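/- **Setting.** Let $\Omega\subset\mathbb R^3$ be an open set of class $C^2$ (bounded or unbounded) contained in an infinite cylinder $\{x:\operatorname{dist}(x,\mathrm{span}\{\xi\})<L\}$ for some unit vector $\xi$ and some $L>0$. Let $N\ge 1$, $r>0$, $R=rN^{-1/3}$, and let $X_1,\dots,X_N\in\Omega$ be such that the balls $B_i=B_R(X_i)$ satisfy $\overline{B_i}\subset\Omega$ and $\overline{B_i}\cap\overline{B_j}=\emptyset$ for $i\ne j$. Let $Q_1,\dots,Q_N\subset\Omega$ be disjoint open cubes, $Q_i$ centred at $X_i$, with $$\frac1{C_1N}\le|Q_i|\le\frac{C_1}{N}\quad\text{and}\quad B_i\subset Q_i\quad\text{for all } i .$$ Put $$\rho_N=\frac1N\sum_{i=1}^N\delta_{X_i},\qquad \bar\rho_N=\frac1N\sum_{i=1}^N\frac{1}{|\partial B_i|}\mathcal H^2_{\partial B_i},\qquad \sigma_N=\frac1N\sum_{i=1}^N\frac1{|Q_i|}\mathbf 1_{Q_i}.$$ Let $n\in L^\infty(\Omega)$ be a probability density on $\Omega$. We use the conditions $$\text{(H1)}\quad \min_{i\ne j}|X_i-X_j|\ge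 cN^{-1/3},\quad \min_i\operatorname{dist}(X_i,\partial\Omega)\ge cN^{-1/3};\qquad \text{(H2)}\quad \mathcal W_\infty(\rho_N,n)\le C_0N^{-1/3},$$ where $\mathcal W_\infty$ is the $\infty$-Wasserstein distance and $c,C_0,C_1>0$. For $k\in\{1,2\}$, $\|\mu-\nu\|_{(W^{k,p}(\Omega))^*}$ is the supremum of $|\langle\mu,v\rangle-\langle\nu,v\rangle|$ over the $v\in W^{k,p}(\Omega)$ of norm at most $1$, where $\mathcal H^2_{\partial B_i}$ acts on $v$ through the trace of $v$ on $\partial B_i$. Write $(s)_+=\max(s,0)$. **Proposition.** Let $p\in(1,\infty)$, $p\ne3$. (i) There is a constant $C$, depending only on $p$ and $C_1$, such that for every such configuration $$\|\bar\rho_N-\sigma_N\|_{(W^{1,p}(\Omega))^*}\le C\,r^{-(3/p-1)_+}N^{-1/3},$$ and, if $p>3/2$, $$\|\bar\rho_N-\sigma_N\|_{(W^{2,p}(\Omega))^*}\le C\,N^{-2/3}.$$ (ii) Let $K\subset\overline\Omega$ be compact. There is a constant $C$, depending only on $p,C_0,c,C_1$ and on $\Omega,K$, such that the following holds. Let $n$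 and $r$ be fixed, and suppose that for each $N$ in an infinite set $I$ of positive integers a configuration as above is given that satisfies (H1), (H2) and $X_i\in K$ for all $i$, with $c,C_0,C_1$ independent of $N$. Then for all $N\in I$ $$\|\sigma_N-n\|_{(W^{1,p}(\Omega))^*}\le C\,N^{-1/3}.$$ (iii) There is a constant $C$, depending only on $p,n,C_0,c$ and on $\Omega$ (in particular not on $C_1$, $N$ or $r$), such that for every configuration as above that satisfies (H1) and (H2) $$\|\bar\rho_N-n\|_{(W^{1,p}(\Omega))^*}\le C\,r^{-(3/p-1)_+}N^{-1/3}.$$ In each case it is part of the claim that the measures involved define functionals on the whole Sobolev space. -/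

import Mathlib

open MeasureTheory Filter Topology Set Metric
open scoped ENNReal NNReal ContDiff

noncomputable section

namespace Sedimentation

/-- Three-dimensional Euclidean space. -/
abbrev E : Type := EuclideanSpace ℝ (Fin 3)

/-! ### Sobolev spaces on an open set -/

/-- `g` is the `j`-th weak partial derivative of `v` on the open set `Ω`. -/
def HasWeakPartial (Ω : Set E) (j : Fin 3) (v g : E → ℝ) : Prop :=
  LocallyIntegrableOn v Ω ∧ LocallyIntegrableOn g Ω ∧
    ∀ φ : E → ℝ, ContDiff ℝ ∞ φ → HasCompactSupport φ → tsupport φ ⊆ Ω →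
      ∫ y in Ω, v y * fderiv ℝ φ y (EuclideanSpace.single j 1) = - ∫ y in Ω, g y * φ y

open Classical in
/-- The `j`-th weak partial derivative of `v` on `Ω` (unique up to null subsets of `Ω`), and `0` if
there is none. -/
def weakPartial (Ω : Set E) (j : Fin 3) (v : E → ℝ) : E → ℝ :=
  if h : ∃ g : E → ℝ, HasWeakPartial Ω j v g then h.choose else 0

/-- `v ∈ W^{k,p}(Ω)`; values of `v` outside `Ω` are irrelevant. -/
def MemSobolev (Ω : Set E) (p : ℝ≥0∞) : ℕ → (E → ℝ) → Prop
  | 0, v => MemLp v p (volume.restrict Ω)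
  | k + 1, v => MemLp v p (volume.restrict Ω) ∧
      ∀ j : Fin 3, (∃ g : E → ℝ, HasWeakPartial Ω j v g) ∧ MemSobolev Ω p k (weakPartial Ω j v)

/-- The `W^{k,p}(Ω)` norm: the sum of the `L^p(Ω)` norms of `v` and of all its iterated weak partial
derivatives of order at most `k`. -/
def sobolevNorm (Ω : Set E) (p : ℝ≥0∞) : ℕ → (E → ℝ) → ℝ≥0∞
  | 0, v => eLpNorm v p (volume.restrict Ω)
  | k + 1, v => eLpNorm v p (volume.restrict Ω) +
      ∑ j : Fin 3, sobolevNorm Ω p k (weakPartial Ω j v)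

/-! ### Measures as elements of the dual of a Sobolev space

A measure that is singular with respect to the Lebesgue measure, such as the surface measure of a
sphere, is tested with a Sobolev function `v` through its precise representative (the limit of the
averages over small balls).  On a smooth surface this is the trace of `v`; for measures with a
density it is `v` itself. -/

/-- The averages of `v` over the balls around `x` converge as the radius tends to `0`. -/
def HasPreciseValue (v : E → ℝ) (x : E) : Prop :=
  ∃ l : ℝ, Tendsto (fun s : ℝ => ⨍ y in ball x s, v y) (𝓝[>] (0 : ℝ)) (𝓝 l)

/-- The precise representative of `v`. -/
def preciseRep (v : E → ℝ) (x : E) : ℝ :=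
  limUnder (𝓝[>] (0 : ℝ)) fun s : ℝ => ⨍ y in ball x s, v y

/-- The pairing `⟨μ, v⟩` is well defined for all `v ∈ W^{k,p}(Ω)`. -/
def ActsOnSobolev (Ω : Set E) (k : ℕ) (p : ℝ≥0∞) (μ : Measure E) : Prop :=
  ∀ v : E → ℝ, MemSobolev Ω p k v →
    (∀ᵐ x ∂μ, HasPreciseValue v x) ∧ Integrable (preciseRep v) μ

/-- The norm of `μ - ν` in the dual of `W^{k,p}(Ω)`: the supremum of `|⟨μ, v⟩ - ⟨ν, v⟩|` over the
unit ball of `W^{k,p}(Ω)`. -/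
def dualDist (Ω : Set E) (k : ℕ) (p : ℝ≥0∞) (μ ν : Measure E) : ℝ≥0∞ :=
  ⨆ (v : E → ℝ) (_ : MemSobolev Ω p k v) (_ : sobolevNorm Ω p k v ≤ 1),
    ENNReal.ofReal |(∫ x, preciseRep v x ∂μ) - ∫ x, preciseRep v x ∂ν|

/-- `μ - ν` is an element of the dual of `W^{k,p}(Ω)`, of norm at most `B`. -/
def DualDistLE (Ω : Set E) (k : ℕ) (p : ℝ) (μ ν : Measure E) (B : ℝ) : Prop :=
  ActsOnSobolev Ω k (ENNReal.ofReal p) μ ∧ ActsOnSobolev Ω k (ENNReal.ofReal p) ν ∧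
    dualDist Ω k (ENNReal.ofReal p) μ ν ≤ ENNReal.ofReal B

/-! ### The infinite Wasserstein distance -/

/-- `W_∞(μ, ν)`: the infimum over all couplings `π` of `μ` and `ν` of the `π`-essential supremum of
`|x - y|` (and `∞` if there is no coupling). -/
def wassersteinInfty (μ ν : Measure E) : ℝ≥0∞ :=
  ⨅ (π : Measure (E × E)) (_ : π.map Prod.fst = μ) (_ : π.map Prod.snd = ν),
    essSup (fun z : E × E => edist z.1 z.2) π

/-! ### The container and the limit density -/

/-- `Ω` is an open set of class `C²`: near each boundary point, and in suitable orthonormal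
coordinates, `Ω` is the set above the graph of a `C²` function. -/
def IsC2Domain (Ω : Set E) : Prop :=
  IsOpen Ω ∧ ∀ x ∈ frontier Ω, ∃ ρ : ℝ, 0 < ρ ∧
    ∃ (b : OrthonormalBasis (Fin 3) ℝ E) (γ : EuclideanSpace ℝ (Fin 2) → ℝ), ContDiff ℝ 2 γ ∧
      ∀ y ∈ ball x ρ, (y ∈ Ω ↔ γ !₂[b.repr y 0, b.repr y 1] < b.repr y 2)

/-- `Ω` is an open set of class `C²` contained in an infinite cylinder with axis `ξ`. -/
def IsContainer (Ω : Set E) : Prop :=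
  IsC2Domain Ω ∧ ∃ ξ : E, ‖ξ‖ = 1 ∧ ∃ L : ℝ, 0 < L ∧
    ∀ x ∈ Ω, infDist x (Submodule.span ℝ {ξ} : Set E) < L

/-- `n` is a bounded probability density on `Ω`. -/
def IsBoundedDensity (Ω : Set E) (n : E → ℝ) : Prop :=
  MemLp n ∞ (volume.restrict Ω) ∧ (∀ᵐ x ∂(volume.restrict Ω), 0 ≤ n x) ∧
    ∫⁻ x in Ω, ENNReal.ofReal (n x) = 1

/-- The measure on `Ω` with density `n`. -/
def densityMeasure (Ω : Set E) (n : E → ℝ) : Measure E :=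
  (volume.restrict Ω).withDensity fun x => ENNReal.ofReal (n x)

/-! ### Particle configurations -/

/-- The length `N^{-1/3}`. -/
def scale (N : ℕ) : ℝ := (N : ℝ) ^ (-(1 / 3 : ℝ))

/-- `N ≥ 1` particles with centres `X i` and radius `r N^{-1/3}`; the balls are compactly contained
in `Ω` and their closures are disjoint. -/
structure IsConfiguration (Ω : Set E) (N : ℕ) (r : ℝ) (X : Fin N → E) : Prop where
  pos_N : 0 < N
  pos_r : 0 < r
  subset : ∀ i, closedBall (X i) (r * scale N) ⊆ Ω
  disjoint : ∀ i j, i ≠ j →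
    Disjoint (closedBall (X i) (r * scale N)) (closedBall (X j) (r * scale N))

/-- `Q` is an open cube, of any orientation, with centre `x`. -/
def IsCubeAt (x : E) (Q : Set E) : Prop :=
  ∃ (b : OrthonormalBasis (Fin 3) ℝ E) (ℓ : ℝ), 0 < ℓ ∧
    Q = {y : E | ∀ k : Fin 3, |b.repr (y - x) k| < ℓ / 2}

/-- Disjoint cubes `Q i ⊆ Ω` with centres `X i`, of volume between `1 / (C₁ N)` and `C₁ / N`, which
contain the balls. -/
structure IsCubeFamily (Ω : Set E) (N : ℕ) (r C₁ : ℝ) (X : Fin N → E) (Q : Fin N → Set E) :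
    Prop where
  cube : ∀ i, IsCubeAt (X i) (Q i)
  subset : ∀ i, Q i ⊆ Ω
  disjoint : ∀ i j, i ≠ j → Disjoint (Q i) (Q j)
  volume_ge : ∀ i, ENNReal.ofReal (1 / (C₁ * N)) ≤ volume (Q i)
  volume_le : ∀ i, volume (Q i) ≤ ENNReal.ofReal (C₁ / N)
  ball_subset : ∀ i, ball (X i) (r * scale N) ⊆ Q i

/-- The centres have distance at least `c N^{-1/3}` from each other and from `∂Ω`. -/
def IsSeparated (Ω : Set E) (N : ℕ) (c : ℝ) (X : Fin N → E) : Prop :=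
  (∀ i j, i ≠ j → c * scale N ≤ dist (X i) (X j)) ∧
    ∀ i, c * scale N ≤ infDist (X i) (frontier Ω)

/-- The empirical measure `ρ_N`. -/
def empiricalMeasure (N : ℕ) (X : Fin N → E) : Measure E :=
  (N : ℝ≥0∞)⁻¹ • ∑ i, Measure.dirac (X i)

/-- The measure `ρ̄_N`: the average of the normalised surface measures of the spheres `∂B_i`. -/
def sphereMeasure (N : ℕ) (r : ℝ) (X : Fin N → E) : Measure E :=
  (N : ℝ≥0∞)⁻¹ • ∑ i, (μH[2] (sphere (X i) (r * scale N)))⁻¹ •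
    (μH[2] : Measure E).restrict (sphere (X i) (r * scale N))

/-- The measure `σ_N`: the average of the normalised Lebesgue measures on the cubes `Q_i`. -/
def cubeMeasure (N : ℕ) (Q : Fin N → Set E) : Measure E :=
  (N : ℝ≥0∞)⁻¹ • ∑ i, (volume (Q i))⁻¹ • (volume : Measure E).restrict (Q i)

/-- The empirical measure is `C₀ N^{-1/3}`-close to `n` in the infinite Wasserstein distance. -/
def IsCloseTo (Ω : Set E) (n : E → ℝ) (N : ℕ) (C₀ : ℝ) (X : Fin N → E) : Prop :=
  wassersteinInfty (empiricalMeasure N X) (densityMeasure Ω n) ≤ ENNReal.ofReal (C₀ * scale N)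

end Sedimentation

end

/-!
All three estimates reduce to a pointwise potential estimate. If `Q` is an open convex subset of `Ω`
of diameter of order `D`, if `Z ⊆ Q` has volume of order `D ^ 3`, and if `x ∈ Q`, then the precise
value of a Sobolev function `v` at `x` differs from the average of `v` over `Z` by at most a
constant times `∫ z in Q, |∇v z| |x - z|⁻²` (`exists_enorm_preciseRep_sub_average_le`; the smooth
case is transferred by mollification, and the precise value exists wherever the potential is
finite). It remains to integrate this potential against the measures at hand.

* *Surface measures against averages over cells.* By Hölder's inequality the potential of
  `G ∈ L^p(Q)` has integral at most `C R^(1 - 3/p) ‖G‖_p` (for `p < 3`) or `C D^(1 - 3/p) ‖G‖_p`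
  (for `p > 3`) against the normalised surface measure of a sphere of radius `R` in `Q`
  (`exists_lintegral_pot_sphereProb_le`). Here `p < 3` requires a splitting of the kernel near the
  sphere, where `|x - z|⁻²` is not uniformly integrable. Summation over the disjoint cells, by
  Jensen's inequality, gives the first estimate (`exists_sphereMeasure_sub_cubeMeasure_le`). Since a
  sphere and a cube have the same centre of mass, an affine function may be subtracted from `v`; the
  gradient of the difference is again controlled by a potential, and the composition of two kernels
  `|x - z|⁻²` is of order `|x - z|⁻¹`. This gains another factor `N^(-1/3)`
  (`exists_sphere_sub_cell_le_second`).

* *Measures with bounded density.* On a compact set, a `C²` domain has a uniform interior cone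
  property (`IsC2Domain.exists_hasInteriorCone`). Hence for each particle `X i` there is a ball
  `Z i` of radius `N^(-1/3)`, at distance of order `N^(-1/3)`, such that the convex hull of `Z i`
  and a small ball around any `y ∈ Ω` near `X i` lies in `Ω`, even if the segment from `y` to `X i`
  does not. Two probability measures with bounded density, each composed of pieces of mass `1 / N`
  near the particles, are both compared with the mean of the averages of `v` over the `Z i`, and the
  truncated potential is integrated by Hölder's inequality
  (`IsC2Domain.exists_enorm_integral_sub_le`). A coupling of the empirical measure with `n` splits
  `n` into such pieces (`IsCloseTo.exists_split`).

For `σ_N` against `n`, the density `n` has to be bounded in terms of `c` and `C₀` alone: by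
separation a ball of radius `N^(-1/3)` has mass at most `C / N`, and the Lebesgue differentiation
theorem applies along the infinite set of admissible `N`. For `ρ̄_N` against `n`, the cubes are
replaced by disjoint balls around the particles whose radii are bounded below in terms of `c`, which
removes the dependence on `C₁`; all particles lie in a compact set since `n` has bounded support as
soon as there is one admissible configuration, and `r` is bounded since the balls are disjoint and
lie in a cylinder.
-/

noncomputable section

namespace Sedimentation

/-! ### The surface measure of a sphere -/

/-- The two coordinates of a point other than the `k`-th one, with the sup norm. -/
def dropCoord (k : Fin 3) (z : E) : Fin 2 → ℝ := fun i => z (k.succAbove i)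

theorem norm_apply_le (z : E) (k : Fin 3) : |z k| ≤ ‖z‖ := by
  simpa using PiLp.norm_apply_le z k

theorem dist_sq_eq (z w : E) :
    dist z w ^ 2 = (z 0 - w 0) ^ 2 + (z 1 - w 1) ^ 2 + (z 2 - w 2) ^ 2 := by
  rw [EuclideanSpace.dist_eq, Real.sq_sqrt (by positivity), Fin.sum_univ_three]
  simp [Real.dist_eq, sq_abs]

theorem lipschitzWith_dropCoord (k : Fin 3) : LipschitzWith 1 (dropCoord k) := by
  refine LipschitzWith.of_dist_le_mul fun z w => ?_
  rw [NNReal.coe_one, one_mul, dist_pi_le_iff dist_nonneg]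
  intro i
  simpa [dropCoord, Real.dist_eq, dist_eq_norm] using norm_apply_le (z - w) (k.succAbove i)

theorem hausdorffMeasure_two_eq : (μH[2] : Measure (Fin 2 → ℝ)) = volume := by
  have := hausdorffMeasure_pi_real (ι := Fin 2)
  simpa using this

/-- The projection of a sphere to a coordinate plane, which does not increase the Hausdorff measure,
contains a square of side `R`. -/
theorem hausdorffMeasure_sphere_ge (x : E) {R : ℝ} (hR : 0 < R) :
    ENNReal.ofReal (R ^ 2) ≤ μH[2] (sphere x R) := by
  have h1 : closedBall (dropCoord 2 x) (R / 2) ⊆ dropCoord 2 '' sphere x R := by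
    intro a ha
    rw [mem_closedBall, dist_pi_le_iff (by positivity)] at ha
    have h0 := ha 0
    have h1 := ha 1
    have e0 : dropCoord 2 x 0 = x 0 := rfl
    have e1 : dropCoord 2 x 1 = x 1 := rfl
    rw [Real.dist_eq, e0] at h0
    rw [Real.dist_eq, e1] at h1
    have h0' := sq_le_sq' (by linarith [(abs_le.1 h0).1]) (abs_le.1 h0).2
    have h1' := sq_le_sq' (by linarith [(abs_le.1 h1).1]) (abs_le.1 h1).2
    set t := √(R ^ 2 - (a 0 - x 0) ^ 2 - (a 1 - x 1) ^ 2) with ht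
    have ht2 : t ^ 2 = R ^ 2 - (a 0 - x 0) ^ 2 - (a 1 - x 1) ^ 2 :=
      Real.sq_sqrt (by nlinarith)
    refine ⟨!₂[a 0, a 1, x 2 + t], ?_, ?_⟩
    · rw [mem_sphere, ← sq_eq_sq₀ dist_nonneg hR.le, dist_sq_eq]
      simp [ht2]
    · ext i
      fin_cases i <;> rfl
  calc ENNReal.ofReal (R ^ 2) = volume (closedBall (dropCoord 2 x) (R / 2)) := by
        rw [Real.volume_pi_closedBall _ (by positivity)]
        congr 1
        simp [mul_div_cancel₀]
    _ ≤ μH[2] (dropCoord 2 '' sphere x R) := by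
        rw [hausdorffMeasure_two_eq]; exact measure_mono h1
    _ ≤ μH[2] (sphere x R) := by
        have := (lipschitzWith_dropCoord 2).hausdorffMeasure_image_le (d := 2) (by norm_num)
          (sphere x R)
        simpa using this

/-- The part of a sphere on which the `k`-th coordinate is at least half the radius, in the
direction of the sign `σ`; it is a Lipschitz graph over the other two coordinates. -/
def sphereCap (x : E) (R : ℝ) (k : Fin 3) (σ : ℝ) : Set E :=
  {z ∈ sphere x R | R / 2 ≤ σ * (z k - x k)}

theorem dist_le_of_mem_sphereCap {x : E} {R : ℝ} (hR : 0 < R) {k : Fin 3} {σ : ℝ}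
    (hσ : σ = 1 ∨ σ = -1) {z w : E} (hz : z ∈ sphereCap x R k σ) (hw : w ∈ sphereCap x R k σ) :
    dist z w ≤ 5 * dist (dropCoord k z) (dropCoord k w) := by
  obtain ⟨hz1, hz2⟩ := hz
  obtain ⟨hw1, hw2⟩ := hw
  set m := dist (dropCoord k z) (dropCoord k w) with hm
  have hm0 : 0 ≤ m := dist_nonneg
  have hc : ∀ i, |z (k.succAbove i) - w (k.succAbove i)| ≤ m := fun i => by
    have := dist_le_pi_dist (dropCoord k z) (dropCoord k w) i
    simpa [Real.dist_eq, dropCoord] using this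
  have bz : ∀ j, |z j - x j| ≤ R := fun j => by
    have := norm_apply_le (z - x) j
    rw [← dist_eq_norm, mem_sphere.1 hz1] at this
    simpa using this
  have bw : ∀ j, |w j - x j| ≤ R := fun j => by
    have := norm_apply_le (w - x) j
    rw [← dist_eq_norm, mem_sphere.1 hw1] at this
    simpa using this
  have hz3 : dist z x ^ 2 = R ^ 2 := by rw [mem_sphere.1 hz1]
  have hw3 : dist w x ^ 2 = R ^ 2 := by rw [mem_sphere.1 hw1]
  rw [EuclideanSpace.dist_eq, Real.sq_sqrt (by positivity), Fin.sum_univ_succAbove _ k,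
    Fin.sum_univ_two] at hz3 hw3
  simp only [Real.dist_eq, sq_abs] at hz3 hw3
  refine abs_le_of_sq_le_sq' ?_ (by positivity) |>.2
  rw [EuclideanSpace.dist_eq, Real.sq_sqrt (by positivity), Fin.sum_univ_succAbove _ k,
    Fin.sum_univ_two]
  simp only [Real.dist_eq, sq_abs]
  have h0 := hc 0
  have h1 := hc 1
  have z0 := bz (k.succAbove 0)
  have z1 := bz (k.succAbove 1)
  have w0 := bw (k.succAbove 0)
  have w1 := bw (k.succAbove 1)
  generalize z (k.succAbove 0) = a0 at *
  generalize z (k.succAbove 1) = a1 at *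
  generalize w (k.succAbove 0) = b0 at *
  generalize w (k.succAbove 1) = b1 at *
  generalize x (k.succAbove 0) = c0 at *
  generalize x (k.succAbove 1) = c1 at *
  generalize z k = a at *
  generalize w k = b at *
  generalize x k = c at *
  -- the difference of the squares of the `k`-th coordinates is controlled by the other two
  have key : |a - b| ≤ 4 * m := by
    have e : (a - b) * ((a - c) + (b - c)) =
        -((a0 - b0) * ((a0 - c0) + (b0 - c0)) + (a1 - b1) * ((a1 - c1) + (b1 - c1))) := by
      nlinarith
    have l1 : |(a - b) * ((a - c) + (b - c))| ≤ m * (2 * R) + m * (2 * R) := by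
      rw [e, abs_neg]
      refine (abs_add_le _ _).trans ?_
      rw [abs_mul, abs_mul]
      gcongr
      · exact (abs_add_le _ _).trans (by linarith)
      · exact (abs_add_le _ _).trans (by linarith)
    have l2 : R ≤ |(a - c) + (b - c)| := by
      rcases hσ with rfl | rfl
      · exact le_trans (by linarith) (le_abs_self _)
      · exact le_trans (by linarith) (neg_le_abs _)
    rw [abs_mul] at l1
    have : |a - b| * R ≤ 4 * m * R := by
      calc |a - b| * R ≤ |a - b| * |(a - c) + (b - c)| := by gcongr
        _ ≤ _ := l1
        _ = _ := by ring
    exact le_of_mul_le_mul_right this hR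
  have s := sq_le_sq' (by linarith [(abs_le.1 key).1]) (abs_le.1 key).2
  have s0 := sq_le_sq' (by linarith [(abs_le.1 h0).1]) (abs_le.1 h0).2
  have s1 := sq_le_sq' (by linarith [(abs_le.1 h1).1]) (abs_le.1 h1).2
  nlinarith

/-- A spherical cap is a Lipschitz image of its projection to a coordinate plane. -/
theorem hausdorffMeasure_sphereCap_le {x : E} {R : ℝ} (hR : 0 < R) {k : Fin 3} {σ : ℝ}
    (hσ : σ = 1 ∨ σ = -1) (y : E) {s : ℝ} (hs : 0 ≤ s) :
    μH[2] (sphereCap x R k σ ∩ closedBall y s) ≤ ENNReal.ofReal (100 * s ^ 2) := by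
  set P := sphereCap x R k σ ∩ closedBall y s
  have hd : ∀ z ∈ P, ∀ w ∈ P, dist z w ≤ 5 * dist (dropCoord k z) (dropCoord k w) :=
    fun z hz w hw => dist_le_of_mem_sphereCap hR hσ hz.1 hw.1
  have hinj : InjOn (dropCoord k) P := fun z hz w hw h => by
    have := hd z hz w hw
    rw [h, dist_self, mul_zero] at this
    exact dist_le_zero.1 this
  set g := Function.invFunOn (dropCoord k) P
  have hg : ∀ z ∈ P, g (dropCoord k z) = z := fun z hz => hinj.leftInvOn_invFunOn hz
  have hL : LipschitzOnWith 5 g (dropCoord k '' P) := by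
    refine LipschitzOnWith.of_dist_le_mul ?_
    rintro _ ⟨z, hz, rfl⟩ _ ⟨w, hw, rfl⟩
    rw [hg z hz, hg w hw]
    exact hd z hz w hw
  have himg : g '' (dropCoord k '' P) = P := hinj.leftInvOn_invFunOn.image_image
  calc μH[2] P = μH[2] (g '' (dropCoord k '' P)) := by rw [himg]
    _ ≤ ((5 : ℝ≥0) : ℝ≥0∞) ^ (2 : ℝ) * μH[2] (dropCoord k '' P) :=
        hL.hausdorffMeasure_image_le (by norm_num)
    _ ≤ ((5 : ℝ≥0) : ℝ≥0∞) ^ (2 : ℝ) * volume (closedBall (dropCoord k y) s) := by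
        rw [hausdorffMeasure_two_eq]
        gcongr
        rintro _ ⟨z, hz, rfl⟩
        rw [mem_closedBall]
        have := (lipschitzWith_dropCoord k).dist_le_mul z y
        rw [NNReal.coe_one, one_mul] at this
        exact this.trans hz.2
    _ = ENNReal.ofReal (100 * s ^ 2) := by
        rw [Real.volume_pi_closedBall _ hs]
        have : (((5 : ℝ≥0) : ℝ≥0∞) ^ (2 : ℝ)) = ENNReal.ofReal 25 := by
          rw [show (2 : ℝ) = ((2 : ℕ) : ℝ) by norm_num, ENNReal.rpow_natCast]
          rw [ENNReal.ofReal_eq_coe_nnreal (by norm_num)]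
          rw [← ENNReal.coe_pow]
          congr 1
          ext
          norm_num
        rw [this, ← ENNReal.ofReal_mul (by norm_num)]
        congr 1
        simp
        ring

theorem sphere_subset_iUnion_sphereCap (x : E) {R : ℝ} :
    sphere x R ⊆ ⋃ k : Fin 3, (sphereCap x R k 1 ∪ sphereCap x R k (-1)) := by
  intro z hz
  by_contra hcon
  simp only [mem_iUnion, mem_union, sphereCap, mem_ofPred_eq, not_exists, not_or, not_and, not_le]
    at hcon
  have hlt : ∀ k, |z k - x k| < R / 2 := fun k => by
    rw [abs_lt]
    have h1 := (hcon k).1 hz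
    have h2 := (hcon k).2 hz
    constructor <;> linarith
  have e := dist_sq_eq z x
  rw [mem_sphere.1 hz] at e
  have hsq : ∀ k, (z k - x k) ^ 2 ≤ (R / 2) ^ 2 := fun k =>
    sq_le_sq' (by linarith [(abs_lt.1 (hlt k)).1]) (abs_lt.1 (hlt k)).2.le
  have hpos : 0 < R := by
    have := (abs_nonneg _).trans_lt (hlt 0)
    linarith
  nlinarith [hsq 0, hsq 1, hsq 2]

theorem hausdorffMeasure_sphere_inter_le (x : E) {R : ℝ} (hR : 0 < R) (y : E) {s : ℝ}
    (hs : 0 ≤ s) :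
    μH[2] (sphere x R ∩ closedBall y s) ≤ ENNReal.ofReal (600 * s ^ 2) := by
  calc μH[2] (sphere x R ∩ closedBall y s)
      ≤ μH[2] (⋃ k : Fin 3, ((sphereCap x R k 1 ∩ closedBall y s) ∪
          (sphereCap x R k (-1) ∩ closedBall y s))) := by
        refine measure_mono fun z hz => ?_
        obtain ⟨k, hk⟩ := mem_iUnion.1 (sphere_subset_iUnion_sphereCap x hz.1)
        exact mem_iUnion.2 ⟨k, hk.imp (fun h => ⟨h, hz.2⟩) fun h => ⟨h, hz.2⟩⟩
    _ ≤ ∑ k : Fin 3, μH[2] ((sphereCap x R k 1 ∩ closedBall y s) ∪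
          (sphereCap x R k (-1) ∩ closedBall y s)) := measure_iUnion_fintype_le _ _
    _ ≤ ∑ _k : Fin 3, ENNReal.ofReal (200 * s ^ 2) := by
        refine Finset.sum_le_sum fun k _ => (measure_union_le _ _).trans ?_
        refine (add_le_add (hausdorffMeasure_sphereCap_le hR (Or.inl rfl) y hs)
          (hausdorffMeasure_sphereCap_le hR (Or.inr rfl) y hs)).trans ?_
        rw [← ENNReal.ofReal_add (by positivity) (by positivity)]
        exact ENNReal.ofReal_le_ofReal (by linarith)
    _ = ENNReal.ofReal (600 * s ^ 2) := by
        rw [← ENNReal.ofReal_sum_of_nonneg fun _ _ => by positivity]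
        congr 1
        rw [Fin.sum_univ_three]
        ring

/-- The normalised surface measure of a sphere. -/
def sphereProb (x : E) (R : ℝ) : Measure E :=
  (μH[2] (sphere x R))⁻¹ • (μH[2] : Measure E).restrict (sphere x R)

theorem hausdorffMeasure_sphere_ne_zero (x : E) {R : ℝ} (hR : 0 < R) : μH[2] (sphere x R) ≠ 0 := by
  have := hausdorffMeasure_sphere_ge x hR
  intro h
  rw [h, nonpos_iff_eq_zero, ENNReal.ofReal_eq_zero] at this
  have : 0 < R ^ 2 := by positivity
  linarith

theorem hausdorffMeasure_sphere_ne_top (x : E) {R : ℝ} (hR : 0 < R) : μH[2] (sphere x R) ≠ ⊤ := by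
  have := hausdorffMeasure_sphere_inter_le x hR x hR.le
  rw [inter_eq_left.2 sphere_subset_closedBall] at this
  exact (this.trans_lt ENNReal.ofReal_lt_top).ne

theorem isProbabilityMeasure_sphereProb (x : E) {R : ℝ} (hR : 0 < R) :
    IsProbabilityMeasure (sphereProb x R) := by
  refine ⟨?_⟩
  rw [sphereProb, Measure.smul_apply, Measure.restrict_apply_univ, smul_eq_mul]
  exact ENNReal.inv_mul_cancel (hausdorffMeasure_sphere_ne_zero x hR)
    (hausdorffMeasure_sphere_ne_top x hR)

theorem ae_mem_sphere_sphereProb (x : E) (R : ℝ) : ∀ᵐ y ∂(sphereProb x R), y ∈ sphere x R :=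
  Measure.ae_smul_measure (ae_restrict_mem isClosed_sphere.measurableSet) _

/-- A ball of radius `s` carries at most a fraction `600 (s / R)²` of the area of a sphere. -/
theorem sphereProb_closedBall_le (x : E) {R : ℝ} (hR : 0 < R) (y : E) {s : ℝ} (hs : 0 ≤ s) :
    sphereProb x R (closedBall y s) ≤ ENNReal.ofReal (600 * (R ^ 2)⁻¹ * s ^ 2) := by
  rw [sphereProb, Measure.smul_apply, Measure.restrict_apply isClosed_closedBall.measurableSet,
    smul_eq_mul, inter_comm]
  calc _ ≤ (ENNReal.ofReal (R ^ 2))⁻¹ * ENNReal.ofReal (600 * s ^ 2) := by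
        gcongr
        · exact hausdorffMeasure_sphere_ge x hR
        · exact hausdorffMeasure_sphere_inter_le x hR y hs
    _ = _ := by
        rw [← ENNReal.ofReal_inv_of_pos (by positivity), ← ENNReal.ofReal_mul (by positivity)]
        congr 1
        ring

theorem sphereProb_singleton (x : E) (R : ℝ) (hR : 0 < R) (y : E) : sphereProb x R {y} = 0 := by
  have := sphereProb_closedBall_le x hR y (le_refl 0)
  simpa using this

theorem map_reflection_sphereProb (x : E) (R : ℝ) :
    (sphereProb x R).map (fun y => x + (x - y)) = sphereProb x R := by
  let e : E ≃ᵢ E := (IsometryEquiv.subLeft x).trans (IsometryEquiv.addLeft x)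
  have he : ⇑e = fun y => x + (x - y) := rfl
  have hp : e ⁻¹' sphere x R = sphere x R := by
    ext y
    simp [he, norm_sub_rev]
  rw [sphereProb, Measure.map_smul, ← he]
  have := (e.measurePreserving_hausdorffMeasure 2).restrict_preimage
    (isClosed_sphere (x := x) (ε := R)).measurableSet
  rw [hp] at this
  rw [this.map_eq]

/-! ### Riesz kernels -/

/-- The Riesz kernel `|x - y|^{-β}`, with the value `∞` on the diagonal if `β > 0`. -/
def kern (β : ℝ) (x y : E) : ℝ≥0∞ := (edist x y)⁻¹ ^ β

theorem kern_comm (β : ℝ) (x y : E) : kern β x y = kern β y x := by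
  rw [kern, kern, edist_comm]

theorem measurable_kern (β : ℝ) (x : E) : Measurable (kern β x) := by
  unfold kern; fun_prop

theorem measurable_kern_uncurry (β : ℝ) : Measurable fun z : E × E => kern β z.1 z.2 := by
  unfold kern; fun_prop

theorem kern_add {α β : ℝ} (hα : 0 ≤ α) (hβ : 0 ≤ β) (x y : E) :
    kern (α + β) x y = kern α x y * kern β x y :=
  ENNReal.rpow_add_of_nonneg _ _ hα hβ

theorem kern_rpow (α β : ℝ) (x y : E) : kern α x y ^ β = kern (α * β) x y := by
  rw [kern, kern, ENNReal.rpow_mul]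

theorem kern_self {β : ℝ} (hβ : 0 < β) (x : E) : kern β x x = ⊤ := by
  simp [kern, hβ]

theorem kern_eq_ofReal (β : ℝ) {x y : E} (h : x ≠ y) :
    kern β x y = ENNReal.ofReal (dist x y ^ (-β)) := by
  have hd : 0 < dist x y := dist_pos.2 h
  rw [kern, edist_dist, ← ENNReal.ofReal_inv_of_pos hd, ENNReal.ofReal_rpow_of_pos (by positivity),
    Real.inv_rpow hd.le, Real.rpow_neg hd.le]

theorem kern_le_of_dist_le {β c : ℝ} (hβ : 0 ≤ β) (hc : 0 < c) {a b x z : E}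
    (h : dist a b ≤ c * dist x z) : kern β x z ≤ ENNReal.ofReal (c ^ β) * kern β a b := by
  have h1 : (edist x z)⁻¹ ≤ ENNReal.ofReal c * (edist a b)⁻¹ := by
    have h2 : edist a b ≤ ENNReal.ofReal c * edist x z := by
      rw [edist_dist, edist_dist, ← ENNReal.ofReal_mul hc.le]
      exact ENNReal.ofReal_le_ofReal h
    have hc0 : ENNReal.ofReal c ≠ 0 := by simpa using hc
    calc (edist x z)⁻¹ = ENNReal.ofReal c * (ENNReal.ofReal c * edist x z)⁻¹ := by
          rw [ENNReal.mul_inv (Or.inl hc0) (Or.inl ENNReal.ofReal_ne_top), ← mul_assoc,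
            ENNReal.mul_inv_cancel hc0 ENNReal.ofReal_ne_top, one_mul]
      _ ≤ _ := by gcongr
  calc kern β x z ≤ (ENNReal.ofReal c * (edist a b)⁻¹) ^ β := ENNReal.rpow_le_rpow h1 hβ
    _ = _ := by
      rw [ENNReal.mul_rpow_of_nonneg _ _ hβ, ENNReal.ofReal_rpow_of_pos hc, kern]

theorem kern_le_ofReal {β s : ℝ} (hβ : 0 ≤ β) (hs : 0 < s) {x y : E} (h : s ≤ dist x y) :
    kern β x y ≤ ENNReal.ofReal (s ^ (-β)) := by
  rw [kern_eq_ofReal β (dist_pos.1 (hs.trans_le h))]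
  exact ENNReal.ofReal_le_ofReal (Real.rpow_le_rpow_of_nonpos hs h (by linarith))

/-- Dyadic summation near the pole: if the balls around `y` have measure at most `A s^d` then the
kernel of order `β < d` is integrable near `y`. -/
theorem lintegral_kern_closedBall_le {β d : ℝ} (hβ : 0 ≤ β) (hd : β < d) :
    ∃ C : ℝ, 0 ≤ C ∧ ∀ (μ : Measure E) (y : E) (R A : ℝ), 0 < R → 0 ≤ A →
      (∀ s, 0 < s → s ≤ R → μ (closedBall y s) ≤ ENNReal.ofReal (A * s ^ d)) →
      ∫⁻ x in closedBall y R, kern β y x ∂μ ≤ ENNReal.ofReal (C * A * R ^ (d - β)) := by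
  set q : ℝ := 2 ^ (-(d - β)) with hq
  have hq0 : 0 < q := by positivity
  have hq1 : q < 1 := Real.rpow_lt_one_of_one_lt_of_neg one_lt_two (by linarith)
  have hq1' : 0 < 1 - q := by linarith
  refine ⟨2 ^ β * (1 - q)⁻¹, by positivity, fun μ y R A hR hA hμ => ?_⟩
  have hpt : ∀ x ∈ closedBall y R, kern β y x ≤
      ∑' k : ℕ, (closedBall y (R / 2 ^ k)).indicator
        (fun _ => ENNReal.ofReal ((R / 2 ^ (k + 1)) ^ (-β))) x := by
    intro x hx
    rcases eq_or_ne y x with rfl | hne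
    · rcases hβ.eq_or_lt with rfl | hβ
      · refine le_trans ?_ (ENNReal.le_tsum 0)
        simp [kern, hR.le]
      · have hc : ENNReal.ofReal ((R / 2) ^ (-β)) ≠ 0 := by
          rw [ne_eq, ENNReal.ofReal_eq_zero, not_le]; positivity
        refine le_top.trans ?_
        rw [← ENNReal.tsum_const_eq_top_of_ne_zero (α := ℕ) hc]
        refine ENNReal.tsum_le_tsum fun k => ?_
        rw [indicator_of_mem (by simp; positivity)]
        refine ENNReal.ofReal_le_ofReal (Real.rpow_le_rpow_of_nonpos (by positivity) ?_
          (by linarith))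
        gcongr
        rw [pow_succ]
        nlinarith [one_le_pow₀ (M₀ := ℝ) one_le_two (n := k)]
    · have hd0 : 0 < dist y x := dist_pos.2 hne
      have h1 : dist y x / R ≤ 1 := by
        rw [div_le_one hR, dist_comm]; exact hx
      obtain ⟨k, hk1, hk2⟩ := exists_nat_pow_near_of_lt_one (x := dist y x / R) (y := 1 / 2)
        (by positivity) h1 (by norm_num) (by norm_num)
      refine le_trans ?_ (ENNReal.le_tsum k)
      rw [lt_div_iff₀ hR] at hk1
      rw [div_le_iff₀ hR] at hk2
      have e1 : (1 / 2 : ℝ) ^ (k + 1) * R = R / 2 ^ (k + 1) := by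
        rw [one_div, inv_pow]; field_simp
      have e2 : (1 / 2 : ℝ) ^ k * R = R / 2 ^ k := by rw [one_div, inv_pow]; field_simp
      rw [e1] at hk1
      rw [e2] at hk2
      rw [indicator_of_mem (by rw [mem_closedBall, dist_comm]; exact hk2)]
      exact kern_le_ofReal hβ (by positivity) hk1.le
  have hterm : ∀ k : ℕ, ENNReal.ofReal ((R / 2 ^ (k + 1)) ^ (-β)) * μ (closedBall y (R / 2 ^ k)) ≤
      ENNReal.ofReal (2 ^ β * A * R ^ (d - β) * q ^ k) := by
    intro k
    have h2k : (1 : ℝ) ≤ 2 ^ k := one_le_pow₀ one_le_two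
    refine (mul_le_mul_right (hμ (R / 2 ^ k) (by positivity) (div_le_self hR.le h2k)) _).trans ?_
    rw [← ENNReal.ofReal_mul (by positivity)]
    refine ENNReal.ofReal_le_ofReal (le_of_eq ?_)
    have e : q ^ k = ((2 : ℝ) ^ k) ^ (β - d) := by
      rw [hq, ← Real.rpow_natCast, ← Real.rpow_mul (by norm_num), mul_comm,
        Real.rpow_mul (by norm_num), Real.rpow_natCast]
      congr 1; ring
    rw [e, pow_succ]
    generalize (2 : ℝ) ^ k = t at *
    have ht : 0 < t := by linarith
    rw [Real.rpow_sub ht, Real.rpow_sub hR, Real.div_rpow hR.le (by positivity),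
      Real.div_rpow hR.le (by positivity), Real.mul_rpow (by positivity) (by positivity),
      Real.rpow_neg hR.le, Real.rpow_neg ht.le, Real.rpow_neg (by norm_num)]
    field_simp
  calc ∫⁻ x in closedBall y R, kern β y x ∂μ
      ≤ ∫⁻ x in closedBall y R, ∑' k : ℕ, (closedBall y (R / 2 ^ k)).indicator
        (fun _ => ENNReal.ofReal ((R / 2 ^ (k + 1)) ^ (-β))) x ∂μ :=
        setLIntegral_mono' isClosed_closedBall.measurableSet hpt
    _ ≤ ∫⁻ x, ∑' k : ℕ, (closedBall y (R / 2 ^ k)).indicator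
        (fun _ => ENNReal.ofReal ((R / 2 ^ (k + 1)) ^ (-β))) x ∂μ := setLIntegral_le_lintegral _ _
    _ = ∑' k : ℕ, ENNReal.ofReal ((R / 2 ^ (k + 1)) ^ (-β)) * μ (closedBall y (R / 2 ^ k)) := by
        rw [lintegral_tsum fun k =>
          (measurable_const.indicator isClosed_closedBall.measurableSet).aemeasurable]
        refine tsum_congr fun k => ?_
        rw [lintegral_indicator isClosed_closedBall.measurableSet, setLIntegral_const]
    _ ≤ ∑' k : ℕ, ENNReal.ofReal (2 ^ β * A * R ^ (d - β) * q ^ k) := ENNReal.tsum_le_tsum hterm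
    _ = ENNReal.ofReal (2 ^ β * (1 - q)⁻¹ * A * R ^ (d - β)) := by
        rw [← ENNReal.ofReal_tsum_of_nonneg (fun k => by positivity)
          ((summable_geometric_of_lt_one hq0.le hq1).mul_left _), tsum_mul_left,
          tsum_geometric_of_lt_one hq0.le hq1]
        congr 1; ring

/-- Dyadic summation away from the pole, for kernels of order `β > d`. -/
theorem lintegral_kern_compl_ball_le {β d : ℝ} (hd0 : 0 ≤ d) (hd : d < β) :
    ∃ C : ℝ, 0 ≤ C ∧ ∀ (μ : Measure E) (y : E) (R A : ℝ), 0 < R → 0 ≤ A →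
      (∀ s, R ≤ s → μ (closedBall y s) ≤ ENNReal.ofReal (A * s ^ d)) →
      ∫⁻ x in (ball y R)ᶜ, kern β y x ∂μ ≤ ENNReal.ofReal (C * A * R ^ (d - β)) := by
  have hβ : 0 ≤ β := by linarith
  set q : ℝ := 2 ^ (d - β) with hq
  have hq0 : 0 < q := by positivity
  have hq1 : q < 1 := Real.rpow_lt_one_of_one_lt_of_neg one_lt_two (by linarith)
  have hq1' : 0 < 1 - q := by linarith
  refine ⟨2 ^ d * (1 - q)⁻¹, by positivity, fun μ y R A hR hA hμ => ?_⟩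
  have hpt : ∀ x ∈ (ball y R)ᶜ, kern β y x ≤
      ∑' k : ℕ, (closedBall y (R * 2 ^ (k + 1))).indicator
        (fun _ => ENNReal.ofReal ((R * 2 ^ k) ^ (-β))) x := by
    intro x hx
    have h1 : 1 ≤ dist y x / R := by
      rw [one_le_div hR, dist_comm]; simpa using hx
    obtain ⟨k, hk1, hk2⟩ := exists_nat_pow_near h1 one_lt_two
    refine le_trans ?_ (ENNReal.le_tsum k)
    rw [le_div_iff₀ hR, mul_comm] at hk1
    rw [div_lt_iff₀ hR, mul_comm] at hk2
    rw [indicator_of_mem (by rw [mem_closedBall, dist_comm]; exact hk2.le)]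
    exact kern_le_ofReal hβ (by positivity) hk1
  have hterm : ∀ k : ℕ, ENNReal.ofReal ((R * 2 ^ k) ^ (-β)) * μ (closedBall y (R * 2 ^ (k + 1))) ≤
      ENNReal.ofReal (2 ^ d * A * R ^ (d - β) * q ^ k) := by
    intro k
    have h2k : (1 : ℝ) ≤ 2 ^ (k + 1) := one_le_pow₀ one_le_two
    refine (mul_le_mul_right (hμ (R * 2 ^ (k + 1)) (le_mul_of_one_le_right hR.le h2k)) _).trans ?_
    rw [← ENNReal.ofReal_mul (by positivity)]
    refine ENNReal.ofReal_le_ofReal (le_of_eq ?_)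
    have e : q ^ k = ((2 : ℝ) ^ k) ^ (d - β) := by
      rw [hq, ← Real.rpow_natCast, ← Real.rpow_mul (by norm_num), mul_comm,
        Real.rpow_mul (by norm_num), Real.rpow_natCast]
    rw [e, pow_succ]
    have ht : (0 : ℝ) < 2 ^ k := by positivity
    generalize (2 : ℝ) ^ k = t at *
    rw [Real.rpow_sub ht, Real.rpow_sub hR, Real.mul_rpow hR.le (by positivity),
      Real.mul_rpow hR.le (by positivity), Real.mul_rpow (by positivity) (by positivity),
      Real.rpow_neg hR.le, Real.rpow_neg ht.le]
    field_simp
  calc ∫⁻ x in (ball y R)ᶜ, kern β y x ∂μ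
      ≤ ∫⁻ x in (ball y R)ᶜ, ∑' k : ℕ, (closedBall y (R * 2 ^ (k + 1))).indicator
        (fun _ => ENNReal.ofReal ((R * 2 ^ k) ^ (-β))) x ∂μ :=
        setLIntegral_mono' isOpen_ball.measurableSet.compl hpt
    _ ≤ ∫⁻ x, ∑' k : ℕ, (closedBall y (R * 2 ^ (k + 1))).indicator
        (fun _ => ENNReal.ofReal ((R * 2 ^ k) ^ (-β))) x ∂μ := setLIntegral_le_lintegral _ _
    _ = ∑' k : ℕ, ENNReal.ofReal ((R * 2 ^ k) ^ (-β)) * μ (closedBall y (R * 2 ^ (k + 1))) := by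
        rw [lintegral_tsum fun k =>
          (measurable_const.indicator isClosed_closedBall.measurableSet).aemeasurable]
        refine tsum_congr fun k => ?_
        rw [lintegral_indicator isClosed_closedBall.measurableSet, setLIntegral_const]
    _ ≤ ∑' k : ℕ, ENNReal.ofReal (2 ^ d * A * R ^ (d - β) * q ^ k) := ENNReal.tsum_le_tsum hterm
    _ = ENNReal.ofReal (2 ^ d * (1 - q)⁻¹ * A * R ^ (d - β)) := by
        rw [← ENNReal.ofReal_tsum_of_nonneg (fun k => by positivity)
          ((summable_geometric_of_lt_one hq0.le hq1).mul_left _), tsum_mul_left,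
          tsum_geometric_of_lt_one hq0.le hq1]
        congr 1; ring

/-- The volume of the unit ball. -/
def unitVol : ℝ := (volume (ball (0 : E) 1)).toReal

theorem unitVol_pos : 0 < unitVol :=
  ENNReal.toReal_pos (measure_ball_pos _ _ one_pos).ne' measure_ball_lt_top.ne

theorem volume_closedBall_eq (x : E) {s : ℝ} (hs : 0 ≤ s) :
    volume (closedBall x s) = ENNReal.ofReal (unitVol * s ^ 3) := by
  rw [Measure.addHaar_closedBall _ _ hs, finrank_euclideanSpace_fin, unitVol, mul_comm,
    ENNReal.ofReal_mul ENNReal.toReal_nonneg, ENNReal.ofReal_toReal measure_ball_lt_top.ne]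

theorem volume_ball_eq (x : E) {s : ℝ} (hs : 0 ≤ s) :
    volume (ball x s) = ENNReal.ofReal (unitVol * s ^ 3) := by
  rw [← volume_closedBall_eq x hs, Measure.addHaar_closedBall_eq_addHaar_ball]

theorem lintegral_volume_kern_closedBall_le {β : ℝ} (hβ : 0 ≤ β) (hd : β < 3) :
    ∃ C : ℝ, 0 ≤ C ∧ ∀ (y : E) (R : ℝ), 0 < R →
      ∫⁻ x in closedBall y R, kern β y x ≤ ENNReal.ofReal (C * R ^ (3 - β)) := by
  obtain ⟨C, hC, h⟩ := lintegral_kern_closedBall_le hβ hd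
  refine ⟨C * unitVol, mul_nonneg hC unitVol_pos.le, fun y R hR =>
    h volume y R unitVol hR unitVol_pos.le fun s hs _ => ?_⟩
  rw [volume_closedBall_eq y hs.le, ← Real.rpow_natCast]
  norm_num

theorem lintegral_volume_kern_compl_ball_le {β : ℝ} (hd : 3 < β) :
    ∃ C : ℝ, 0 ≤ C ∧ ∀ (y : E) (R : ℝ), 0 < R →
      ∫⁻ x in (ball y R)ᶜ, kern β y x ≤ ENNReal.ofReal (C * R ^ (3 - β)) := by
  obtain ⟨C, hC, h⟩ := lintegral_kern_compl_ball_le (by norm_num) hd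
  refine ⟨C * unitVol, mul_nonneg hC unitVol_pos.le, fun y R hR =>
    h volume y R unitVol hR unitVol_pos.le fun s hs => ?_⟩
  rw [volume_closedBall_eq y (hR.le.trans hs), ← Real.rpow_natCast]
  norm_num

/-- Averaging `|x - ·|^{-2}` over a ball increases it at most by a constant factor. -/
theorem exists_lintegral_kern_two_le :
    ∃ C : ℝ, 0 < C ∧ ∀ (x y : E) (ε : ℝ), 0 < ε →
      ∫⁻ z in closedBall y ε, kern 2 x z ≤ ENNReal.ofReal (C * ε ^ 3) * kern 2 x y := by
  obtain ⟨C, hC, h⟩ := lintegral_volume_kern_closedBall_le (β := 2) (by norm_num) (by norm_num)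
  refine ⟨4 * unitVol + 12 * C, by have := unitVol_pos; positivity, fun x y ε hε => ?_⟩
  have hu := unitVol_pos
  rcases le_or_gt (2 * ε) (dist x y) with hfar | hnear
  · calc ∫⁻ z in closedBall y ε, kern 2 x z
        ≤ ∫⁻ _z in closedBall y ε, ENNReal.ofReal ((2 : ℝ) ^ (2 : ℝ)) * kern 2 x y := by
          refine setLIntegral_mono' isClosed_closedBall.measurableSet fun z hz => ?_
          refine kern_le_of_dist_le (by norm_num) (by norm_num) ?_
          have := dist_triangle x z y
          rw [mem_closedBall] at hz
          linarith
      _ = ENNReal.ofReal (4 * unitVol * ε ^ 3) * kern 2 x y := by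
          rw [setLIntegral_const, volume_closedBall_eq y hε.le, mul_right_comm,
            ← ENNReal.ofReal_mul (by positivity)]
          congr 2
          norm_num
          ring
      _ ≤ _ := by gcongr; nlinarith
  · calc ∫⁻ z in closedBall y ε, kern 2 x z
        ≤ ∫⁻ z in closedBall x (3 * ε), kern 2 x z := by
          refine lintegral_mono_set (closedBall_subset_closedBall' ?_)
          rw [dist_comm]; linarith
      _ ≤ ENNReal.ofReal (C * (3 * ε) ^ ((3 : ℝ) - 2)) := h x (3 * ε) (by positivity)
      _ = ENNReal.ofReal (12 * C * ε ^ 3) * ENNReal.ofReal ((2 * ε) ^ (-2 : ℝ)) := by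
          rw [← ENNReal.ofReal_mul (by positivity)]
          congr 1
          rw [Real.rpow_neg (by positivity), show (3 : ℝ) - 2 = 1 by norm_num, Real.rpow_one,
            show (2 : ℝ) = ((2 : ℕ) : ℝ) by norm_num, Real.rpow_natCast]
          field_simp
          push_cast
          ring
      _ ≤ _ := by
          gcongr
          · nlinarith
          · rcases eq_or_ne x y with rfl | hne
            · rw [kern_self (by norm_num)]; exact le_top
            · rw [kern_eq_ofReal 2 hne]
              exact ENNReal.ofReal_le_ofReal
                (Real.rpow_le_rpow_of_nonpos (dist_pos.2 hne) hnear.le (by norm_num))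

/-- The composition of two kernels of order `2` is a kernel of order `1`. -/
theorem exists_lintegral_kern_two_mul_kern_two_le :
    ∃ C : ℝ, 0 < C ∧ ∀ x y : E,
      ∫⁻ z, kern 2 x z * kern 2 z y ≤ ENNReal.ofReal C * kern 1 x y := by
  obtain ⟨C, hC, h⟩ := lintegral_volume_kern_closedBall_le (β := 2) (by norm_num) (by norm_num)
  obtain ⟨C', hC', h'⟩ := lintegral_volume_kern_compl_ball_le (β := 4) (by norm_num)
  refine ⟨4 * C + 4 * C' + 1, by positivity, fun x y => ?_⟩
  rcases eq_or_ne x y with rfl | hne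
  · rw [kern_self one_pos, ENNReal.mul_top (by simp; positivity)]
    exact le_top
  have hd : 0 < dist x y := dist_pos.2 hne
  set d := dist x y with hdef
  have near : ∀ a b : E, dist a b = d → ∫⁻ z in closedBall a (d / 2), kern 2 a z * kern 2 b z ≤
      ENNReal.ofReal (2 * C / d) := by
    intro a b hab
    have hab' : a ≠ b := dist_pos.1 (hab ▸ hd)
    calc ∫⁻ z in closedBall a (d / 2), kern 2 a z * kern 2 b z
        ≤ ∫⁻ z in closedBall a (d / 2), kern 2 a z * ENNReal.ofReal ((d / 2) ^ (-2 : ℝ)) := by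
          refine setLIntegral_mono' isClosed_closedBall.measurableSet fun z hz => ?_
          gcongr
          refine kern_le_ofReal (by norm_num) (by positivity) ?_
          have := dist_triangle a z b
          rw [mem_closedBall, dist_comm] at hz
          rw [dist_comm b z]
          linarith
      _ ≤ ENNReal.ofReal (C * (d / 2) ^ ((3 : ℝ) - 2)) * ENNReal.ofReal ((d / 2) ^ (-2 : ℝ)) := by
          rw [lintegral_mul_const _ (measurable_kern 2 a)]
          gcongr
          exact h a (d / 2) (by positivity)
      _ = ENNReal.ofReal (2 * C / d) := by
          rw [← ENNReal.ofReal_mul (by positivity)]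
          congr 1
          rw [mul_assoc, ← Real.rpow_add (by positivity)]
          norm_num [Real.rpow_neg_one]
          ring
  have far : ∀ a : E, ∫⁻ z in (ball a (d / 2))ᶜ, kern 4 a z ≤ ENNReal.ofReal (2 * C' / d) := by
    intro a
    refine (h' a (d / 2) (by positivity)).trans (ENNReal.ofReal_le_ofReal (le_of_eq ?_))
    norm_num [Real.rpow_neg_one]
    ring
  have hsplit : ∀ z : E, kern 2 x z * kern 2 z y ≤
      (closedBall x (d / 2)).indicator (fun z => kern 2 x z * kern 2 y z) z +
      (closedBall y (d / 2)).indicator (fun z => kern 2 y z * kern 2 x z) z +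
      ((ball x (d / 2))ᶜ.indicator (kern 4 x) z + (ball y (d / 2))ᶜ.indicator (kern 4 y) z) := by
    intro z
    rw [kern_comm 2 z y]
    by_cases h1 : z ∈ closedBall x (d / 2)
    · rw [indicator_of_mem h1, add_assoc]
      exact le_self_add
    by_cases h2 : z ∈ closedBall y (d / 2)
    · rw [indicator_of_mem h2, mul_comm, add_comm (indicator _ _ z), add_assoc]
      exact le_self_add
    · rw [indicator_of_mem (s := (ball x (d / 2))ᶜ) fun h => h1 (ball_subset_closedBall h),
        indicator_of_mem (s := (ball y (d / 2))ᶜ) fun h => h2 (ball_subset_closedBall h)]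
      refine le_trans ?_ le_add_self
      rw [show (4 : ℝ) = 2 + 2 by norm_num, kern_add (by norm_num) (by norm_num),
        kern_add (by norm_num) (by norm_num)]
      rcases le_total (kern 2 x z) (kern 2 y z) with hle | hle
      · exact (mul_le_mul_left hle _).trans le_add_self
      · exact (mul_le_mul_right hle _).trans le_self_add
  have m1 : ∀ a b : E, Measurable fun z => kern 2 a z * kern 2 b z := fun a b =>
    (measurable_kern 2 a).mul (measurable_kern 2 b)
  calc ∫⁻ z, kern 2 x z * kern 2 z y ≤ _ := lintegral_mono hsplit
    _ ≤ ENNReal.ofReal (2 * C / d) + ENNReal.ofReal (2 * C / d) +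
        (ENNReal.ofReal (2 * C' / d) + ENNReal.ofReal (2 * C' / d)) := by
        have hm : Measurable fun z =>
            (closedBall x (d / 2)).indicator (fun z => kern 2 x z * kern 2 y z) z +
            (closedBall y (d / 2)).indicator (fun z => kern 2 y z * kern 2 x z) z :=
          ((m1 x y).indicator isClosed_closedBall.measurableSet).add
            ((m1 y x).indicator isClosed_closedBall.measurableSet)
        rw [lintegral_add_left hm,
          lintegral_add_left ((m1 x y).indicator isClosed_closedBall.measurableSet),
          lintegral_add_left ((measurable_kern 4 x).indicator isOpen_ball.measurableSet.compl),
          lintegral_indicator isClosed_closedBall.measurableSet,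
          lintegral_indicator isClosed_closedBall.measurableSet,
          lintegral_indicator isOpen_ball.measurableSet.compl,
          lintegral_indicator isOpen_ball.measurableSet.compl]
        exact add_le_add (add_le_add (near x y rfl) (near y x (dist_comm y x)))
          (add_le_add (far x) (far y))
    _ = ENNReal.ofReal ((4 * C + 4 * C') / d) := by
        rw [← ENNReal.ofReal_add (by positivity) (by positivity),
          ← ENNReal.ofReal_add (by positivity) (by positivity),
          ← ENNReal.ofReal_add (by positivity) (by positivity)]
        congr 1; ring
    _ ≤ _ := by
        rw [kern_eq_ofReal 1 hne, ← ENNReal.ofReal_mul (by positivity), Real.rpow_neg_one,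
          ← div_eq_mul_inv]
        exact ENNReal.ofReal_le_ofReal (div_le_div_of_nonneg_right (by linarith) hd.le)

/-! ### The potential estimate for smooth functions -/

theorem lintegral_comp_homothety (H : E → ℝ≥0∞) (hH : Measurable H) (x : E) {t : ℝ} (ht : 0 < t) :
    ∫⁻ y, H (x + t • (y - x)) = ENNReal.ofReal ((t ^ 3)⁻¹) * ∫⁻ z, H z := by
  have h1 : ∫⁻ y, H (x + t • (y - x)) = ∫⁻ w, H (x + t • w) :=
    lintegral_sub_right_eq_self (fun w => H (x + t • w)) x
  have h2 : ∫⁻ w : E, H (x + t • w) =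
      ∫⁻ z, H (x + z) ∂(Measure.map (fun w : E => t • w) volume) := by
    rw [lintegral_map (by fun_prop) (by fun_prop)]
  rw [h1, h2, Measure.map_addHaar_smul _ ht.ne', lintegral_smul_measure, smul_eq_mul,
    lintegral_add_left_eq_self H x, finrank_euclideanSpace_fin, abs_of_pos (by positivity)]

theorem lintegral_Ici_rpow_neg_four_le {a : ℝ} (ha : 0 < a) :
    ∫⁻ t in Ici a, ENNReal.ofReal (t ^ (-4 : ℝ)) ≤ ENNReal.ofReal (a ^ (-3 : ℝ)) := by
  rw [setLIntegral_congr Ioi_ae_eq_Ici.symm, ← ofReal_integral_eq_lintegral_ofReal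
    (integrableOn_Ioi_rpow_of_lt (by norm_num) ha), integral_Ioi_rpow_of_lt (by norm_num) ha]
  · refine ENNReal.ofReal_le_ofReal ?_
    have : 0 < a ^ (-3 : ℝ) := by positivity
    rw [show (-4 : ℝ) + 1 = -3 by norm_num]
    linarith
  · filter_upwards [ae_restrict_mem measurableSet_Ioi] with t ht
    have : 0 < t := ha.trans ht
    positivity

theorem enorm_sub_le_lintegral_segment {u : E → ℝ} (hu : ContDiff ℝ 1 u) (x y : E) :
    ‖u x - u y‖ₑ ≤ ∫⁻ t in Ioc (0 : ℝ) 1, ‖fderiv ℝ u (x + t • (y - x))‖ₑ * ‖y - x‖ₑ := by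
  have hc : Continuous fun t : ℝ => fderiv ℝ u (x + t • (y - x)) (y - x) :=
    ((hu.continuous_fderiv (by norm_num)).comp (by fun_prop)).clm_apply continuous_const
  have hd : ∀ t ∈ uIcc (0 : ℝ) 1, HasDerivAt (fun t : ℝ => u (x + t • (y - x)))
      (fderiv ℝ u (x + t • (y - x)) (y - x)) t := fun t _ => by
    have h1 : HasDerivAt (fun t : ℝ => x + t • (y - x)) (y - x) t := by
      simpa using ((hasDerivAt_id t).smul_const (y - x)).const_add x
    exact ((hu.differentiable (by norm_num)) _).hasFDerivAt.comp_hasDerivAt t h1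
  have h := intervalIntegral.integral_eq_sub_of_hasDerivAt hd (hc.intervalIntegrable 0 1)
  simp only [one_smul, add_sub_cancel, zero_smul, add_zero] at h
  rw [← enorm_neg, neg_sub, ← h, intervalIntegral.integral_of_le zero_le_one]
  refine (enorm_integral_le_lintegral_enorm _).trans (lintegral_mono fun t => ?_)
  exact ContinuousLinearMap.le_opENorm _ _

set_option maxHeartbeats 400000 in
/-- The integral over a subset `Z` of a convex set of the differences `|u(x) - u(y)|` is bounded by
the Riesz potential of the gradient. This is the fundamental theorem of calculus along the segments
from `x` to `y ∈ Z`, followed by the change of variables `z = x + t (y - x)` for fixed `t`. -/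
theorem lintegral_enorm_sub_le {u : E → ℝ} (hu : ContDiff ℝ 1 u) {Q Z : Set E}
    (hQ : Convex ℝ Q) (hQm : MeasurableSet Q) (hZ : MeasurableSet Z) (hZQ : Z ⊆ Q) {x : E}
    (hx : x ∈ Q) {D : ℝ} (hD : 0 < D) (hQD : Q ⊆ closedBall x D) :
    ∫⁻ y in Z, ‖u x - u y‖ₑ ≤
      ENNReal.ofReal (D ^ 3) * ∫⁻ z in Q, ‖fderiv ℝ u z‖ₑ * kern 2 x z := by
  have hF : Measurable fun z => ‖fderiv ℝ u z‖ₑ :=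
    (hu.continuous_fderiv (by norm_num)).enorm.measurable
  obtain ⟨F, hFdef⟩ : ∃ F : E → ℝ≥0∞, F = Q.indicator fun z => ‖fderiv ℝ u z‖ₑ := ⟨_, rfl⟩
  have hFm : Measurable F := hFdef ▸ hF.indicator hQm
  -- the integrand after the change of variables `z = x + t (y - x)`
  obtain ⟨H, hHdef⟩ : ∃ H : ℝ × E → ℝ≥0∞,
    H = {q : ℝ × E | dist q.2 x ≤ q.1 * D}.indicator (fun q => F q.2 * edist q.2 x) := ⟨_, rfl⟩
  have hset : MeasurableSet {q : ℝ × E | dist q.2 x ≤ q.1 * D} :=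
    measurableSet_le (by fun_prop) (by fun_prop)
  have hHm : Measurable H := by
    have : Measurable fun q : ℝ × E => F q.2 * edist q.2 x := by fun_prop
    exact hHdef ▸ this.indicator hset
  have hHt : ∀ t, Measurable fun z => H (t, z) := fun t => hHm.comp measurable_prodMk_left
  have step : ∀ t ∈ Ioc (0 : ℝ) 1,
      ∫⁻ y in Z, ‖fderiv ℝ u (x + t • (y - x))‖ₑ * ‖y - x‖ₑ ≤
        ∫⁻ z, ENNReal.ofReal (t ^ (-4 : ℝ)) * H (t, z) := by
    intro t ht
    have ht0 := ht.1
    calc ∫⁻ y in Z, ‖fderiv ℝ u (x + t • (y - x))‖ₑ * ‖y - x‖ₑ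
        ≤ ∫⁻ y in Z, ENNReal.ofReal t⁻¹ * H (t, x + t • (y - x)) := by
          refine setLIntegral_mono' hZ fun y hy => ?_
          have hmem : x + t • (y - x) ∈ Q :=
            hQ.add_smul_sub_mem hx (hZQ hy) ⟨ht0.le, ht.2⟩
          have hdist : dist (x + t • (y - x)) x ≤ t * D := by
            rw [dist_eq_norm, add_sub_cancel_left, norm_smul, Real.norm_of_nonneg ht0.le,
              ← dist_eq_norm]
            gcongr
            exact hQD (hZQ hy)
          rw [hHdef, hFdef]
          rw [indicator_of_mem (by exact hdist), indicator_of_mem hmem, edist_eq_enorm_sub,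
            add_sub_cancel_left, enorm_smul, mul_left_comm, Real.enorm_eq_ofReal ht0.le,
            ← mul_assoc (ENNReal.ofReal t⁻¹), ← ENNReal.ofReal_mul (by positivity),
            inv_mul_cancel₀ ht0.ne', ENNReal.ofReal_one, one_mul]
      _ ≤ ∫⁻ y, ENNReal.ofReal t⁻¹ * H (t, x + t • (y - x)) := setLIntegral_le_lintegral _ _
      _ = ∫⁻ z, ENNReal.ofReal (t ^ (-4 : ℝ)) * H (t, z) := by
          have hm : Measurable fun y => H (t, x + t • (y - x)) := (hHt t).comp (by fun_prop)
          rw [lintegral_const_mul _ hm,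
            lintegral_comp_homothety (fun z => H (t, z)) (hHt t) x ht0,
            lintegral_const_mul _ (hHt t), ← mul_assoc, ← ENNReal.ofReal_mul (by positivity)]
          congr 2
          rw [Real.rpow_neg ht0.le, show (4 : ℝ) = ((4 : ℕ) : ℝ) by norm_num, Real.rpow_natCast]
          field_simp
  have hprod : Measurable fun q : E × ℝ =>
      ‖fderiv ℝ u (x + q.2 • (q.1 - x))‖ₑ * ‖q.1 - x‖ₑ := by
    refine Measurable.mul (hF.comp (by fun_prop)) (by fun_prop)
  calc ∫⁻ y in Z, ‖u x - u y‖ₑ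
      ≤ ∫⁻ y in Z, ∫⁻ t in Ioc (0 : ℝ) 1,
          ‖fderiv ℝ u (x + t • (y - x))‖ₑ * ‖y - x‖ₑ :=
        lintegral_mono fun y => enorm_sub_le_lintegral_segment hu x y
    _ = ∫⁻ t in Ioc (0 : ℝ) 1, ∫⁻ y in Z,
          ‖fderiv ℝ u (x + t • (y - x))‖ₑ * ‖y - x‖ₑ :=
        lintegral_lintegral_swap hprod.aemeasurable
    _ ≤ ∫⁻ t in Ioc (0 : ℝ) 1, ∫⁻ z, ENNReal.ofReal (t ^ (-4 : ℝ)) * H (t, z) :=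
        setLIntegral_mono' measurableSet_Ioc step
    _ = ∫⁻ z, ∫⁻ t in Ioc (0 : ℝ) 1, ENNReal.ofReal (t ^ (-4 : ℝ)) * H (t, z) := by
        refine lintegral_lintegral_swap (Measurable.aemeasurable ?_)
        exact Measurable.mul (f := fun q : ℝ × E => ENNReal.ofReal (q.1 ^ (-4 : ℝ))) (by fun_prop)
          hHm
    _ ≤ ∫⁻ z, ENNReal.ofReal (D ^ 3) * Q.indicator (fun z => ‖fderiv ℝ u z‖ₑ * kern 2 x z) z := by
        have hne : ∀ᵐ z : E, z ≠ x := by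
          simp [ae_iff]
        refine lintegral_mono_ae (hne.mono fun z hz => ?_)
        have hd : 0 < dist x z := dist_pos.2 (Ne.symm hz)
        -- only the `t ≥ dist x z / D` contribute, as `dist x y ≤ D` for all `y ∈ Z`
        set a := dist x z / D with ha
        have ha0 : 0 < a := by positivity
        calc ∫⁻ t in Ioc (0 : ℝ) 1, ENNReal.ofReal (t ^ (-4 : ℝ)) * H (t, z)
            ≤ ∫⁻ t, (Ici a).indicator (fun t => ENNReal.ofReal (t ^ (-4 : ℝ))) t *
                (F z * edist z x) := by
              refine (setLIntegral_le_lintegral _ _).trans (lintegral_mono fun t => ?_)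
              rw [hHdef]
              by_cases h : dist z x ≤ t * D
              · rw [indicator_of_mem (by exact h), indicator_of_mem]
                rw [mem_Ici, ha, div_le_iff₀ hD, dist_comm]
                exact h
              · rw [indicator_of_notMem (by exact h), mul_zero]
                exact zero_le
          _ ≤ ENNReal.ofReal (a ^ (-3 : ℝ)) * (F z * edist z x) := by
              rw [lintegral_mul_const _ (Measurable.indicator (by fun_prop) measurableSet_Ici),
                lintegral_indicator measurableSet_Ici]
              gcongr
              exact lintegral_Ici_rpow_neg_four_le ha0
          _ = _ := by
              by_cases h : z ∈ Q
              · rw [hFdef, indicator_of_mem h, indicator_of_mem h, kern_eq_ofReal 2 (Ne.symm hz),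
                  edist_comm, edist_dist, mul_left_comm, mul_left_comm _ ‖fderiv ℝ u z‖ₑ,
                  ← ENNReal.ofReal_mul (by positivity), ← ENNReal.ofReal_mul (by positivity)]
                congr 2
                rw [Real.rpow_neg ha0.le, Real.rpow_neg hd.le,
                  show (3 : ℝ) = ((3 : ℕ) : ℝ) by norm_num,
                  show (2 : ℝ) = ((2 : ℕ) : ℝ) by norm_num, Real.rpow_natCast, Real.rpow_natCast,
                  show dist x z = a * D by rw [ha]; field_simp]
                field_simp
              · rw [hFdef, indicator_of_notMem h, indicator_of_notMem h]
                simp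
    _ = _ := by
        have hm : Measurable fun z => ‖fderiv ℝ u z‖ₑ * kern 2 x z :=
          hF.mul (measurable_kern 2 x)
        rw [lintegral_const_mul _ (hm.indicator hQm),
          lintegral_indicator hQm]

/-! ### Mollification of Sobolev functions -/

/-- A smooth bump function supported in the ball of radius `1 / (n + 1)`. -/
def bump (n : ℕ) : ContDiffBump (0 : E) where
  rIn := 1 / (n + 1) / 2
  rOut := 1 / (n + 1)
  rIn_pos := by positivity
  rIn_lt_rOut := half_lt_self (by positivity)

/-- The normalised bump function. -/
def mollifier (n : ℕ) : E → ℝ := (bump n).normed volume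

/-- The mollification of `V`. -/
def mollify (V : E → ℝ) (n : ℕ) : E → ℝ := fun x => ∫ t, V t * mollifier n (x - t)

theorem mollifier_le (n : ℕ) (x : E) :
    mollifier n x ≤ 8 / (unitVol * (1 / (n + 1)) ^ 3) := by
  have h := (bump n).normed_le_div_measure_closedBall_rOut volume 2 (by
    change (1 : ℝ) / (n + 1) ≤ 2 * (1 / (n + 1) / 2)
    linarith) x
  rw [finrank_euclideanSpace_fin, Measure.real, volume_closedBall_eq _ (bump n).rOut_pos.le,
    ENNReal.toReal_ofReal (by have := unitVol_pos; have := (bump n).rOut_pos; positivity)] at h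
  refine h.trans (le_of_eq ?_)
  norm_num [bump]

theorem mollifier_nonneg (n : ℕ) (x : E) : 0 ≤ mollifier n x := (bump n).nonneg_normed x

theorem contDiff_mollifier (n : ℕ) : ContDiff ℝ ∞ (mollifier n) := (bump n).contDiff_normed

theorem hasCompactSupport_mollifier (n : ℕ) : HasCompactSupport (mollifier n) :=
  (bump n).hasCompactSupport_normed

theorem tsupport_mollifier (n : ℕ) : tsupport (mollifier n) = closedBall 0 (1 / (n + 1)) :=
  (bump n).tsupport_normed_eq (μ := volume)

theorem integral_mollifier (n : ℕ) : ∫ x, mollifier n x = 1 := (bump n).integral_normed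

theorem mollifier_sub_comm (n : ℕ) (x y : E) : mollifier n (x - y) = mollifier n (y - x) := by
  rw [← neg_sub, mollifier, ContDiffBump.normed_neg]

theorem mollify_eq_convolution (V : E → ℝ) (n : ℕ) :
    mollify V n = convolution V (mollifier n) (ContinuousLinearMap.lsmul ℝ ℝ) volume := rfl

theorem contDiff_mollify {V : E → ℝ} (hV : LocallyIntegrable V) (n : ℕ) :
    ContDiff ℝ 1 (mollify V n) := by
  rw [mollify_eq_convolution]
  exact (hasCompactSupport_mollifier n).contDiff_convolution_right (n := 1) _ hV
    ((contDiff_mollifier n).of_le (by exact_mod_cast le_top))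

theorem fderiv_mollify_apply {V : E → ℝ} (hV : LocallyIntegrable V) (n : ℕ) (x e : E) :
    fderiv ℝ (mollify V n) x e = ∫ t, V t * fderiv ℝ (mollifier n) (x - t) e := by
  have h1 : ContDiff ℝ 1 (mollifier n) := (contDiff_mollifier n).of_le (by exact_mod_cast le_top)
  have := (hasCompactSupport_mollifier n).hasFDerivAt_convolution_right
    (ContinuousLinearMap.lsmul ℝ ℝ) hV h1 x
  rw [mollify_eq_convolution, this.fderiv, convolution_precompR_apply _ hV
    ((hasCompactSupport_mollifier n).fderiv ℝ) (h1.continuous_fderiv (by norm_num))]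
  rfl

theorem enorm_clm_le_sum (L : E →L[ℝ] ℝ) :
    ‖L‖ₑ ≤ ∑ j : Fin 3, ‖L (EuclideanSpace.single j 1)‖ₑ := by
  have h : ‖L‖ ≤ ∑ j : Fin 3, ‖L (EuclideanSpace.single j 1)‖ := by
    refine L.opNorm_le_bound (by positivity) fun z => ?_
    have hz : z = ∑ j : Fin 3, z j • EuclideanSpace.single j (1 : ℝ) := by
      ext i
      simp [Finset.sum_apply, Pi.single_apply]
    conv_lhs => rw [hz, map_sum]
    rw [Finset.sum_mul]
    refine (norm_sum_le _ _).trans (Finset.sum_le_sum fun j _ => ?_)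
    rw [map_smul, norm_smul, mul_comm]
    gcongr
    exact norm_apply_le z j
  calc ‖L‖ₑ = ENNReal.ofReal ‖L‖ := (ofReal_norm L).symm
    _ ≤ _ := ENNReal.ofReal_le_ofReal h
    _ = _ := by
      rw [ENNReal.ofReal_sum_of_nonneg fun _ _ => norm_nonneg _]
      simp only [ofReal_norm]

theorem integrable_indicator_of_hasWeakPartial {Ω : Set E} {j : Fin 3} {v g : E → ℝ}
    (h : HasWeakPartial Ω j v g) {K : Set E} (hK : IsCompact K) (hKΩ : K ⊆ Ω) :
    Integrable (K.indicator v) :=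
  (integrable_indicator_iff hK.measurableSet).2
    ((h.1.mono_set hKΩ).integrableOn_isCompact hK)

/-- The gradient of the mollification of a Sobolev function is bounded by the averages of its weak
gradient over small balls. -/
theorem enorm_fderiv_mollify_le {Ω : Set E} {v : E → ℝ} {g : Fin 3 → E → ℝ}
    (hg : ∀ j, HasWeakPartial Ω j v (g j)) {G : E → ℝ≥0∞}
    (hG : ∀ᵐ y ∂(volume.restrict Ω), ∑ j, ‖g j y‖ₑ ≤ G y) {K : Set E} (hK : IsCompact K)
    (hKΩ : K ⊆ Ω) {n : ℕ} {x : E} (hx : closedBall x (1 / (n + 1)) ⊆ K) :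
    ‖fderiv ℝ (mollify (K.indicator v) n) x‖ₑ ≤
      ENNReal.ofReal (8 / (unitVol * (1 / (n + 1)) ^ 3)) *
        ∫⁻ y in closedBall x (1 / (n + 1)), G y := by
  set c : ℝ := 8 / (unitVol * (1 / (n + 1)) ^ 3)
  have hV : Integrable (K.indicator v) := integrable_indicator_of_hasWeakPartial (hg 0) hK hKΩ
  set φ : E → ℝ := fun y => mollifier n (x - y) with hφ
  have hφsupp : tsupport φ ⊆ closedBall x (1 / (n + 1)) := by
    have : tsupport φ ⊆ (fun y => x - y) ⁻¹' tsupport (mollifier n) :=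
      tsupport_comp_subset_preimage (mollifier n) (f := fun y : E => x - y) (by fun_prop)
    refine this.trans fun y hy => ?_
    rw [mem_preimage, tsupport_mollifier, mem_closedBall, dist_zero_right, ← dist_eq_norm,
      dist_comm] at hy
    exact hy
  have hφd : ContDiff ℝ ∞ φ := (contDiff_mollifier n).comp (by fun_prop)
  have hφc : HasCompactSupport φ :=
    HasCompactSupport.of_support_subset_isCompact (isCompact_closedBall x (1 / (n + 1)))
      ((subset_tsupport φ).trans hφsupp)
  have hφ' : ∀ y e, fderiv ℝ φ y e = - fderiv ℝ (mollifier n) (x - y) e := by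
    intro y e
    have h1 : HasFDerivAt (fun y : E => x - y) (-ContinuousLinearMap.id ℝ E) y :=
      (hasFDerivAt_id y).const_sub x
    have h2 := (((contDiff_mollifier n).differentiable (by simp)) (x - y)).hasFDerivAt.comp y h1
    have h3 : fderiv ℝ φ y = (fderiv ℝ (mollifier n) (x - y)).comp (-ContinuousLinearMap.id ℝ E) :=
      h2.fderiv
    rw [h3]
    simp
  have hj : ∀ j, ‖fderiv ℝ (mollify (K.indicator v) n) x (EuclideanSpace.single j 1)‖ₑ ≤
      ∫⁻ y in closedBall x (1 / (n + 1)), ‖g j y‖ₑ * ENNReal.ofReal c := by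
    intro j
    have e1 : fderiv ℝ (mollify (K.indicator v) n) x (EuclideanSpace.single j 1) =
        ∫ y in Ω, g j y * φ y := by
      have h3 := (hg j).2.2 φ hφd hφc (hφsupp.trans (hx.trans hKΩ))
      rw [fderiv_mollify_apply hV.locallyIntegrable, ← neg_eq_iff_eq_neg.2 h3, ← integral_neg]
      have hsub : Function.support (fun y => -(v y * fderiv ℝ φ y (EuclideanSpace.single j 1))) ⊆
          Ω := by
        intro y hy
        by_contra hyΩ
        refine hy ?_
        have : y ∉ tsupport (fderiv ℝ φ) := fun hmem =>
          hyΩ (hKΩ (hx (hφsupp (tsupport_fderiv_subset ℝ hmem))))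
        simp [image_eq_zero_of_notMem_tsupport this]
      rw [setIntegral_eq_integral_of_forall_compl_eq_zero fun y hy => by
        by_contra h; exact hy (hsub h)]
      refine integral_congr_ae (ae_of_all _ fun y => ?_)
      by_cases hy : y ∈ K
      · simp [hy, hφ']
      · have : y ∉ tsupport (fderiv ℝ φ) := fun hmem =>
          hy (hx (hφsupp (tsupport_fderiv_subset ℝ hmem)))
        simp [hy, image_eq_zero_of_notMem_tsupport this]
    rw [e1]
    calc ‖∫ y in Ω, g j y * φ y‖ₑ ≤ ∫⁻ y in Ω, ‖g j y * φ y‖ₑ :=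
          enorm_integral_le_lintegral_enorm _
      _ ≤ ∫⁻ y, ‖g j y * φ y‖ₑ := setLIntegral_le_lintegral _ _
      _ ≤ ∫⁻ y, (closedBall x (1 / (n + 1))).indicator
            (fun y => ‖g j y‖ₑ * ENNReal.ofReal c) y := by
          refine lintegral_mono fun y => ?_
          by_cases hy : y ∈ closedBall x (1 / (n + 1))
          · rw [indicator_of_mem hy, enorm_mul]
            gcongr
            rw [Real.enorm_eq_ofReal (mollifier_nonneg n _)]
            exact ENNReal.ofReal_le_ofReal (mollifier_le n _)
          · simp [image_eq_zero_of_notMem_tsupport fun h => hy (hφsupp h)]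
      _ = _ := lintegral_indicator isClosed_closedBall.measurableSet _
  have hB : closedBall x (1 / (n + 1)) ⊆ Ω := hx.trans hKΩ
  refine (enorm_clm_le_sum _).trans ((Finset.sum_le_sum fun j _ => hj j).trans ?_)
  rw [← lintegral_finsetSum' _ fun j _ => ?_]
  · rw [← lintegral_const_mul' _ _ ENNReal.ofReal_ne_top]
    refine lintegral_mono_ae ((ae_restrict_of_ae_restrict_of_subset hB hG).mono fun y hy => ?_)
    rw [← Finset.sum_mul, mul_comm]
    gcongr
  · exact (((hg j).2.1.mono_set hB).integrableOn_isCompact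
      (isCompact_closedBall x _)).aestronglyMeasurable.enorm.mul_const _

/-- Mollification is symmetric, so it may be moved from `V` to the indicator of `Z`, where dominated
convergence applies. -/
theorem tendsto_setIntegral_mollify {V : E → ℝ} (hV : Integrable V) {Z : Set E}
    (hZ : MeasurableSet Z) (hZf : volume Z ≠ ⊤) :
    Tendsto (fun n => ∫ x in Z, mollify V n x) atTop (𝓝 (∫ x in Z, V x)) := by
  have hZi : Integrable (Z.indicator fun _ => (1 : ℝ)) :=
    (integrable_indicator_iff hZ).2 (integrableOn_const hZf)
  have hmi : ∀ n, Integrable (mollifier n) := fun n => (bump n).integrable_normed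
  set w : ℕ → E → ℝ := fun n t => ∫ x in Z, mollifier n (x - t) with hw
  have hwc : ∀ n t, w n t = convolution (mollifier n) (Z.indicator fun _ => (1 : ℝ))
      (ContinuousLinearMap.lsmul ℝ ℝ) volume t := by
    intro n t
    rw [convolution_eq_swap]
    change ∫ x in Z, mollifier n (x - t) = _
    rw [← integral_indicator hZ]
    refine integral_congr_ae (ae_of_all _ fun x => ?_)
    by_cases hx : x ∈ Z <;> simp [hx, mollifier_sub_comm n t x]
  have h1 : ∀ n, ∫ x in Z, mollify V n x = ∫ t, V t * w n t := by
    intro n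
    have hint : Integrable (Function.uncurry fun (x t : E) => V t * mollifier n (x - t))
        ((volume.restrict Z).prod volume) := by
      have := hV.convolution_integrand (ContinuousLinearMap.lsmul ℝ ℝ) (hmi n)
      refine Integrable.mono_measure this ?_
      exact Measure.prod_mono Measure.restrict_le_self le_rfl
    simp only [mollify]
    rw [integral_integral_swap hint]
    refine integral_congr_ae (ae_of_all _ fun t => ?_)
    simp only [hw]
    rw [integral_const_mul]
  simp_rw [h1]
  rw [← integral_indicator hZ]
  have hlim : ∀ᵐ t, Tendsto (fun n => w n t) atTop (𝓝 (Z.indicator (fun _ => (1 : ℝ)) t)) := by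
    have hr : Tendsto (fun n => (bump n).rOut) atTop (𝓝 0) :=
      tendsto_one_div_add_atTop_nhds_zero_nat
    have := ContDiffBump.ae_convolution_tendsto_right_of_locallyIntegrable (μ := volume)
      (φ := bump) (l := atTop) (K := 2) hr (Eventually.of_forall fun n => by
        change (1 : ℝ) / (n + 1) ≤ 2 * (1 / (n + 1) / 2)
        linarith) hZi.locallyIntegrable
    refine this.mono fun t ht => ?_
    simp_rw [hwc]
    exact ht
  refine tendsto_integral_of_dominated_convergence (fun t => ‖V t‖) (fun n => ?_) hV.norm
    (fun n => ae_of_all _ fun t => ?_) (hlim.mono fun t ht => ?_)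
  · refine hV.aestronglyMeasurable.mul (AEStronglyMeasurable.congr (f := fun t =>
      convolution (mollifier n) (Z.indicator fun _ => (1 : ℝ))
      (ContinuousLinearMap.lsmul ℝ ℝ) volume t) ?_ (ae_of_all _ fun t => (hwc n t).symm))
    exact ((hmi n).integrable_convolution _ hZi).aestronglyMeasurable
  · rw [norm_mul]
    refine mul_le_of_le_one_right (norm_nonneg _) ?_
    have hi : Integrable fun x => mollifier n (x - t) := (hmi n).comp_sub_right t
    rw [Real.norm_of_nonneg (setIntegral_nonneg hZ fun x _ => mollifier_nonneg n _)]
    calc w n t ≤ ∫ x, mollifier n (x - t) :=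
          setIntegral_le_integral hi (ae_of_all _ fun x => mollifier_nonneg n _)
      _ = 1 := by rw [integral_sub_right_eq_self (mollifier n), integral_mollifier]
  · have : Z.indicator V t = V t * Z.indicator (fun _ => (1 : ℝ)) t := by
      by_cases h : t ∈ Z <;> simp [h]
    rw [this]
    exact ht.const_mul _

/-! ### The potential estimate for Sobolev functions -/

/-- The potential `∫_Q G(z) |x - z|^{-2} dz`. -/
def pot (G : E → ℝ≥0∞) (Q : Set E) (x : E) : ℝ≥0∞ := ∫⁻ z in Q, G z * kern 2 x z

theorem pot_mono (G : E → ℝ≥0∞) {Q Q' : Set E} (h : Q ⊆ Q') (x : E) : pot G Q x ≤ pot G Q' x :=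
  lintegral_mono_set h

theorem measurable_pot {G : E → ℝ≥0∞} (hG : Measurable G) (Q : Set E) : Measurable (pot G Q) :=
  Measurable.lintegral_prod_right' (f := fun z : E × E => G z.2 * kern 2 z.1 z.2)
    ((hG.comp measurable_snd).mul (measurable_kern_uncurry 2))

/-- `G` is a measurable majorant of the weak gradient of `v` on `Ω`. -/
structure GradBound (Ω : Set E) (v : E → ℝ) (G : E → ℝ≥0∞) : Prop where
  meas : Measurable G
  exists_grad : ∃ g : Fin 3 → E → ℝ, (∀ j, HasWeakPartial Ω j v (g j)) ∧
    ∀ᵐ y ∂(volume.restrict Ω), ∑ j, ‖g j y‖ₑ ≤ G y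

/-- The potential estimate for mollifications. The gradient of a mollification is bounded by
averages of `G`, and the averaging is absorbed by the kernel, up to a constant. -/
theorem exists_lintegral_enorm_mollify_sub_le :
    ∃ C : ℝ, 0 < C ∧ ∀ {Ω : Set E} {v : E → ℝ} {G : E → ℝ≥0∞}, GradBound Ω v G →
      ∀ {K Q S Z : Set E} {x : E} {D : ℝ} {n : ℕ}, IsCompact K → K ⊆ Ω → Q ⊆ K →
      MeasurableSet Q → Convex ℝ S → MeasurableSet S → MeasurableSet Z → Z ⊆ S → x ∈ S → 0 < D →
      S ⊆ closedBall x D → (∀ z ∈ S, closedBall z (1 / (n + 1)) ⊆ Q) →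
      ∫⁻ y in Z, ‖mollify (K.indicator v) n x - mollify (K.indicator v) n y‖ₑ ≤
        ENNReal.ofReal (C * D ^ 3) * pot G Q x := by
  obtain ⟨C, hC, hav⟩ := exists_lintegral_kern_two_le
  have hu := unitVol_pos
  refine ⟨C * 8 / unitVol, by positivity, ?_⟩
  intro Ω v G hvG K Q S Z x D n hK hKΩ hQK hQ hS hSm hZ hZS hx hD hSD hn
  obtain ⟨g, hg, hG⟩ := hvG.exists_grad
  have hV : Integrable (K.indicator v) := integrable_indicator_of_hasWeakPartial (hg 0) hK hKΩ
  set ε : ℝ := 1 / (n + 1) with hε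
  have hε0 : 0 < ε := by positivity
  set c : ℝ := 8 / (unitVol * ε ^ 3) with hc
  have hc0 : 0 < c := by positivity
  have hGm := hvG.meas
  have hset : MeasurableSet {q : E × E | dist q.2 q.1 ≤ ε} :=
    measurableSet_le (by fun_prop) measurable_const
  obtain ⟨F, hF⟩ : ∃ F : E × E → ℝ≥0∞, F = {q : E × E | dist q.2 q.1 ≤ ε}.indicator
      fun q => G q.2 * kern 2 x q.1 := ⟨_, rfl⟩
  have hFm : Measurable F := by
    have : Measurable fun q : E × E => G q.2 * kern 2 x q.1 :=
      (hGm.comp measurable_snd).mul ((measurable_kern 2 x).comp measurable_fst)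
    exact hF ▸ this.indicator hset
  calc ∫⁻ y in Z, ‖mollify (K.indicator v) n x - mollify (K.indicator v) n y‖ₑ
      ≤ ENNReal.ofReal (D ^ 3) *
          ∫⁻ z in S, ‖fderiv ℝ (mollify (K.indicator v) n) z‖ₑ * kern 2 x z :=
        lintegral_enorm_sub_le (contDiff_mollify hV.locallyIntegrable n) hS hSm hZ hZS hx hD hSD
    _ ≤ ENNReal.ofReal (D ^ 3) *
          ∫⁻ z in S, ENNReal.ofReal c * ∫⁻ y in Q, F (z, y) := by
        refine mul_le_mul_right (setLIntegral_mono' hSm fun z hz => ?_) _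
        calc ‖fderiv ℝ (mollify (K.indicator v) n) z‖ₑ * kern 2 x z
            ≤ (ENNReal.ofReal c * ∫⁻ y in closedBall z ε, G y) * kern 2 x z := by
              gcongr
              exact enorm_fderiv_mollify_le hg hG hK hKΩ ((hn z hz).trans hQK)
          _ = ENNReal.ofReal c * ∫⁻ y in closedBall z ε, F (z, y) := by
              rw [mul_assoc, ← lintegral_mul_const _ hGm]
              congr 1
              refine setLIntegral_congr_fun isClosed_closedBall.measurableSet fun y hy => ?_
              rw [hF, indicator_of_mem (by exact hy)]
          _ ≤ _ := mul_le_mul_right (lintegral_mono_set (hn z hz)) _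
    _ = ENNReal.ofReal (D ^ 3) * (ENNReal.ofReal c *
          ∫⁻ y in Q, ∫⁻ z in S, F (z, y)) := by
        rw [lintegral_const_mul _ hFm.lintegral_prod_right', lintegral_lintegral_swap]
        exact hFm.aemeasurable
    _ ≤ ENNReal.ofReal (D ^ 3) * (ENNReal.ofReal c *
          ∫⁻ y in Q, ENNReal.ofReal (C * ε ^ 3) * (G y * kern 2 x y)) := by
        refine mul_le_mul_right (mul_le_mul_right (lintegral_mono fun y => ?_) _) _
        calc ∫⁻ z in S, F (z, y) ≤ ∫⁻ z, F (z, y) := setLIntegral_le_lintegral _ _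
          _ = ∫⁻ z, G y * (closedBall y ε).indicator (kern 2 x) z := by
              refine lintegral_congr fun z => ?_
              by_cases h : dist y z ≤ ε
              · rw [hF, indicator_of_mem (by exact h), indicator_of_mem]
                rwa [mem_closedBall, dist_comm]
              · rw [hF, indicator_of_notMem (by exact h), indicator_of_notMem, mul_zero]
                rwa [mem_closedBall, dist_comm]
          _ = G y * ∫⁻ z in closedBall y ε, kern 2 x z := by
              rw [lintegral_const_mul _
                ((measurable_kern 2 x).indicator isClosed_closedBall.measurableSet),
                lintegral_indicator isClosed_closedBall.measurableSet]
          _ ≤ G y * (ENNReal.ofReal (C * ε ^ 3) * kern 2 x y) :=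
              mul_le_mul_right (hav x y ε hε0) _
          _ = _ := mul_left_comm _ _ _
    _ = _ := by
        have hm : Measurable fun y => G y * kern 2 x y := hGm.mul (measurable_kern 2 x)
        rw [lintegral_const_mul _ hm, pot, ← mul_assoc, ← mul_assoc,
          ← ENNReal.ofReal_mul (by positivity), ← ENNReal.ofReal_mul (by positivity)]
        congr 2
        rw [hc]
        field_simp

theorem enorm_sub_setAverage_le {u : E → ℝ} {Z : Set E} (hu : IntegrableOn u Z)
    (hZ0 : volume Z ≠ 0) (hZf : volume Z ≠ ⊤) (a : ℝ) :
    ‖a - ⨍ y in Z, u y‖ₑ ≤ (volume Z)⁻¹ * ∫⁻ y in Z, ‖a - u y‖ₑ := by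
  have hr : volume.real Z ≠ 0 := (ENNReal.toReal_pos hZ0 hZf).ne'
  have e : a - ⨍ y in Z, u y = (volume.real Z)⁻¹ * ∫ y in Z, (a - u y) := by
    have hc : IntegrableOn (fun _ => a) Z := integrableOn_const hZf
    rw [integral_sub hc hu, setAverage_eq, setIntegral_const, smul_eq_mul,
      smul_eq_mul]
    field_simp
  rw [e, enorm_mul]
  have h1 : ‖(volume.real Z)⁻¹‖ₑ = (volume Z)⁻¹ := by
    rw [Real.enorm_eq_ofReal (by positivity), Measure.real,
      ENNReal.ofReal_inv_of_pos (ENNReal.toReal_pos hZ0 hZf),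
      ENNReal.ofReal_toReal hZf]
  rw [h1]
  gcongr
  exact enorm_integral_le_lintegral_enorm _

/-- Comparison of the averages over two subsets of convex neighbourhoods of the same point `x`. Both
are compared with the value of a mollification at `x`, which cancels. -/
theorem exists_enorm_average_sub_average_le :
    ∃ C : ℝ, 0 < C ∧ ∀ {Ω : Set E} {v : E → ℝ} {G : E → ℝ≥0∞}, GradBound Ω v G →
      ∀ {x : E} {Q S Z : Fin 2 → Set E} {D : Fin 2 → ℝ},
      (∀ i, IsOpen (Q i) ∧ Q i ⊆ Ω ∧ closure (S i) ⊆ Q i ∧ Convex ℝ (S i) ∧ MeasurableSet (S i) ∧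
        MeasurableSet (Z i) ∧ Z i ⊆ S i ∧ x ∈ S i ∧ 0 < D i ∧ S i ⊆ closedBall x (D i) ∧
        volume (Z i) ≠ 0) →
      ‖(⨍ y in Z 0, v y) - ⨍ y in Z 1, v y‖ₑ ≤
        ∑ i, (volume (Z i))⁻¹ * (ENNReal.ofReal (C * D i ^ 3) * pot G (Q i) x) := by
  obtain ⟨C, hC, hmol⟩ := exists_lintegral_enorm_mollify_sub_le
  refine ⟨C, hC, ?_⟩
  intro Ω v G hvG x Q S Z D h
  choose hQo hQΩ hSQ hS hSm hZ hZS hx hD hSD hZ0 using h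
  have hcS : ∀ i, IsCompact (closure (S i)) := fun i =>
    ((isCompact_closedBall x (D i)).of_isClosed_subset isClosed_closure
      (closure_minimal (hSD i) isClosed_closedBall))
  have hex := fun i => (hcS i).exists_cthickening_subset_open (hQo i) (hSQ i)
  choose δ hδ hδQ using hex
  set Q' : Fin 2 → Set E := fun i => cthickening (δ i) (closure (S i)) with hQ'
  set K : Set E := Q' 0 ∪ Q' 1 with hK
  have hKc : IsCompact K := (hcS 0).cthickening.union (hcS 1).cthickening
  have hQK : ∀ i, Q' i ⊆ K := by
    intro i
    fin_cases i
    · exact subset_union_left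
    · exact subset_union_right
  have hKΩ : K ⊆ Ω := union_subset ((hδQ 0).trans (hQΩ 0)) ((hδQ 1).trans (hQΩ 1))
  have hSK : ∀ i, S i ⊆ K := fun i =>
    (subset_closure.trans (self_subset_cthickening _)).trans (hQK i)
  obtain ⟨g, hg, hG⟩ := hvG.exists_grad
  have hV : Integrable (K.indicator v) := integrable_indicator_of_hasWeakPartial (hg 0) hKc hKΩ
  have hZf : ∀ i, volume (Z i) ≠ ⊤ := fun i =>
    ((measure_mono ((hZS i).trans (hSD i))).trans_lt measure_closedBall_lt_top).ne
  have hlim : ∀ i, Tendsto (fun n => ⨍ y in Z i, mollify (K.indicator v) n y) atTop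
      (𝓝 (⨍ y in Z i, v y)) := by
    intro i
    simp_rw [setAverage_eq]
    refine Tendsto.const_smul ?_ _
    have := tendsto_setIntegral_mollify hV (hZ i) (hZf i)
    rwa [setIntegral_congr_fun (g := v) (hZ i) fun y hy =>
      indicator_of_mem (hSK i (hZS i hy)) _] at this
  have hlim' := ((hlim 0).sub (hlim 1)).enorm
  refine le_of_tendsto hlim' ?_
  have hev : ∀ i, ∀ᶠ n : ℕ in atTop, (1 : ℝ) / (n + 1) ≤ δ i := fun i =>
    (tendsto_one_div_add_atTop_nhds_zero_nat.eventually (gt_mem_nhds (hδ i))).mono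
      fun n hn => le_of_lt hn
  filter_upwards [hev 0, hev 1] with n h0 h1
  have hn : ∀ i, (1 : ℝ) / (n + 1) ≤ δ i := Fin.forall_fin_two.2 ⟨h0, h1⟩
  set u := mollify (K.indicator v) n with hu
  have hi : ∀ i, IntegrableOn u (Z i) := fun i =>
    ((contDiff_mollify hV.locallyIntegrable n).continuous.continuousOn.integrableOn_compact
      (isCompact_closedBall x (D i))).mono_set ((hZS i).trans (hSD i))
  have hb : ∀ i, ‖u x - ⨍ y in Z i, u y‖ₑ ≤
      (volume (Z i))⁻¹ * (ENNReal.ofReal (C * D i ^ 3) * pot G (Q i) x) := by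
    intro i
    refine (enorm_sub_setAverage_le (hi i) (hZ0 i) (hZf i) _).trans (mul_le_mul_right ?_ _)
    refine (hmol hvG hKc hKΩ (hQK i) isClosed_cthickening.measurableSet (hS i) (hSm i) (hZ i)
      (hZS i) (hx i) (hD i) (hSD i) fun z hz => ?_).trans
      (mul_le_mul_right (pot_mono G (hδQ i) x) _)
    exact (closedBall_subset_closedBall (hn i)).trans
      (closedBall_subset_cthickening (subset_closure hz) _)
  rw [Fin.sum_univ_two]
  calc ‖(⨍ y in Z 0, u y) - ⨍ y in Z 1, u y‖ₑ
      = ‖(u x - ⨍ y in Z 1, u y) - (u x - ⨍ y in Z 0, u y)‖ₑ := by congr 1; ring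
    _ ≤ ‖u x - ⨍ y in Z 1, u y‖ₑ + ‖u x - ⨍ y in Z 0, u y‖ₑ := enorm_sub_le
    _ ≤ _ := by
        rw [add_comm]
        exact add_le_add (hb 0) (hb 1)

theorem tendsto_pot_ball {G : E → ℝ≥0∞} {x : E} {U : Set E} (hU : U ∈ 𝓝 x)
    (h : pot G U x ≠ ⊤) :
    Tendsto (fun s : ℝ => pot G (ball x (2 * s)) x) (𝓝[>] 0) (𝓝 0) := by
  obtain ⟨s₀, hs₀, hs₀U⟩ := Metric.mem_nhds_iff.1 hU
  have hfin : pot G (ball x s₀) x ≠ ⊤ := ((pot_mono G hs₀U x).trans_lt h.lt_top).ne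
  have hv : Tendsto (fun s : ℝ => (volume.restrict (ball x s₀)) (ball x (2 * s))) (𝓝[>] 0)
      (𝓝 0) := by
    have : Tendsto (fun s : ℝ => ENNReal.ofReal (unitVol * (2 * s) ^ 3)) (𝓝[>] 0)
        (𝓝 (ENNReal.ofReal (unitVol * (2 * 0) ^ 3))) := by
      refine Tendsto.mono_left ?_ nhdsWithin_le_nhds
      exact (ENNReal.continuous_ofReal.comp (by fun_prop)).tendsto 0
    simp only [mul_zero, ne_eq, OfNat.ofNat_ne_zero, not_false_eq_true, zero_pow,
      ENNReal.ofReal_zero] at this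
    refine tendsto_of_tendsto_of_tendsto_of_le_of_le' tendsto_const_nhds this
      (Eventually.of_forall fun _ => zero_le) ?_
    filter_upwards [self_mem_nhdsWithin] with s hs
    rw [← volume_ball_eq x (by linarith [mem_Ioi.1 hs])]
    exact Measure.restrict_apply_le _ _
  have := tendsto_setLIntegral_zero (f := fun z => G z * kern 2 x z) hfin hv
  refine this.congr' ?_
  filter_upwards [Ioo_mem_nhdsGT (show (0 : ℝ) < s₀ / 2 by positivity)] with s hs
  rw [Measure.restrict_restrict isOpen_ball.measurableSet, inter_eq_left.2
    (ball_subset_ball (by linarith [hs.2])), pot]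

theorem tendsto_preciseRep {v : E → ℝ} {x : E} (h : HasPreciseValue v x) :
    Tendsto (fun s : ℝ => ⨍ y in ball x s, v y) (𝓝[>] (0 : ℝ)) (𝓝 (preciseRep v x)) :=
  tendsto_nhds_limUnder h

/-- A Sobolev function has a precise value wherever the Riesz potential of its gradient is
finite. -/
theorem GradBound.hasPreciseValue {Ω : Set E} {v : E → ℝ} {G : E → ℝ≥0∞} (hvG : GradBound Ω v G)
    {x : E} {U : Set E} (hU : U ∈ 𝓝 x) (hUΩ : U ⊆ Ω) (h : pot G U x ≠ ⊤) :
    HasPreciseValue v x := by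
  obtain ⟨C, hC, hcomp⟩ := exists_enorm_average_sub_average_le
  obtain ⟨s₀, hs₀, hs₀U⟩ := Metric.mem_nhds_iff.1 hU
  have hu := unitVol_pos
  set A : ℝ≥0∞ := ENNReal.ofReal (C / unitVol) with hA
  have hbound : ∀ s ∈ Ioo (0 : ℝ) (s₀ / 2), ∀ s' ∈ Ioo (0 : ℝ) (s₀ / 2),
      edist (⨍ y in ball x s, v y) (⨍ y in ball x s', v y) ≤
        A * pot G (ball x (2 * s)) x + A * pot G (ball x (2 * s')) x := by
    intro s hs s' hs'
    have hpos : ∀ i, 0 < (![s, s'] : Fin 2 → ℝ) i := Fin.forall_fin_two.2 ⟨hs.1, hs'.1⟩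
    have hlt : ∀ i, (![s, s'] : Fin 2 → ℝ) i < s₀ / 2 := Fin.forall_fin_two.2 ⟨hs.2, hs'.2⟩
    have := hcomp hvG (x := x) (Q := fun i => ball x (2 * ![s, s'] i))
      (S := fun i => ball x (![s, s'] i)) (Z := fun i => ball x (![s, s'] i)) (D := ![s, s'])
      fun i => ⟨isOpen_ball, ((ball_subset_ball (by linarith [hlt i])).trans hs₀U).trans hUΩ,
        closure_ball_subset_closedBall.trans (closedBall_subset_ball (by linarith [hpos i])),
        convex_ball _ _, isOpen_ball.measurableSet, isOpen_ball.measurableSet, subset_rfl,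
        mem_ball_self (hpos i), hpos i, ball_subset_closedBall, (measure_ball_pos _ _ (hpos i)).ne'⟩
    rw [Fin.sum_univ_two] at this
    have e : ∀ t : ℝ, 0 < t → ∀ P : ℝ≥0∞, (volume (ball x t))⁻¹ * (ENNReal.ofReal (C * t ^ 3) * P) =
        A * P := by
      intro t ht P
      rw [volume_ball_eq x ht.le, ← mul_assoc, ← ENNReal.ofReal_inv_of_pos (by positivity),
        ← ENNReal.ofReal_mul (by positivity), hA]
      congr 2
      field_simp
    rw [edist_eq_enorm_sub]
    refine this.trans (le_of_eq ?_)
    rw [e _ (hpos 0), e _ (hpos 1)]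
    rfl
  have hcauchy : Cauchy (map (fun s : ℝ => ⨍ y in ball x s, v y) (𝓝[>] (0 : ℝ))) := by
    rw [EMetric.cauchy_iff]
    refine ⟨map_neBot.ne, fun ε hε => ?_⟩
    have hlim : Tendsto (fun s : ℝ => A * pot G (ball x (2 * s)) x) (𝓝[>] 0) (𝓝 0) := by
      have := ENNReal.Tendsto.const_mul (a := A) (tendsto_pot_ball hU h)
        (Or.inr ENNReal.ofReal_ne_top)
      rwa [mul_zero] at this
    have hev := hlim.eventually (gt_mem_nhds (ENNReal.half_pos hε.ne'))
    have hmem := inter_mem hev (Ioo_mem_nhdsGT (show (0 : ℝ) < s₀ / 2 by positivity))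
    refine ⟨_, image_mem_map hmem, ?_⟩
    rintro _ ⟨s, ⟨hs1, hs2⟩, rfl⟩ _ ⟨s', ⟨hs1', hs2'⟩, rfl⟩
    refine (hbound s hs2 s' hs2').trans_lt ?_
    rw [← ENNReal.add_halves ε]
    exact ENNReal.add_lt_add hs1 hs1'
  exact CompleteSpace.complete hcauchy

/-- The dilates `x + c⁻¹ (Q - x)`, `c = 1 + 1 / (k + 1)`, of an open convex set about one of its
points exhaust the set, and their closures are contained in it. -/
def dilate (Q : Set E) (x : E) (k : ℕ) : Set E :=
  (fun y => x + (1 + 1 / ((k : ℝ) + 1)) • (y - x)) ⁻¹' Q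

theorem closure_preimage_homothety_subset {Q : Set E} (hQo : IsOpen Q) (hQ : Convex ℝ Q) {x : E}
    (hx : x ∈ Q) {c : ℝ} (hc : 1 < c) : closure ((fun y => x + c • (y - x)) ⁻¹' Q) ⊆ Q := by
  intro y hy
  have hcont : Continuous fun y : E => x + c • (y - x) := by fun_prop
  have h1 : x + c • (y - x) ∈ closure Q := hcont.closure_preimage_subset Q hy
  have h2 := hQ.openSegment_interior_closure_subset_interior (hQo.interior_eq.symm ▸ hx) h1
  rw [hQo.interior_eq] at h2
  have hc1 : c⁻¹ < 1 := inv_lt_one_of_one_lt₀ hc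
  have hc0 : 0 < c⁻¹ := inv_pos.2 (by linarith)
  refine h2 ⟨1 - c⁻¹, c⁻¹, by linarith, hc0, by ring, ?_⟩
  rw [smul_add, smul_smul, inv_mul_cancel₀ (by linarith)]
  module

theorem closure_dilate_subset {Q : Set E} (hQo : IsOpen Q) (hQ : Convex ℝ Q) {x : E} (hx : x ∈ Q)
    (k : ℕ) : closure (dilate Q x k) ⊆ Q := by
  have hk : (0 : ℝ) < 1 / ((k : ℝ) + 1) := by positivity
  exact closure_preimage_homothety_subset hQo hQ hx (by linarith)

theorem convex_dilate {Q : Set E} (hQ : Convex ℝ Q) (x : E) (k : ℕ) : Convex ℝ (dilate Q x k) := by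
  intro y hy z hz a b ha hb hab
  have := hQ hy hz ha hb hab
  have e : x + (1 + 1 / ((k : ℝ) + 1)) • (a • y + b • z - x) =
      a • (x + (1 + 1 / ((k : ℝ) + 1)) • (y - x)) +
        b • (x + (1 + 1 / ((k : ℝ) + 1)) • (z - x)) := by
    obtain rfl : a = 1 - b := by linarith
    module
  rw [dilate, mem_preimage, e]
  exact this

theorem monotone_dilate {Q : Set E} (hQ : Convex ℝ Q) {x : E} (hx : x ∈ Q) :
    Monotone (dilate Q x) := by
  intro k l hkl y hy
  rw [dilate, mem_preimage] at hy ⊢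
  have hle : 1 / ((l : ℝ) + 1) ≤ 1 / ((k : ℝ) + 1) := by gcongr
  have hl : (0 : ℝ) < 1 / ((l : ℝ) + 1) := by positivity
  generalize 1 / ((l : ℝ) + 1) = b at *
  generalize 1 / ((k : ℝ) + 1) = a at *
  have := hQ.add_smul_sub_mem hx hy (t := (1 + b) / (1 + a))
    ⟨div_nonneg (by linarith) (by linarith), by rw [div_le_one (by linarith)]; linarith⟩
  rw [add_sub_cancel_left, smul_smul, div_mul_cancel₀ _ (by linarith)] at this
  exact this

theorem iUnion_dilate {Q : Set E} (hQo : IsOpen Q) (hQ : Convex ℝ Q) {x : E} (hx : x ∈ Q) :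
    ⋃ k, dilate Q x k = Q := by
  refine Subset.antisymm (iUnion_subset fun k =>
    subset_closure.trans (closure_dilate_subset hQo hQ hx k)) fun y hy => ?_
  have h : Tendsto (fun k : ℕ => x + (1 + 1 / ((k : ℝ) + 1)) • (y - x)) atTop
      (𝓝 (x + (1 + (0 : ℝ)) • (y - x))) :=
    ((tendsto_const_nhds.add tendsto_one_div_add_atTop_nhds_zero_nat).smul_const _).const_add _
  rw [add_zero, one_smul, add_sub_cancel] at h
  obtain ⟨k, hk⟩ := (h.eventually (hQo.mem_nhds hy)).exists
  exact mem_iUnion.2 ⟨k, hk⟩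

/-- The difference between the precise value at `x` and the average over a subset `Z` of a convex
neighbourhood `Q` of `x` is bounded by the Riesz potential of the gradient on `Q`. Since
mollification needs room inside `Q`, the average is first taken over the part of `Z` in a
dilate of `Q` with ratio less than `1`. -/
theorem exists_enorm_preciseRep_sub_average_le :
    ∃ C : ℝ, 0 < C ∧ ∀ {Ω : Set E} {v : E → ℝ} {G : E → ℝ≥0∞}, GradBound Ω v G →
      ∀ {x : E} {Q Z : Set E} {D : ℝ}, IsOpen Q → Convex ℝ Q → Q ⊆ Ω → x ∈ Q → 0 < D →
      Q ⊆ closedBall x D → MeasurableSet Z → Z ⊆ Q → volume Z ≠ 0 → IntegrableOn v Z →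
      ‖preciseRep v x - ⨍ y in Z, v y‖ₑ ≤
        (volume Z)⁻¹ * (ENNReal.ofReal (C * D ^ 3) * pot G Q x) := by
  obtain ⟨C, hC, hcomp⟩ := exists_enorm_average_sub_average_le
  refine ⟨C, hC, ?_⟩
  intro Ω v G hvG x Q Z D hQo hQ hQΩ hx hD hQD hZ hZQ hZ0 hvZ
  have hu := unitVol_pos
  have hZf : volume Z ≠ ⊤ :=
    ((measure_mono (hZQ.trans hQD)).trans_lt measure_closedBall_lt_top).ne
  -- if the potential is infinite, then so is the right-hand side
  by_cases hpot : pot G Q x = ⊤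
  · rw [hpot, ENNReal.mul_top (by simp; positivity), ENNReal.mul_top (by simpa using hZf)]
    exact le_top
  have hQx : Q ∈ 𝓝 x := hQo.mem_nhds hx
  have hpv := hvG.hasPreciseValue hQx hQΩ hpot
  obtain ⟨s₀, hs₀, hs₀Q⟩ := Metric.mem_nhds_iff.1 hQx
  have hSQ : ∀ k, dilate Q x k ⊆ Q := fun k =>
    subset_closure.trans (closure_dilate_subset hQo hQ hx k)
  have hSo : ∀ k, IsOpen (dilate Q x k) := fun k => hQo.preimage (by fun_prop)
  -- first the radius of the ball around `x` tends to zero, for a fixed dilate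
  have hk : ∀ k, volume (Z ∩ dilate Q x k) ≠ 0 →
      ‖preciseRep v x - ⨍ y in Z ∩ dilate Q x k, v y‖ₑ ≤
        (volume (Z ∩ dilate Q x k))⁻¹ * (ENNReal.ofReal (C * D ^ 3) * pot G Q x) := by
    intro k hk0
    set T := Z ∩ dilate Q x k with hT
    have hlim := ((tendsto_preciseRep hpv).sub_const (⨍ y in T, v y)).enorm
    set A : ℝ≥0∞ := ENNReal.ofReal (C / unitVol) with hA
    have hlim2 : Tendsto (fun s : ℝ => A * pot G (ball x (2 * s)) x +
        (volume T)⁻¹ * (ENNReal.ofReal (C * D ^ 3) * pot G Q x)) (𝓝[>] 0)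
        (𝓝 (A * 0 + (volume T)⁻¹ * (ENNReal.ofReal (C * D ^ 3) * pot G Q x))) :=
      (ENNReal.Tendsto.const_mul (tendsto_pot_ball hQx hpot)
        (Or.inr ENNReal.ofReal_ne_top)).add_const _
    rw [mul_zero, zero_add] at hlim2
    refine le_of_tendsto_of_tendsto hlim hlim2 ?_
    filter_upwards [Ioo_mem_nhdsGT (show (0 : ℝ) < s₀ / 2 by positivity)] with s hs
    have := hcomp hvG (x := x) (Q := ![ball x (2 * s), Q]) (S := ![ball x s, dilate Q x k])
      (Z := ![ball x s, T]) (D := ![s, D]) (Fin.forall_fin_two.2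
      ⟨⟨isOpen_ball, ((ball_subset_ball (by linarith [hs.2])).trans hs₀Q).trans hQΩ,
        closure_ball_subset_closedBall.trans (closedBall_subset_ball (by linarith [hs.1])),
        convex_ball _ _, isOpen_ball.measurableSet, isOpen_ball.measurableSet, subset_rfl,
        mem_ball_self hs.1, hs.1, ball_subset_closedBall, (measure_ball_pos _ _ hs.1).ne'⟩,
      ⟨hQo, hQΩ, closure_dilate_subset hQo hQ hx k, convex_dilate hQ x k, (hSo k).measurableSet,
        hZ.inter (hSo k).measurableSet, inter_subset_right, by simpa [dilate] using hx, hD,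
        (hSQ k).trans hQD, hk0⟩⟩)
    rw [Fin.sum_univ_two] at this
    refine this.trans (le_of_eq ?_)
    congr 1
    change (volume (ball x s))⁻¹ * (ENNReal.ofReal (C * s ^ 3) * _) = _
    have hs1 := hs.1
    rw [volume_ball_eq x hs.1.le, ← mul_assoc, ← ENNReal.ofReal_inv_of_pos (by positivity),
      ← ENNReal.ofReal_mul (by positivity), hA]
    congr 2
    field_simp
  -- then the dilates exhaust `Q`
  have hmono : Monotone fun k => Z ∩ dilate Q x k := fun k l hkl =>
    inter_subset_inter_right _ (monotone_dilate hQ hx hkl)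
  have hUnion : ⋃ k, Z ∩ dilate Q x k = Z := by
    rw [← inter_iUnion, iUnion_dilate hQo hQ hx, inter_eq_left.2 hZQ]
  have hvol : Tendsto (fun k => volume (Z ∩ dilate Q x k)) atTop (𝓝 (volume Z)) := by
    have := tendsto_measure_iUnion_atTop (μ := volume) hmono
    rwa [hUnion] at this
  have hint : Tendsto (fun k => ∫ y in Z ∩ dilate Q x k, v y) atTop (𝓝 (∫ y in Z, v y)) := by
    have := tendsto_setIntegral_of_monotone (fun k => hZ.inter (hSo k).measurableSet) hmono
      (f := v) (μ := volume) (by rwa [hUnion])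
    rwa [hUnion] at this
  have hav : Tendsto (fun k => ⨍ y in Z ∩ dilate Q x k, v y) atTop (𝓝 (⨍ y in Z, v y)) := by
    simp_rw [setAverage_eq]
    refine Tendsto.smul (Tendsto.inv₀ ((ENNReal.tendsto_toReal hZf).comp hvol) ?_) hint
    exact (ENNReal.toReal_pos hZ0 hZf).ne'
  have hrhs : Tendsto (fun k => (volume (Z ∩ dilate Q x k))⁻¹ *
      (ENNReal.ofReal (C * D ^ 3) * pot G Q x)) atTop
      (𝓝 ((volume Z)⁻¹ * (ENNReal.ofReal (C * D ^ 3) * pot G Q x))) :=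
    ENNReal.Tendsto.mul_const (tendsto_inv_iff.2 hvol)
      (Or.inr (ENNReal.mul_ne_top ENNReal.ofReal_ne_top hpot))
  refine le_of_tendsto_of_tendsto ((tendsto_const_nhds.sub hav).enorm) hrhs ?_
  filter_upwards [hvol.eventually_ne hZ0] with k hk0 using hk k hk0

/-! ### Sobolev functions and their precise representatives -/

theorem HasWeakPartial.mono {Ω Ω' : Set E} (hsub : Ω' ⊆ Ω) {j : Fin 3} {v g : E → ℝ}
    (h : HasWeakPartial Ω j v g) : HasWeakPartial Ω' j v g := by
  refine ⟨h.1.mono_set hsub, h.2.1.mono_set hsub, fun φ hφ hφc hφs => ?_⟩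
  have h1 := h.2.2 φ hφ hφc (hφs.trans hsub)
  have e1 : ∀ U : Set E, Ω' ⊆ U →
      ∫ y in U, v y * fderiv ℝ φ y (EuclideanSpace.single j 1) =
        ∫ y, v y * fderiv ℝ φ y (EuclideanSpace.single j 1) := fun U hU =>
    setIntegral_eq_integral_of_forall_compl_eq_zero fun y hy => by
      have : y ∉ tsupport (fderiv ℝ φ) := fun h => hy (hU (hφs (tsupport_fderiv_subset ℝ h)))
      simp [image_eq_zero_of_notMem_tsupport this]
  have e2 : ∀ U : Set E, Ω' ⊆ U → ∫ y in U, g y * φ y = ∫ y, g y * φ y := fun U hU =>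
    setIntegral_eq_integral_of_forall_compl_eq_zero fun y hy => by
      simp [image_eq_zero_of_notMem_tsupport fun h => hy (hU (hφs h))]
  rwa [e1 Ω' subset_rfl, e2 Ω' subset_rfl, ← e1 Ω hsub, ← e2 Ω hsub]

/-- The Lebesgue differentiation theorem. -/
theorem ae_preciseRep_eq {Ω : Set E} (hΩ : IsOpen Ω) {v : E → ℝ}
    (hv : LocallyIntegrable (Ω.indicator v)) :
    ∀ᵐ x ∂(volume.restrict Ω), HasPreciseValue v x ∧ preciseRep v x = v x := by
  have h := IsUnifLocDoublingMeasure.ae_tendsto_average (μ := (volume : Measure E)) hv 1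
  rw [ae_restrict_iff' hΩ.measurableSet]
  refine h.mono fun x hx hxΩ => ?_
  have h1 := hx (fun _ : ℝ => x) (fun s : ℝ => s) (l := 𝓝[>] (0 : ℝ)) tendsto_id (by
    filter_upwards [self_mem_nhdsWithin] with s hs
    exact mem_closedBall_self (by simpa using (mem_Ioi.1 hs).le))
  rw [indicator_of_mem hxΩ] at h1
  obtain ⟨s₀, hs₀, hs₀Ω⟩ := Metric.isOpen_iff.1 hΩ x hxΩ
  have h2 : Tendsto (fun s : ℝ => ⨍ y in ball x s, v y) (𝓝[>] (0 : ℝ)) (𝓝 (v x)) := by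
    refine h1.congr' ?_
    filter_upwards [Ioo_mem_nhdsGT hs₀] with s hs
    have hb : (closedBall x s : Set E) =ᵐ[volume] ball x s := by
      rw [← ball_union_sphere]
      exact union_ae_eq_left_of_ae_eq_empty (ae_eq_empty.2 (Measure.addHaar_sphere _ x s))
    rw [setAverage_congr hb]
    refine setAverage_congr_fun isOpen_ball.measurableSet (ae_of_all _ fun y hy => ?_)
    exact indicator_of_mem (hs₀Ω (ball_subset_ball hs.2.le hy)) _
  exact ⟨⟨_, h2⟩, h2.limUnder_eq⟩

theorem locallyIntegrable_indicator {Ω : Set E} (hΩ : IsOpen Ω) {p : ℝ≥0∞} (hp : 1 ≤ p) {v : E → ℝ}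
    (hv : MemLp v p (volume.restrict Ω)) : LocallyIntegrable (Ω.indicator v) :=
  ((memLp_indicator_iff_restrict hΩ.measurableSet).2 hv).locallyIntegrable hp

/-- The precise representative is measurable with respect to any measure, singular or not, that
charges only points of a compact set at which the precise value exists. -/
theorem aestronglyMeasurable_preciseRep {Ω K : Set E} (hΩ : IsOpen Ω) (hK : IsCompact K)
    (hKΩ : K ⊆ Ω) {v : E → ℝ} (hv : LocallyIntegrableOn v Ω) {μ : Measure E}
    (hμ : ∀ᵐ x ∂μ, x ∈ K ∧ HasPreciseValue v x) : AEStronglyMeasurable (preciseRep v) μ := by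
  obtain ⟨δ, hδ, hδΩ⟩ := hK.exists_cthickening_subset_open hΩ hKΩ
  have hint : IntegrableOn v (cthickening δ K) :=
    (hv.mono_set hδΩ).integrableOn_isCompact hK.cthickening
  set w : E → ℝ := hint.aestronglyMeasurable.mk v with hw
  have hwm : StronglyMeasurable w := hint.aestronglyMeasurable.stronglyMeasurable_mk
  have hwv : ∀ᵐ y ∂(volume.restrict (cthickening δ K)), v y = w y :=
    hint.aestronglyMeasurable.ae_eq_mk
  set s : ℕ → ℝ := fun n => δ / (n + 1) with hs
  have hs0 : ∀ n, 0 < s n := fun n => by positivity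
  have hsδ : ∀ n, s n ≤ δ := fun n => div_le_self hδ.le (by simp)
  have hslim : Tendsto s atTop (𝓝[>] 0) := by
    refine tendsto_nhdsWithin_iff.2 ⟨?_, Eventually.of_forall hs0⟩
    have := (tendsto_one_div_add_atTop_nhds_zero_nat (𝕜 := ℝ)).const_mul δ
    simpa [hs, div_eq_mul_inv] using this
  refine aestronglyMeasurable_of_tendsto_ae atTop
    (f := fun n x => (unitVol * s n ^ 3)⁻¹ * ∫ y, {q : E × E | dist q.2 q.1 < s n}.indicator
      (fun q => w q.2) (x, y)) (fun n => ?_) (hμ.mono fun x hx => ?_)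
  · have h1 : StronglyMeasurable (Function.uncurry fun x y : E =>
        {q : E × E | dist q.2 q.1 < s n}.indicator (fun q => w q.2) (x, y)) := by
      have h2 : StronglyMeasurable fun q : E × E => w q.2 := hwm.comp_measurable measurable_snd
      exact h2.indicator (measurableSet_lt (by fun_prop) measurable_const)
    exact (h1.integral_prod_right.const_mul _).aestronglyMeasurable
  · refine ((tendsto_preciseRep hx.2).comp hslim).congr fun n => ?_
    have hsub : ball x (s n) ⊆ cthickening δ K :=
      ball_subset_closedBall.trans ((closedBall_subset_closedBall (hsδ n)).trans
        (closedBall_subset_cthickening hx.1 δ))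
    have hu := unitVol_pos
    have hn := hs0 n
    rw [Function.comp_apply, setAverage_eq, Measure.real, volume_ball_eq x (hs0 n).le,
      ENNReal.toReal_ofReal (by positivity), smul_eq_mul]
    congr 1
    rw [setIntegral_congr_ae (g := w) isOpen_ball.measurableSet,
      ← integral_indicator isOpen_ball.measurableSet]
    · rfl
    · have := ae_restrict_of_ae_restrict_of_subset hsub hwv
      rwa [ae_restrict_iff' isOpen_ball.measurableSet] at this

theorem hasWeakPartial_weakPartial {Ω : Set E} {j : Fin 3} {v : E → ℝ}
    (h : ∃ g, HasWeakPartial Ω j v g) : HasWeakPartial Ω j v (weakPartial Ω j v) := by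
  rw [weakPartial, dif_pos h]
  exact h.choose_spec

theorem MemSobolev.memLp {Ω : Set E} {p : ℝ≥0∞} {k : ℕ} {v : E → ℝ} (h : MemSobolev Ω p k v) :
    MemLp v p (volume.restrict Ω) := by
  cases k with
  | zero => exact h
  | succ k => exact h.1

theorem eLpNorm_le_sobolevNorm (Ω : Set E) (p : ℝ≥0∞) (k : ℕ) (v : E → ℝ) :
    eLpNorm v p (volume.restrict Ω) ≤ sobolevNorm Ω p k v := by
  cases k with
  | zero => exact le_rfl
  | succ k => exact le_self_add

/-- The `L^p` norm on a set of a function with values in `[0, ∞]`. -/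
def lpNorm (p : ℝ) (G : E → ℝ≥0∞) (Q : Set E) : ℝ≥0∞ := (∫⁻ y in Q, G y ^ p) ^ (1 / p)

theorem lpNorm_mono {p : ℝ} (hp : 0 < p) (G : E → ℝ≥0∞) {Q Q' : Set E} (h : Q ⊆ Q') :
    lpNorm p G Q ≤ lpNorm p G Q' :=
  ENNReal.rpow_le_rpow (lintegral_mono_set h) (by positivity)

theorem lpNorm_sum_le {p : ℝ} (hp : 1 ≤ p) {ι : Type*} (s : Finset ι) (F : ι → E → ℝ≥0∞)
    (hF : ∀ i ∈ s, Measurable (F i)) (Q : Set E) :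
    lpNorm p (fun y => ∑ i ∈ s, F i y) Q ≤ ∑ i ∈ s, lpNorm p (F i) Q := by
  have hp0 : 0 < p := by linarith
  classical
  induction s using Finset.induction_on with
  | empty => simp [lpNorm, hp0]
  | insert a s ha ih =>
    have h1 : Measurable fun y => ∑ i ∈ s, F i y :=
      Finset.measurable_sum _ fun i hi => hF i (Finset.mem_insert_of_mem hi)
    have := ENNReal.lintegral_Lp_add_le (μ := volume.restrict Q)
      (hF a (Finset.mem_insert_self a s)).aemeasurable h1.aemeasurable hp
    simp only [Finset.sum_insert ha]
    exact this.trans (add_le_add le_rfl (ih fun i hi => hF i (Finset.mem_insert_of_mem hi)))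

/-- A Sobolev function has a gradient majorant whose `L^p` norm is the sum of those of the weak
partial derivatives. -/
theorem exists_gradBound {Ω : Set E} {p : ℝ} (hp : 1 < p) {v : E → ℝ}
    (hw : ∀ j, ∃ g, HasWeakPartial Ω j v g)
    (hv : ∀ j, MemLp (weakPartial Ω j v) (ENNReal.ofReal p) (volume.restrict Ω)) :
    ∃ G, GradBound Ω v G ∧ lpNorm p G Ω ≠ ⊤ ∧ lpNorm p G Ω ≤
      ∑ j, eLpNorm (weakPartial Ω j v) (ENNReal.ofReal p) (volume.restrict Ω) := by
  have hp0 : 0 < p := by linarith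
  set g' : Fin 3 → E → ℝ := fun j => (hv j).1.mk _
  have hg'm : ∀ j, Measurable fun y => ‖g' j y‖ₑ := fun j =>
    (hv j).1.stronglyMeasurable_mk.measurable.enorm
  have hae : ∀ j, ∀ᵐ y ∂(volume.restrict Ω), weakPartial Ω j v y = g' j y := fun j =>
    (hv j).1.ae_eq_mk
  refine ⟨fun y => ∑ j, ‖g' j y‖ₑ, ⟨Finset.measurable_sum _ fun j _ => hg'm j,
    fun j => weakPartial Ω j v, fun j => hasWeakPartial_weakPartial (hw j), ?_⟩, ?_⟩
  rotate_left
  · have hle : lpNorm p (fun y => ∑ j, ‖g' j y‖ₑ) Ω ≤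
        ∑ j, eLpNorm (weakPartial Ω j v) (ENNReal.ofReal p) (volume.restrict Ω) := by
      refine (lpNorm_sum_le hp.le _ _ (fun j _ => hg'm j) Ω).trans
        (Finset.sum_le_sum fun j _ => ?_)
      rw [eLpNorm_congr_ae (hae j), eLpNorm_eq_lintegral_rpow_enorm_toReal (by simpa using hp0)
        ENNReal.ofReal_ne_top, ENNReal.toReal_ofReal hp0.le, lpNorm]
    exact ⟨(hle.trans_lt (ENNReal.sum_lt_top.2 fun j _ => (hv j).2)).ne, hle⟩
  · filter_upwards [ae_all_iff.2 hae] with y hy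
    exact le_of_eq (Finset.sum_congr rfl fun j _ => by rw [hy j])

theorem MemSobolev.exists_gradBound {Ω : Set E} {p : ℝ} (hp : 1 < p) {k : ℕ} {v : E → ℝ}
    (hv : MemSobolev Ω (ENNReal.ofReal p) (k + 1) v) :
    ∃ G, GradBound Ω v G ∧ lpNorm p G Ω ≠ ⊤ ∧
      lpNorm p G Ω ≤ sobolevNorm Ω (ENNReal.ofReal p) (k + 1) v := by
  obtain ⟨G, hG, hfin, hle⟩ := Sedimentation.exists_gradBound hp (fun j => (hv.2 j).1)
    fun j => (hv.2 j).2.memLp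
  refine ⟨G, hG, hfin, hle.trans ?_⟩
  refine le_trans (Finset.sum_le_sum fun j _ => ?_) le_add_self
  exact eLpNorm_le_sobolevNorm _ _ _ _

/-! ### Measures with bounded density -/

/-- `μ` has a density on `Ω` bounded by `M`. -/
def HasDensityLE (Ω : Set E) (M : ℝ) (μ : Measure E) : Prop :=
  μ ≤ ENNReal.ofReal M • volume.restrict Ω

theorem HasDensityLE.ae {Ω : Set E} {M : ℝ} {μ : Measure E} (h : HasDensityLE Ω M μ) {P : E → Prop}
    (hP : ∀ᵐ x ∂(volume.restrict Ω), P x) : ∀ᵐ x ∂μ, P x :=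
  (Measure.absolutelyContinuous_of_le h).ae_le (Measure.ae_smul_measure hP _)

theorem HasDensityLE.eLpNorm_one_le {Ω : Set E} {M : ℝ} {μ : Measure E} [IsProbabilityMeasure μ]
    (h : HasDensityLE Ω M μ) {p : ℝ} (hp : 1 < p) {v : E → ℝ}
    (hv : MemLp v (ENNReal.ofReal p) (volume.restrict Ω)) :
    MemLp v (ENNReal.ofReal p) μ ∧ eLpNorm v 1 μ ≤
      ENNReal.ofReal M ^ (1 / p) * eLpNorm v (ENNReal.ofReal p) (volume.restrict Ω) := by
  have hp0 : 0 < p := by linarith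
  have hm : MemLp v (ENNReal.ofReal p) μ :=
    (hv.smul_measure ENNReal.ofReal_ne_top).mono_measure h
  refine ⟨hm, ?_⟩
  have h1 := eLpNorm_le_eLpNorm_mul_rpow_measure_univ (μ := μ) (p := 1) (q := ENNReal.ofReal p)
    (by simpa using hp.le) hm.1
  rw [measure_univ, ENNReal.one_rpow, mul_one] at h1
  refine h1.trans ((eLpNorm_mono_measure v h).trans ?_)
  rw [eLpNorm_smul_measure_of_ne_top ENNReal.ofReal_ne_top, smul_eq_mul, ENNReal.toReal_div,
    ENNReal.toReal_one, ENNReal.toReal_ofReal hp0.le]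

theorem HasDensityLE.actsOnSobolev {Ω : Set E} (hΩ : IsOpen Ω) {M : ℝ} {μ : Measure E}
    [IsProbabilityMeasure μ] (h : HasDensityLE Ω M μ) {p : ℝ} (hp : 1 < p) (k : ℕ) :
    ActsOnSobolev Ω k (ENNReal.ofReal p) μ := by
  intro v hv
  have hae := h.ae (ae_preciseRep_eq hΩ (locallyIntegrable_indicator hΩ
    (by simpa using hp.le) hv.memLp))
  refine ⟨hae.mono fun x hx => hx.1, ?_⟩
  have := (h.eLpNorm_one_le hp hv.memLp).1.integrable (by simpa using hp.le)
  exact this.congr (hae.mono fun x hx => hx.2.symm)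

theorem HasDensityLE.enorm_integral_preciseRep_le {Ω : Set E} (hΩ : IsOpen Ω) {M : ℝ}
    {μ : Measure E} [IsProbabilityMeasure μ] (h : HasDensityLE Ω M μ) {p : ℝ} (hp : 1 < p)
    {v : E → ℝ} (hv : MemLp v (ENNReal.ofReal p) (volume.restrict Ω)) :
    ‖∫ x, preciseRep v x ∂μ‖ₑ ≤
      ENNReal.ofReal M ^ (1 / p) * eLpNorm v (ENNReal.ofReal p) (volume.restrict Ω) := by
  have hae := h.ae (ae_preciseRep_eq hΩ (locallyIntegrable_indicator hΩ
    (by simpa using hp.le) hv))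
  rw [integral_congr_ae (hae.mono fun x hx => hx.2)]
  refine (enorm_integral_le_lintegral_enorm _).trans ?_
  rw [← eLpNorm_one_eq_lintegral_enorm]
  exact (h.eLpNorm_one_le hp hv).2

/-! ### Riesz potentials of `L^p` functions on spheres -/

theorem lintegral_mul_kern_le {p q : ℝ} (hpq : p.HolderConjugate q) (β : ℝ) {G : E → ℝ≥0∞}
    (hG : Measurable G) (Q : Set E) (x : E) :
    ∫⁻ z in Q, G z * kern β x z ≤ lpNorm p G Q * (∫⁻ z in Q, kern (β * q) x z) ^ (1 / q) := by
  have := ENNReal.lintegral_mul_le_Lp_mul_Lq (volume.restrict Q) hpq hG.aemeasurable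
    (measurable_kern β x).aemeasurable
  simpa only [Pi.mul_apply, kern_rpow, lpNorm] using this

theorem exists_lintegral_mul_kern_closedBall_le {p q β : ℝ} (hpq : p.HolderConjugate q)
    (hβ : 0 ≤ β) (hβq : β * q < 3) :
    ∃ C : ℝ, 0 ≤ C ∧ ∀ {G : E → ℝ≥0∞}, Measurable G → ∀ {Q : Set E} {x : E} {D : ℝ}, 0 < D →
      Q ⊆ closedBall x D →
      ∫⁻ z in Q, G z * kern β x z ≤ ENNReal.ofReal (C * D ^ (3 / q - β)) * lpNorm p G Q := by
  have hq := hpq.symm.pos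
  obtain ⟨C, hC, h⟩ := lintegral_volume_kern_closedBall_le (β := β * q) (by positivity) hβq
  refine ⟨C ^ (1 / q), by positivity, fun {G} hG {Q} {x} {D} hD hQD => ?_⟩
  refine (lintegral_mul_kern_le hpq β hG Q x).trans ?_
  rw [mul_comm]
  gcongr
  calc (∫⁻ z in Q, kern (β * q) x z) ^ (1 / q)
      ≤ ENNReal.ofReal (C * D ^ (3 - β * q)) ^ (1 / q) :=
        ENNReal.rpow_le_rpow ((lintegral_mono_set hQD).trans (h x D hD)) (by positivity)
    _ = _ := by
        rw [ENNReal.ofReal_rpow_of_nonneg (by positivity) (by positivity),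
          Real.mul_rpow hC (by positivity), ← Real.rpow_mul hD.le]
        congr 3
        field_simp

theorem exists_lintegral_mul_kern_compl_ball_le {p q β : ℝ} (hpq : p.HolderConjugate q)
    (hβq : 3 < β * q) :
    ∃ C : ℝ, 0 ≤ C ∧ ∀ {G : E → ℝ≥0∞}, Measurable G → ∀ {Q : Set E} {x : E} {D : ℝ}, 0 < D →
      Q ⊆ (ball x D)ᶜ →
      ∫⁻ z in Q, G z * kern β x z ≤ ENNReal.ofReal (C * D ^ (3 / q - β)) * lpNorm p G Q := by
  have hq := hpq.symm.pos
  obtain ⟨C, hC, h⟩ := lintegral_volume_kern_compl_ball_le (β := β * q) hβq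
  refine ⟨C ^ (1 / q), by positivity, fun {G} hG {Q} {x} {D} hD hQD => ?_⟩
  refine (lintegral_mul_kern_le hpq β hG Q x).trans ?_
  rw [mul_comm]
  gcongr
  calc (∫⁻ z in Q, kern (β * q) x z) ^ (1 / q)
      ≤ ENNReal.ofReal (C * D ^ (3 - β * q)) ^ (1 / q) :=
        ENNReal.rpow_le_rpow ((lintegral_mono_set hQD).trans (h x D hD)) (by positivity)
    _ = _ := by
        rw [ENNReal.ofReal_rpow_of_nonneg (by positivity) (by positivity),
          Real.mul_rpow hC (by positivity), ← Real.rpow_mul hD.le]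
        congr 3
        field_simp

/-- Kernels of order less than `2` are uniformly integrable on spheres. -/
theorem exists_lintegral_kern_sphereProb_le {β : ℝ} (hβ : 0 ≤ β) (hβ2 : β < 2) :
    ∃ C : ℝ, 0 ≤ C ∧ ∀ (X y : E) (R : ℝ), 0 < R →
      ∫⁻ x, kern β y x ∂(sphereProb X R) ≤ ENNReal.ofReal (C * R ^ (-β)) := by
  obtain ⟨C, hC, h⟩ := lintegral_kern_closedBall_le hβ hβ2
  refine ⟨600 * C + 1, by positivity, fun X y R hR => ?_⟩
  have := isProbabilityMeasure_sphereProb X hR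
  rw [← lintegral_add_compl _ (isClosed_closedBall (x := y) (ε := R)).measurableSet]
  have h1 : ∫⁻ x in closedBall y R, kern β y x ∂(sphereProb X R) ≤
      ENNReal.ofReal (600 * C * R ^ (-β)) := by
    refine (h (sphereProb X R) y R (600 * (R ^ 2)⁻¹) hR (by positivity) fun s hs _ => ?_).trans
      (le_of_eq ?_)
    · rw [show (2 : ℝ) = ((2 : ℕ) : ℝ) by norm_num, Real.rpow_natCast]
      exact sphereProb_closedBall_le X hR y hs.le
    · congr 1
      rw [Real.rpow_sub hR, Real.rpow_neg hR.le, show (2 : ℝ) = ((2 : ℕ) : ℝ) by norm_num,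
        Real.rpow_natCast]
      field_simp
  have h2 : ∫⁻ x in (closedBall y R)ᶜ, kern β y x ∂(sphereProb X R) ≤
      ENNReal.ofReal (R ^ (-β)) := by
    calc ∫⁻ x in (closedBall y R)ᶜ, kern β y x ∂(sphereProb X R)
        ≤ ∫⁻ _x in (closedBall y R)ᶜ, ENNReal.ofReal (R ^ (-β)) ∂(sphereProb X R) := by
          refine setLIntegral_mono' isClosed_closedBall.measurableSet.compl fun x hx => ?_
          refine kern_le_ofReal hβ hR ?_
          rw [dist_comm]
          exact le_of_lt (by simpa using hx)
      _ ≤ ENNReal.ofReal (R ^ (-β)) * 1 := by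
          rw [setLIntegral_const]
          gcongr
          exact prob_le_one
      _ = _ := mul_one _
  refine (add_le_add h1 h2).trans (le_of_eq ?_)
  rw [← ENNReal.ofReal_add (by positivity) (by positivity)]
  congr 1
  ring

/-- The length that determines the size of the potential of an `L^p` function on a sphere of radius
`R` in a cell of diameter comparable with `D`, raised to the power `1 - 3 / p`. -/
def cellFactor (p R D : ℝ) : ℝ := if p < 3 then R ^ (1 - 3 / p) else D ^ (1 - 3 / p)

/-- The part of the potential that comes from the vicinity of the sphere.  As `|x - y|^{-2}` is only
logarithmically non-integrable on the sphere, it may be split as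
`|x - y|^{-α} |x - y|^{-(2 - α)}` such that Hölder's inequality on the product space applies. -/
theorem exists_lintegral_pot_near_le {p : ℝ} (hp : 1 < p) (hp3 : p < 3) :
    ∃ C : ℝ, 0 ≤ C ∧ ∀ {G : E → ℝ≥0∞}, Measurable G → ∀ {Q : Set E} {X : E} {R : ℝ}, 0 < R →
      Q ⊆ closedBall X (2 * R) →
      ∫⁻ x, pot G Q x ∂(sphereProb X R) ≤
        ENNReal.ofReal (C * R ^ (1 - 3 / p)) * lpNorm p G Q := by
  obtain ⟨q, hpq⟩ : ∃ q, p.HolderConjugate q := ⟨_, Real.HolderConjugate.conjExponent hp⟩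
  have hp0 : 0 < p := hpq.pos
  have hq0 : 0 < q := hpq.symm.pos
  have hinv : 1 / q = 1 - 1 / p := by
    have := hpq.inv_add_inv_eq_one
    simp only [one_div]; linarith
  -- any `α` with `α * p < 2` and `(2 - α) * q < 3` will do
  obtain ⟨α, hα⟩ : ∃ α : ℝ, α = (5 / p - 1) / 2 := ⟨_, rfl⟩
  have hα0 : 0 ≤ α := by
    have : 1 ≤ 5 / p := by rw [le_div_iff₀ hp0]; linarith
    rw [hα]; linarith
  have hαp : α * p = (5 - p) / 2 := by rw [hα]; field_simp
  have hα2 : 2 - α = 5 / 2 * (1 / q) := by rw [hα, hinv]; ring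
  have hαq : (2 - α) * q = 5 / 2 := by rw [hα2]; field_simp
  have h2α : 0 ≤ 2 - α := by rw [hα2]; positivity
  obtain ⟨C₁, hC₁, h₁⟩ := exists_lintegral_kern_sphereProb_le (β := α * p) (by positivity)
    (by rw [hαp]; linarith)
  obtain ⟨C₂, hC₂, h₂⟩ := lintegral_volume_kern_closedBall_le (β := (2 - α) * q) (by positivity)
    (by rw [hαq]; norm_num)
  refine ⟨C₁ ^ (1 / p) * (C₂ * 3 ^ (3 - (2 - α) * q)) ^ (1 / q), by positivity,
    fun {G} hG {Q} {X} {R} hR hQ => ?_⟩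
  have := isProbabilityMeasure_sphereProb X hR
  set ν := sphereProb X R with hν
  set μ := ν.prod (volume.restrict Q) with hμ
  have hGm : Measurable fun z : E × E => G z.2 := hG.comp measurable_snd
  have hf : Measurable fun z : E × E => G z.2 * kern α z.1 z.2 :=
    hGm.mul (measurable_kern_uncurry α)
  have hg := measurable_kern_uncurry (2 - α)
  have e1 : ∫⁻ x, pot G Q x ∂ν =
      ∫⁻ z, ((fun z : E × E => G z.2 * kern α z.1 z.2) *
        fun z : E × E => kern (2 - α) z.1 z.2) z ∂μ := by
    rw [hμ, lintegral_prod _ (hf.mul hg).aemeasurable]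
    refine lintegral_congr fun x => lintegral_congr fun z => ?_
    simp only [Pi.mul_apply]
    rw [mul_assoc, ← kern_add hα0 h2α, add_sub_cancel]
  have f1 : ∫⁻ z, (G z.2 * kern α z.1 z.2) ^ p ∂μ ≤
      ENNReal.ofReal (C₁ * R ^ (-(α * p))) * ∫⁻ z in Q, G z ^ p := by
    rw [hμ, lintegral_prod_symm _ (hf.pow_const p).aemeasurable,
      ← lintegral_const_mul _ (hG.pow_const p)]
    refine lintegral_mono fun z => ?_
    have : ∀ x, (G z * kern α x z) ^ p = G z ^ p * kern (α * p) z x := fun x => by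
      rw [ENNReal.mul_rpow_of_nonneg _ _ hp0.le, kern_rpow, kern_comm]
    simp only [this]
    rw [lintegral_const_mul _ (measurable_kern _ z), mul_comm]
    gcongr
    exact h₁ X z R hR
  have f2 : ∫⁻ z, (kern (2 - α) z.1 z.2) ^ q ∂μ ≤
      ENNReal.ofReal (C₂ * (3 * R) ^ (3 - (2 - α) * q)) := by
    rw [hμ, lintegral_prod _ (hg.pow_const q).aemeasurable]
    calc _ ≤ ∫⁻ _x, ENNReal.ofReal (C₂ * (3 * R) ^ (3 - (2 - α) * q)) ∂ν := by
          refine lintegral_mono_ae ((ae_mem_sphere_sphereProb X R).mono fun x hx => ?_)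
          simp only [kern_rpow]
          refine le_trans (lintegral_mono_set (hQ.trans (closedBall_subset_closedBall' ?_)))
            (h₂ x (3 * R) (by positivity))
          rw [dist_comm, mem_sphere.1 hx]
          linarith
      _ = _ := by simp
  rw [e1]
  refine (ENNReal.lintegral_mul_le_Lp_mul_Lq μ hpq hf.aemeasurable hg.aemeasurable).trans ?_
  calc _ ≤ (ENNReal.ofReal (C₁ * R ^ (-(α * p))) * ∫⁻ z in Q, G z ^ p) ^ (1 / p) *
        (ENNReal.ofReal (C₂ * (3 * R) ^ (3 - (2 - α) * q))) ^ (1 / q) := by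
        gcongr
    _ = _ := by
        rw [ENNReal.mul_rpow_of_nonneg _ _ (by positivity), ← lpNorm, mul_right_comm,
          ENNReal.ofReal_rpow_of_nonneg (by positivity) (by positivity),
          ENNReal.ofReal_rpow_of_nonneg (by positivity) (by positivity),
          ← ENNReal.ofReal_mul (by positivity)]
        congr 2
        rw [Real.mul_rpow (by norm_num) hR.le, ← mul_assoc C₂, Real.mul_rpow hC₁ (by positivity),
          Real.mul_rpow (by positivity) (by positivity), ← Real.rpow_mul hR.le,
          ← Real.rpow_mul hR.le, mul_mul_mul_comm, ← Real.rpow_add hR]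
        congr 2
        have e3 : (3 - (2 - α) * q) * (1 / q) = 3 * (1 / q) - (2 - α) := by field_simp
        have e4 : -(α * p) * (1 / p) = -α := by field_simp
        rw [e3, e4, hinv]
        ring

/-- For `p > 3` Hölder's inequality applies at each point of the sphere. For `p < 3` the part of the
potential that comes from outside the ball of radius `2 R` is compared with its value at the
centre. -/
theorem exists_lintegral_pot_sphereProb_le {p : ℝ} (hp : 1 < p) (hp3 : p ≠ 3) :
    ∃ C : ℝ, 0 ≤ C ∧ ∀ {G : E → ℝ≥0∞}, Measurable G → ∀ {Q : Set E} {X : E} {R D : ℝ}, 0 < R →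
      R ≤ D → MeasurableSet Q → Q ⊆ closedBall X D →
      ∫⁻ x, pot G Q x ∂(sphereProb X R) ≤
        ENNReal.ofReal (C * cellFactor p R D) * lpNorm p G Q := by
  obtain ⟨q, hpq⟩ : ∃ q, p.HolderConjugate q := ⟨_, Real.HolderConjugate.conjExponent hp⟩
  have hp0 : 0 < p := hpq.pos
  have hq0 : 0 < q := hpq.symm.pos
  have hinv : 1 / q = 1 - 1 / p := by
    have := hpq.inv_add_inv_eq_one
    simp only [one_div]; linarith
  have hexp : 3 / q - 2 = 1 - 3 / p := by
    have : 3 / q = 3 * (1 / q) := by ring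
    rw [this, hinv]; ring
  rcases lt_or_gt_of_ne hp3 with hlt | hgt
  · obtain ⟨C₁, hC₁, h₁⟩ := exists_lintegral_pot_near_le hp hlt
    have h2q : 3 < 2 * q := by
      have : 1 / q < 2 / 3 := by
        rw [hinv]
        have : 1 / 3 < 1 / p := one_div_lt_one_div_of_lt hp0 hlt
        linarith
      rw [div_lt_div_iff₀ hq0 (by norm_num)] at this
      linarith
    obtain ⟨C₂, hC₂, h₂⟩ := exists_lintegral_mul_kern_compl_ball_le hpq h2q
    refine ⟨C₁ + 4 * (C₂ * 2 ^ (1 - 3 / p)), by positivity,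
      fun {G} hG {Q} {X} {R} {D} hR hRD hQ hQD => ?_⟩
    have := isProbabilityMeasure_sphereProb X hR
    have hBm : MeasurableSet (closedBall X (2 * R)) := isClosed_closedBall.measurableSet
    set N := Q ∩ closedBall X (2 * R) with hN
    set F := Q \ closedBall X (2 * R) with hF
    have hsplit : ∀ x, pot G Q x = pot G N x + pot G F x := fun x => by
      rw [pot, ← lintegral_inter_add_sdiff _ Q hBm, pot, pot]
    have hfar : ∀ x ∈ sphere X R, pot G F x ≤
        ENNReal.ofReal (4 * (C₂ * 2 ^ (1 - 3 / p)) * R ^ (1 - 3 / p)) * lpNorm p G Q := by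
      intro x hx
      calc pot G F x ≤ ∫⁻ z in F, ENNReal.ofReal 4 * (G z * kern 2 X z) := by
            refine setLIntegral_mono' (hQ.diff hBm) fun z hz => ?_
            rw [mul_left_comm]
            refine mul_le_mul_right ?_ _
            have h4 : ENNReal.ofReal 4 = ENNReal.ofReal ((2 : ℝ) ^ (2 : ℝ)) := by norm_num
            rw [h4]
            refine kern_le_of_dist_le (by norm_num) (by norm_num) ?_
            have h1 := dist_triangle X x z
            rw [dist_comm X x, mem_sphere.1 hx] at h1
            have h2 : 2 * R < dist z X := by simpa using hz.2
            rw [dist_comm] at h2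
            linarith
        _ = ENNReal.ofReal 4 * ∫⁻ z in F, G z * kern 2 X z :=
            lintegral_const_mul _ (hG.mul (measurable_kern 2 X))
        _ ≤ ENNReal.ofReal 4 * (ENNReal.ofReal (C₂ * (2 * R) ^ (3 / q - 2)) * lpNorm p G F) := by
            gcongr
            exact h₂ hG (by positivity) fun z hz hz' => hz.2 (ball_subset_closedBall hz')
        _ ≤ ENNReal.ofReal 4 * (ENNReal.ofReal (C₂ * (2 * R) ^ (3 / q - 2)) * lpNorm p G Q) := by
            gcongr
            exact lpNorm_mono hp0 G sdiff_subset
        _ = _ := by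
            rw [← mul_assoc, ← ENNReal.ofReal_mul (by norm_num), hexp,
              Real.mul_rpow (by norm_num) hR.le]
            congr 2
            ring
    simp only [hsplit]
    rw [lintegral_add_left (measurable_pot hG N)]
    calc _ ≤ ENNReal.ofReal (C₁ * R ^ (1 - 3 / p)) * lpNorm p G Q +
          ENNReal.ofReal (4 * (C₂ * 2 ^ (1 - 3 / p)) * R ^ (1 - 3 / p)) * lpNorm p G Q := by
          refine add_le_add ?_ ?_
          · refine (h₁ hG hR inter_subset_right).trans ?_
            gcongr
            exact lpNorm_mono hp0 G inter_subset_left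
          · refine (lintegral_mono_ae ((ae_mem_sphere_sphereProb X R).mono hfar)).trans ?_
            simp
      _ = _ := by
          rw [← add_mul, ← ENNReal.ofReal_add (by positivity) (by positivity), cellFactor,
            if_pos hlt]
          congr 2
          ring
  · have h2q : 2 * q < 3 := by
      have : 2 / 3 < 1 / q := by
        rw [hinv]
        have : 1 / p < 1 / 3 := one_div_lt_one_div_of_lt (by norm_num) hgt
        linarith
      rw [div_lt_div_iff₀ (by norm_num) hq0] at this
      linarith
    obtain ⟨C, hC, h⟩ := exists_lintegral_mul_kern_closedBall_le hpq (β := 2) (by norm_num) h2q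
    refine ⟨C * 2 ^ (1 - 3 / p), by positivity, fun {G} hG {Q} {X} {R} {D} hR hRD hQ hQD => ?_⟩
    have := isProbabilityMeasure_sphereProb X hR
    have hD : 0 < D := hR.trans_le hRD
    have hb : ∀ x ∈ sphere X R, pot G Q x ≤
        ENNReal.ofReal (C * (2 * D) ^ (3 / q - 2)) * lpNorm p G Q := fun x hx => by
      refine h hG (by positivity) (hQD.trans (closedBall_subset_closedBall' ?_))
      rw [dist_comm, mem_sphere.1 hx]
      linarith
    refine (lintegral_mono_ae ((ae_mem_sphere_sphereProb X R).mono hb)).trans (le_of_eq ?_)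
    rw [lintegral_const, measure_univ, mul_one, hexp, cellFactor, if_neg (by linarith),
      Real.mul_rpow (by norm_num) hD.le, mul_assoc]

/-! ### Averages over spheres and over convex cells -/

/-- `Q` is a convex open cell of diameter comparable with `D` that contains the sphere of radius `R`
around `X` up to a null set; `κ` bounds `D ^ 3 / |Q|`. -/
structure IsCell (Ω : Set E) (X : E) (R D κ : ℝ) (Q : Set E) : Prop where
  isOpen : IsOpen Q
  convex : Convex ℝ Q
  subset : Q ⊆ Ω
  ae_mem : ∀ᵐ x ∂(sphereProb X R), x ∈ Q
  subset_closedBall : Q ⊆ closedBall X D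
  pos : 0 < R
  le : R ≤ D
  nonneg : 0 ≤ κ
  volume_ge : ENNReal.ofReal (D ^ 3) ≤ ENNReal.ofReal κ * volume Q

theorem IsCell.volume_ne_zero {Ω : Set E} {X : E} {R D κ : ℝ} {Q : Set E}
    (h : IsCell Ω X R D κ Q) : volume Q ≠ 0 := by
  intro h0
  have hD : 0 < D := h.pos.trans_le h.le
  have := h.volume_ge
  rw [h0, mul_zero, nonpos_iff_eq_zero, ENNReal.ofReal_eq_zero] at this
  have : 0 < D ^ 3 := by positivity
  linarith

theorem IsCell.volume_ne_top {Ω : Set E} {X : E} {R D κ : ℝ} {Q : Set E}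
    (h : IsCell Ω X R D κ Q) : volume Q ≠ ⊤ :=
  ((measure_mono h.subset_closedBall).trans_lt measure_closedBall_lt_top).ne

theorem exists_enorm_preciseRep_sub_average_cell_le :
    ∃ C : ℝ, 0 < C ∧ ∀ {Ω : Set E} {v : E → ℝ} {G : E → ℝ≥0∞}, GradBound Ω v G →
      ∀ {X : E} {R D κ : ℝ} {Q : Set E}, IsCell Ω X R D κ Q → IntegrableOn v Q →
      ∀ x ∈ Q, x ∈ closedBall X D →
      ‖preciseRep v x - ⨍ y in Q, v y‖ₑ ≤ ENNReal.ofReal (C * κ) * pot G Q x := by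
  obtain ⟨C, hC, h⟩ := exists_enorm_preciseRep_sub_average_le
  refine ⟨8 * C, by positivity, ?_⟩
  intro Ω v G hvG X R D κ Q hQ hv x hx hxX
  have hD : 0 < D := hQ.pos.trans_le hQ.le
  have hκ := hQ.nonneg
  have hsub : Q ⊆ closedBall x (2 * D) := hQ.subset_closedBall.trans
    (closedBall_subset_closedBall' (by rw [mem_closedBall, dist_comm] at hxX; linarith))
  refine (h hvG hQ.isOpen hQ.convex hQ.subset hx (by positivity) hsub hQ.isOpen.measurableSet
    subset_rfl hQ.volume_ne_zero hv).trans ?_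
  rw [← mul_assoc]
  refine mul_le_mul_left ?_ _
  rw [show C * (2 * D) ^ 3 = 8 * C * D ^ 3 by ring,
    ENNReal.ofReal_mul (p := 8 * C) (by positivity),
    ENNReal.ofReal_mul (p := 8 * C) (by positivity),
    mul_left_comm]
  refine mul_le_mul_right ?_ _
  rw [mul_comm, ← div_eq_mul_inv]
  exact ENNReal.div_le_of_le_mul hQ.volume_ge

/-- On a cell, the averages of a Sobolev function over the sphere and over the cell are close. -/
theorem exists_sphere_sub_cell_le {p : ℝ} (hp : 1 < p) (hp3 : p ≠ 3) :
    ∃ C : ℝ, 0 ≤ C ∧ ∀ {Ω : Set E}, IsOpen Ω → ∀ {v : E → ℝ} {G : E → ℝ≥0∞}, GradBound Ω v G →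
      ∀ {X : E} {R D κ : ℝ} {Q : Set E}, IsCell Ω X R D κ Q → sphere X R ⊆ Ω →
      IntegrableOn v Q → lpNorm p G Q ≠ ⊤ →
      (∀ᵐ x ∂(sphereProb X R), HasPreciseValue v x) ∧
      Integrable (preciseRep v) (sphereProb X R) ∧
      ‖(∫ x, preciseRep v x ∂(sphereProb X R)) - ⨍ y in Q, v y‖ₑ ≤
        ENNReal.ofReal (C * κ * cellFactor p R D) * lpNorm p G Q := by
  obtain ⟨C₁, hC₁, h₁⟩ := exists_enorm_preciseRep_sub_average_cell_le
  obtain ⟨C₂, hC₂, h₂⟩ := exists_lintegral_pot_sphereProb_le hp hp3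
  refine ⟨C₁ * C₂, by positivity, ?_⟩
  intro Ω hΩ v G hvG X R D κ Q hQ hsΩ hv hfin
  have hD : 0 < D := hQ.pos.trans_le hQ.le
  have hκ := hQ.nonneg
  have := isProbabilityMeasure_sphereProb X hQ.pos
  set ν := sphereProb X R
  have hE : 0 ≤ cellFactor p R D := by
    have := hQ.pos
    unfold cellFactor; split_ifs <;> positivity
  have hpot := h₂ hvG.meas hQ.pos hQ.le hQ.isOpen.measurableSet hQ.subset_closedBall
  have hae : ∀ᵐ x ∂ν, pot G Q x < ⊤ := ae_lt_top (measurable_pot hvG.meas Q)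
    (hpot.trans_lt (ENNReal.mul_lt_top ENNReal.ofReal_lt_top hfin.lt_top)).ne
  have hpv : ∀ᵐ x ∂ν, HasPreciseValue v x := by
    filter_upwards [hae, hQ.ae_mem] with x hx hxQ
    exact hvG.hasPreciseValue (hQ.isOpen.mem_nhds hxQ) hQ.subset hx.ne
  have hsm : AEStronglyMeasurable (preciseRep v) ν := by
    obtain ⟨g, hg, -⟩ := hvG.exists_grad
    refine aestronglyMeasurable_preciseRep hΩ (isCompact_sphere X R) hsΩ (hg 0).1 ?_
    filter_upwards [hpv, ae_mem_sphere_sphereProb X R] with x hx hxs using ⟨hxs, hx⟩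
  have hbound : ∫⁻ x, ‖preciseRep v x - ⨍ y in Q, v y‖ₑ ∂ν ≤
      ENNReal.ofReal (C₁ * C₂ * κ * cellFactor p R D) * lpNorm p G Q := by
    calc ∫⁻ x, ‖preciseRep v x - ⨍ y in Q, v y‖ₑ ∂ν
        ≤ ∫⁻ x, ENNReal.ofReal (C₁ * κ) * pot G Q x ∂ν := by
          refine lintegral_mono_ae ?_
          filter_upwards [hQ.ae_mem, ae_mem_sphere_sphereProb X R] with x hxQ hxs
          exact h₁ hvG hQ hv x hxQ (sphere_subset_closedBall.trans
            (closedBall_subset_closedBall hQ.le) hxs)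
      _ ≤ ENNReal.ofReal (C₁ * κ) * (ENNReal.ofReal (C₂ * cellFactor p R D) * lpNorm p G Q) := by
          rw [lintegral_const_mul _ (measurable_pot hvG.meas Q)]
          gcongr
      _ = _ := by
          rw [← mul_assoc, ← ENNReal.ofReal_mul (by positivity)]
          congr 2
          ring
  have hint : Integrable (fun x => preciseRep v x - ⨍ y in Q, v y) ν :=
    ⟨hsm.sub aestronglyMeasurable_const, hbound.trans_lt
      (ENNReal.mul_lt_top ENNReal.ofReal_lt_top hfin.lt_top)⟩
  have hint' : Integrable (preciseRep v) ν := by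
    refine (hint.add (integrable_const (⨍ y in Q, v y))).congr (ae_of_all _ fun x => ?_)
    simp
  refine ⟨hpv, hint', ?_⟩
  have e : (∫ x, preciseRep v x ∂ν) - ⨍ y in Q, v y =
      ∫ x, (preciseRep v x - ⨍ y in Q, v y) ∂ν := by
    rw [integral_sub hint' (integrable_const _), integral_const, probReal_univ, one_smul]
  rw [e]
  exact (enorm_integral_le_lintegral_enorm _).trans hbound

/-! ### Averages over the particles -/

/-- The normalised Lebesgue measure on a set. -/
def unif (Q : Set E) : Measure E := (volume Q)⁻¹ • (volume : Measure E).restrict Q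

theorem isProbabilityMeasure_unif {Q : Set E} (h0 : volume Q ≠ 0) (hf : volume Q ≠ ⊤) :
    IsProbabilityMeasure (unif Q) := by
  refine ⟨?_⟩
  rw [unif, Measure.smul_apply, Measure.restrict_apply_univ, smul_eq_mul,
    ENNReal.inv_mul_cancel h0 hf]

theorem integral_unif (Q : Set E) (f : E → ℝ) : ∫ x, f x ∂(unif Q) = ⨍ x in Q, f x := by
  rw [unif, average, Measure.restrict_apply_univ]

/-- The average of `N` measures. -/
def avgMeasure {N : ℕ} (μ : Fin N → Measure E) : Measure E := (N : ℝ≥0∞)⁻¹ • ∑ i, μ i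

theorem sphereMeasure_eq (N : ℕ) (r : ℝ) (X : Fin N → E) :
    sphereMeasure N r X = avgMeasure fun i => sphereProb (X i) (r * scale N) := rfl

theorem cubeMeasure_eq (N : ℕ) (Q : Fin N → Set E) :
    cubeMeasure N Q = avgMeasure fun i => unif (Q i) := rfl

theorem ae_avgMeasure {N : ℕ} {μ : Fin N → Measure E} {P : E → Prop}
    (h : ∀ i, ∀ᵐ x ∂(μ i), P x) : ∀ᵐ x ∂(avgMeasure μ), P x := by
  refine Measure.ae_smul_measure ?_ _
  rw [← Measure.sum_fintype]
  exact Measure.ae_sum_iff.2 h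

theorem integrable_avgMeasure {N : ℕ} (hN : 0 < N) {μ : Fin N → Measure E} {f : E → ℝ}
    (h : ∀ i, Integrable f (μ i)) : Integrable f (avgMeasure μ) :=
  (integrable_finsetSum_measure.2 fun i _ => h i).smul_measure
    (ENNReal.inv_ne_top.2 (by exact_mod_cast hN.ne'))

theorem integral_avgMeasure {N : ℕ} {μ : Fin N → Measure E} {f : E → ℝ}
    (h : ∀ i, Integrable f (μ i)) :
    ∫ x, f x ∂(avgMeasure μ) = (N : ℝ)⁻¹ * ∑ i, ∫ x, f x ∂(μ i) := by
  rw [avgMeasure, integral_smul_measure, integral_finsetSum_measure fun i _ => h i]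
  simp

theorem isProbabilityMeasure_avgMeasure {N : ℕ} (hN : 0 < N) {μ : Fin N → Measure E}
    (h : ∀ i, IsProbabilityMeasure (μ i)) : IsProbabilityMeasure (avgMeasure μ) := by
  refine ⟨?_⟩
  rw [avgMeasure, Measure.smul_apply, Measure.finsetSum_apply]
  simp only [measure_univ, Finset.sum_const, Finset.card_univ, Fintype.card_fin, nsmul_eq_mul,
    mul_one, smul_eq_mul]
  exact ENNReal.inv_mul_cancel (by exact_mod_cast hN.ne') (ENNReal.natCast_ne_top N)

theorem enorm_avg_sub_avg_le {N : ℕ} (a b : Fin N → ℝ) {B : Fin N → ℝ≥0∞}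
    (h : ∀ i, ‖a i - b i‖ₑ ≤ B i) :
    ‖(N : ℝ)⁻¹ * ∑ i, a i - (N : ℝ)⁻¹ * ∑ i, b i‖ₑ ≤ (N : ℝ≥0∞)⁻¹ * ∑ i, B i := by
  rcases Nat.eq_zero_or_pos N with rfl | hN
  · simp
  rw [← mul_sub, ← Finset.sum_sub_distrib, enorm_mul]
  refine mul_le_mul' (le_of_eq ?_) ((enorm_sum_le _ _).trans (Finset.sum_le_sum fun i _ => h i))
  have hN' : (0 : ℝ) < N := by exact_mod_cast hN
  rw [Real.enorm_eq_ofReal (by positivity), ENNReal.ofReal_inv_of_pos hN', ENNReal.ofReal_natCast]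

theorem scale_pos {N : ℕ} (hN : 0 < N) : 0 < scale N := by
  have : (0 : ℝ) < N := by exact_mod_cast hN
  unfold scale
  positivity

theorem scale_pow_three {N : ℕ} (hN : 0 < N) : scale N ^ 3 = (N : ℝ)⁻¹ := by
  have : (0 : ℝ) < N := by exact_mod_cast hN
  rw [scale, ← Real.rpow_natCast, ← Real.rpow_mul this.le]
  norm_num [Real.rpow_neg_one]

theorem scale_le_one {N : ℕ} (hN : 0 < N) : scale N ≤ 1 :=
  Real.rpow_le_one_of_one_le_of_nonpos (by exact_mod_cast hN) (by norm_num)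

theorem inv_rpow_eq_scale {N : ℕ} (hN : 0 < N) {p : ℝ} (hp : 0 < p) :
    ((N : ℝ≥0∞)⁻¹) ^ (1 / p) = ENNReal.ofReal (scale N ^ (3 / p)) := by
  have hN' : (0 : ℝ) < N := by exact_mod_cast hN
  have hs := scale_pos hN
  rw [← ENNReal.ofReal_natCast, ← ENNReal.ofReal_inv_of_pos hN', ← scale_pow_three hN,
    ENNReal.ofReal_rpow_of_nonneg (by positivity) (by positivity), ← Real.rpow_natCast,
    ← Real.rpow_mul hs.le]
  congr 2
  push_cast
  ring

/-- Jensen's inequality for the `L^p` norms over cells with bounded overlap. -/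
theorem avg_lpNorm_le {p : ℝ} (hp : 1 ≤ p) {N : ℕ} (hN : 0 < N) {Ω : Set E} {Q : Fin N → Set E}
    {M : ℝ} (hM : 0 ≤ M) (hQ : HasDensityLE Ω M (∑ i, volume.restrict (Q i))) (G : E → ℝ≥0∞) :
    (N : ℝ≥0∞)⁻¹ * ∑ i, lpNorm p G (Q i) ≤
      ENNReal.ofReal (M ^ (1 / p) * scale N ^ (3 / p)) * lpNorm p G Ω := by
  have hp0 : 0 < p := by linarith
  have hs := scale_pos hN
  have hw : ∑ _i : Fin N, (N : ℝ≥0∞)⁻¹ = 1 := by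
    simp only [Finset.sum_const, Finset.card_univ, Fintype.card_fin, nsmul_eq_mul]
    exact ENNReal.mul_inv_cancel (by exact_mod_cast hN.ne') (ENNReal.natCast_ne_top N)
  have h1 := ENNReal.rpow_arith_mean_le_arith_mean_rpow Finset.univ
    (fun _ : Fin N => (N : ℝ≥0∞)⁻¹) (fun i => lpNorm p G (Q i)) hw hp
  have h2 : ∀ i, lpNorm p G (Q i) ^ p = ∫⁻ y in Q i, G y ^ p := fun i => by
    rw [lpNorm, ← ENNReal.rpow_mul, one_div_mul_cancel hp0.ne', ENNReal.rpow_one]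
  simp only [h2] at h1
  rw [← Finset.mul_sum, ← Finset.mul_sum, ← lintegral_finsetSum_measure] at h1
  have h3 : ∫⁻ y, G y ^ p ∂(∑ i, volume.restrict (Q i)) ≤
      ENNReal.ofReal M * ∫⁻ y in Ω, G y ^ p := by
    refine (lintegral_mono' hQ le_rfl).trans (le_of_eq ?_)
    rw [lintegral_smul_measure, smul_eq_mul]
  calc (N : ℝ≥0∞)⁻¹ * ∑ i, lpNorm p G (Q i)
      = (((N : ℝ≥0∞)⁻¹ * ∑ i, lpNorm p G (Q i)) ^ p) ^ (1 / p) := by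
        rw [← ENNReal.rpow_mul, mul_one_div_cancel hp0.ne', ENNReal.rpow_one]
    _ ≤ ((N : ℝ≥0∞)⁻¹ * (ENNReal.ofReal M * ∫⁻ y in Ω, G y ^ p)) ^ (1 / p) := by
        refine ENNReal.rpow_le_rpow (h1.trans ?_) (by positivity)
        gcongr
    _ = _ := by
        rw [ENNReal.mul_rpow_of_nonneg _ _ (by positivity),
          ENNReal.mul_rpow_of_nonneg _ _ (by positivity), ← lpNorm, inv_rpow_eq_scale hN hp0,
          ENNReal.ofReal_rpow_of_nonneg hM (by positivity), ← mul_assoc,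
          ← ENNReal.ofReal_mul (by positivity), mul_comm (scale N ^ (3 / p))]

theorem cellFactor_mul_scale {p r d s : ℝ} (hr : 0 ≤ r) (hd : 0 ≤ d) (hs : 0 < s) :
    cellFactor p (r * s) (d * s) * s ^ (3 / p) = cellFactor p r d * s := by
  unfold cellFactor
  split_ifs
  · rw [Real.mul_rpow hr hs.le, mul_assoc, ← Real.rpow_add hs, sub_add_cancel, Real.rpow_one]
  · rw [Real.mul_rpow hd hs.le, mul_assoc, ← Real.rpow_add hs, sub_add_cancel, Real.rpow_one]

theorem dualDistLE_of_forall {Ω : Set E} {k : ℕ} {p : ℝ} {μ ν : Measure E} {B : ℝ}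
    (hμ : ActsOnSobolev Ω k (ENNReal.ofReal p) μ) (hν : ActsOnSobolev Ω k (ENNReal.ofReal p) ν)
    (h : ∀ v, MemSobolev Ω (ENNReal.ofReal p) k v → sobolevNorm Ω (ENNReal.ofReal p) k v ≤ 1 →
      ‖(∫ x, preciseRep v x ∂μ) - ∫ x, preciseRep v x ∂ν‖ₑ ≤ ENNReal.ofReal B) :
    DualDistLE Ω k p μ ν B := by
  refine ⟨hμ, hν, iSup_le fun v => iSup_le fun hv => iSup_le fun hv1 => ?_⟩
  rw [← Real.enorm_eq_ofReal_abs]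
  exact h v hv hv1

theorem integrable_unif {Ω Q : Set E} (hQ : Q ⊆ Ω) (h0 : volume Q ≠ 0) (hf : volume Q ≠ ⊤)
    {p : ℝ} (hp : 1 < p) {v : E → ℝ} (hv : MemLp v (ENNReal.ofReal p) (volume.restrict Ω)) :
    IntegrableOn v Q ∧ Integrable v (unif Q) := by
  have : IsFiniteMeasure (volume.restrict Q) := ⟨by simpa using hf.lt_top⟩
  have h1 : IntegrableOn v Q :=
    (hv.mono_measure (Measure.restrict_mono hQ le_rfl)).integrable (by simpa using hp.le)
  exact ⟨h1, h1.smul_measure (ENNReal.inv_ne_top.2 h0)⟩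

theorem preciseRep_ae_eq_unif {Ω Q : Set E} (hΩ : IsOpen Ω) (hQ : Q ⊆ Ω) {p : ℝ} (hp : 1 < p)
    {v : E → ℝ} (hv : MemLp v (ENNReal.ofReal p) (volume.restrict Ω)) :
    preciseRep v =ᵐ[unif Q] v := by
  have hae := ae_preciseRep_eq hΩ (locallyIntegrable_indicator hΩ (by simpa using hp.le) hv)
  exact Measure.ae_smul_measure
    (ae_restrict_of_ae_restrict_of_subset hQ (hae.mono fun x hx => hx.2)) _

/-- Comparison of the averaged surface measures with the averages over cells. -/
theorem exists_sphereMeasure_sub_cubeMeasure_le {p : ℝ} (hp : 1 < p) (hp3 : p ≠ 3) :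
    ∃ C : ℝ, 0 ≤ C ∧ ∀ {Ω : Set E}, IsOpen Ω → ∀ {N : ℕ}, 0 < N → ∀ {r d κ M : ℝ} {X : Fin N → E}
      {Q : Fin N → Set E}, 0 ≤ M → 0 < r → 0 ≤ d →
      (∀ i, IsCell Ω (X i) (r * scale N) (d * scale N) κ (Q i)) →
      (∀ i, sphere (X i) (r * scale N) ⊆ Ω) → HasDensityLE Ω M (∑ i, volume.restrict (Q i)) →
      ActsOnSobolev Ω 1 (ENNReal.ofReal p) (sphereMeasure N r X) ∧
      ∀ v, MemSobolev Ω (ENNReal.ofReal p) 1 v → sobolevNorm Ω (ENNReal.ofReal p) 1 v ≤ 1 →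
        ‖(∫ x, preciseRep v x ∂(sphereMeasure N r X)) - ∫ x, preciseRep v x ∂(cubeMeasure N Q)‖ₑ ≤
          ENNReal.ofReal (C * κ * M ^ (1 / p) * cellFactor p r d * scale N) := by
  obtain ⟨C, hC, h⟩ := exists_sphere_sub_cell_le hp hp3
  refine ⟨C, hC, ?_⟩
  intro Ω hΩ N hN r d κ M X Q hM hr hd hQ hsΩ hover
  have hp0 : 0 < p := by linarith
  have hs := scale_pos hN
  have hκ : 0 ≤ κ := (hQ ⟨0, hN⟩).nonneg
  have hint : ∀ v, MemLp v (ENNReal.ofReal p) (volume.restrict Ω) → ∀ i,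
      IntegrableOn v (Q i) ∧ Integrable v (unif (Q i)) := fun v hv i =>
    integrable_unif (hQ i).subset (hQ i).volume_ne_zero (hQ i).volume_ne_top hp hv
  constructor
  · intro v hv
    obtain ⟨G, hG, hfin, -⟩ := hv.exists_gradBound hp
    have hc := fun i => h hΩ hG (hQ i) (hsΩ i) (hint v hv.memLp i).1
      ((lpNorm_mono hp0 G (hQ i).subset).trans_lt hfin.lt_top).ne
    exact ⟨ae_avgMeasure fun i => (hc i).1, integrable_avgMeasure hN fun i => (hc i).2.1⟩
  · intro v hv hv1
    obtain ⟨G, hG, hfin, hle⟩ := hv.exists_gradBound hp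
    have hc := fun i => h hΩ hG (hQ i) (hsΩ i) (hint v hv.memLp i).1
      ((lpNorm_mono hp0 G (hQ i).subset).trans_lt hfin.lt_top).ne
    have hae := fun i => preciseRep_ae_eq_unif hΩ (hQ i).subset hp hv.memLp
    rw [sphereMeasure_eq, cubeMeasure_eq, integral_avgMeasure fun i => (hc i).2.1,
      integral_avgMeasure fun i => (hint v hv.memLp i).2.congr (hae i).symm]
    have hcf : 0 ≤ cellFactor p (r * scale N) (d * scale N) := by
      unfold cellFactor; split_ifs <;> positivity
    refine (enorm_avg_sub_avg_le _ _ fun i => ?_).trans (b := (N : ℝ≥0∞)⁻¹ * ∑ i,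
      ENNReal.ofReal (C * κ * cellFactor p (r * scale N) (d * scale N)) * lpNorm p G (Q i)) ?_
    · rw [integral_congr_ae (hae i), integral_unif]
      exact (hc i).2.2
    · rw [← Finset.mul_sum, mul_left_comm]
      calc _ ≤ ENNReal.ofReal (C * κ * cellFactor p (r * scale N) (d * scale N)) *
            (ENNReal.ofReal (M ^ (1 / p) * scale N ^ (3 / p)) * 1) := by
            refine mul_le_mul_right ((avg_lpNorm_le hp.le hN hM hover G).trans ?_) _
            exact mul_le_mul_right (hle.trans hv1) _
        _ = _ := by
            rw [mul_one, ← ENNReal.ofReal_mul (by positivity)]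
            congr 1
            calc _ = C * κ * M ^ (1 / p) *
                (cellFactor p (r * scale N) (d * scale N) * scale N ^ (3 / p)) := by ring
              _ = _ := by rw [cellFactor_mul_scale hr.le hd hs]; ring

/-! ### Cubes -/

/-- The properties of a cube with side `ℓ` that are needed: convexity, volume, symmetry. A ball
around the centre that lies in the cube has radius at most `ℓ`, and its boundary sphere lies in
the cube up to a null set. -/
theorem IsCubeAt.exists_side {x : E} {Q : Set E} (h : IsCubeAt x Q) :
    ∃ ℓ : ℝ, 0 < ℓ ∧ IsOpen Q ∧ Convex ℝ Q ∧ volume Q = ENNReal.ofReal (ℓ ^ 3) ∧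
      Q ⊆ closedBall x ℓ ∧ (∀ y, y ∈ Q → x + (x - y) ∈ Q) ∧
      ∀ R, 0 < R → ball x R ⊆ Q → R ≤ ℓ ∧ ∀ᵐ y ∂(sphereProb x R), y ∈ Q := by
  obtain ⟨b, ℓ, hℓ, rfl⟩ := h
  have hnorm : ∀ z : E, ‖z‖ ^ 2 = b.repr z 0 ^ 2 + b.repr z 1 ^ 2 + b.repr z 2 ^ 2 := fun z => by
    rw [← b.repr.norm_map z, EuclideanSpace.norm_sq_eq, Fin.sum_univ_three]
    simp
  refine ⟨ℓ, hℓ, ?_, ?_, ?_, ?_, ?_, ?_⟩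
  · rw [ofPred_forall]
    refine isOpen_iInter_of_finite fun k => isOpen_lt ?_ continuous_const
    have : Continuous fun y : E => b.repr (y - x) := b.repr.continuous.comp (by fun_prop)
    exact continuous_abs.comp ((EuclideanSpace.proj (𝕜 := ℝ) k).continuous.comp this)
  · intro y hy z hz s t hs ht hst k
    have e : b.repr (s • y + t • z - x) k = s * b.repr (y - x) k + t * b.repr (z - x) k := by
      have : s • y + t • z - x = s • (y - x) + t • (z - x) := by
        obtain rfl : s = 1 - t := by linarith
        module
      rw [this, map_add, map_smul, map_smul]
      simp
    rw [e]
    have h1 := abs_lt.1 (hy k)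
    have h2 := abs_lt.1 (hz k)
    exact abs_lt.2 (convex_Ioo (-(ℓ / 2)) (ℓ / 2) h1 h2 hs ht hst)
  · have e : {y : E | ∀ k : Fin 3, |b.repr (y - x) k| < ℓ / 2} =
        (fun y => y - x) ⁻¹' (b.repr ⁻¹' ((MeasurableEquiv.toLp 2 (Fin 3 → ℝ)).symm ⁻¹'
          (univ.pi fun _ => Ioo (-(ℓ / 2)) (ℓ / 2)))) := by
      ext y
      simp only [mem_ofPred_eq, mem_preimage, mem_univ_pi, mem_Ioo, abs_lt]
      rfl
    have hm : MeasurableSet (univ.pi fun _ : Fin 3 => Ioo (-(ℓ / 2)) (ℓ / 2)) :=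
      MeasurableSet.univ_pi fun _ => measurableSet_Ioo
    have hm2 := (MeasurableEquiv.toLp 2 (Fin 3 → ℝ)).symm.measurable hm
    rw [e, (measurePreserving_sub_right volume x).measure_preimage
      (b.measurePreserving_repr.measurable hm2).nullMeasurableSet,
      b.measurePreserving_repr.measure_preimage hm2.nullMeasurableSet,
      (EuclideanSpace.volume_preserving_symm_measurableEquiv_toLp (Fin 3)).measure_preimage
      hm.nullMeasurableSet, volume_pi_pi]
    simp only [Real.volume_Ioo, Finset.prod_const, Finset.card_univ, Fintype.card_fin]
    rw [← ENNReal.ofReal_pow (by linarith)]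
    congr 2
    ring
  · intro y hy
    rw [mem_closedBall, dist_eq_norm]
    refine abs_le_of_sq_le_sq' ?_ hℓ.le |>.2
    have hsq : ∀ k, b.repr (y - x) k ^ 2 ≤ (ℓ / 2) ^ 2 := fun k =>
      sq_le_sq' (abs_lt.1 (hy k)).1.le (abs_lt.1 (hy k)).2.le
    rw [hnorm]
    nlinarith [hsq 0, hsq 1, hsq 2]
  · intro y hy k
    have : x + (x - y) - x = -(y - x) := by abel
    rw [this, map_neg]
    change |-(b.repr (y - x) k)| < _
    rw [abs_neg]
    exact hy k
  · intro R hR hRQ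
    have hRℓ : R ≤ ℓ / 2 := by
      refine le_of_forall_lt fun s hs => ?_
      rcases le_or_gt s 0 with hs0 | hs0
      · linarith
      have h1 : x + s • b 0 ∈ ball x R := by
        rw [mem_ball, dist_eq_norm, add_sub_cancel_left, norm_smul, b.norm_eq_one, mul_one,
          Real.norm_of_nonneg hs0.le]
        exact hs
      have h2 := hRQ h1 0
      rw [add_sub_cancel_left, map_smul] at h2
      simpa [abs_of_pos hs0] using h2
    refine ⟨by linarith, ?_⟩
    -- the sphere meets the boundary of the cube in at most six points
    have hae : ∀ᵐ y ∂(sphereProb x R), ∀ k : Fin 3,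
        y ≠ x + R • b k ∧ y ≠ x + (-R) • b k := by
      refine ae_all_iff.2 fun k => ?_
      have h1 : ∀ a : E, ∀ᵐ y ∂(sphereProb x R), y ≠ a := fun a => by
        rw [ae_iff]
        simpa using sphereProb_singleton x R hR a
      exact (h1 _).and (h1 _)
    filter_upwards [hae, ae_mem_sphere_sphereProb x R] with y hy hyR k
    by_contra hk
    rw [not_lt] at hk
    have h1 : ‖y - x‖ ^ 2 = R ^ 2 := by rw [← dist_eq_norm, mem_sphere.1 hyR]
    rw [← b.repr.norm_map, EuclideanSpace.norm_sq_eq, Fin.sum_univ_succAbove _ k,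
      Fin.sum_univ_two] at h1
    simp only [Real.norm_eq_abs] at h1
    have hk' : R ≤ |b.repr (y - x) k| := hRℓ.trans hk
    have hk2 : R ^ 2 ≤ |b.repr (y - x) k| ^ 2 := by gcongr
    have hz0 : b.repr (y - x) (k.succAbove 0) = 0 := by
      have : |b.repr (y - x) (k.succAbove 0)| ^ 2 ≤ 0 := by
        nlinarith [sq_nonneg |b.repr (y - x) (k.succAbove 1)|]
      simpa using le_antisymm this (sq_nonneg _)
    have hz1 : b.repr (y - x) (k.succAbove 1) = 0 := by
      have : |b.repr (y - x) (k.succAbove 1)| ^ 2 ≤ 0 := by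
        nlinarith [sq_nonneg |b.repr (y - x) (k.succAbove 0)|]
      simpa using le_antisymm this (sq_nonneg _)
    have hk3 : |b.repr (y - x) k| = R := by
      rw [hz0, hz1] at h1
      simp only [abs_zero] at h1
      nlinarith [abs_nonneg (b.repr (y - x) k)]
    have hsum : y - x = b.repr (y - x) k • b k := by
      conv_lhs => rw [← b.sum_repr (y - x)]
      rw [Fin.sum_univ_succAbove _ k, Fin.sum_univ_two, hz0, hz1]
      simp
    rcases abs_choice (b.repr (y - x) k) with h | h
    · refine (hy k).1 ?_
      rw [← hk3, h, ← hsum]; abel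
    · refine (hy k).2 ?_
      rw [← hk3, h, neg_neg, ← hsum]; abel

theorem sum_restrict_le_of_disjoint {N : ℕ} {Ω : Set E} {Q : Fin N → Set E}
    (hQ : ∀ i, MeasurableSet (Q i)) (hsub : ∀ i, Q i ⊆ Ω)
    (hd : ∀ i j, i ≠ j → Disjoint (Q i) (Q j)) :
    HasDensityLE Ω 1 (∑ i, volume.restrict (Q i)) := by
  rw [HasDensityLE, ENNReal.ofReal_one, one_smul, ← Measure.sum_fintype,
    ← Measure.restrict_iUnion (fun i j hij => hd i j hij) hQ]
  exact Measure.restrict_mono (iUnion_subset hsub) le_rfl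

theorem hasDensityLE_cubeMeasure {N : ℕ} {Ω : Set E} {Q : Fin N → Set E} {m M : ℝ} (hm : 0 ≤ m)
    (hover : HasDensityLE Ω M (∑ i, volume.restrict (Q i)))
    (hQ : ∀ i, (N : ℝ≥0∞)⁻¹ * (volume (Q i))⁻¹ ≤ ENNReal.ofReal m) :
    HasDensityLE Ω (m * M) (cubeMeasure N Q) := by
  rw [HasDensityLE, cubeMeasure, Finset.smul_sum]
  calc ∑ i, (N : ℝ≥0∞)⁻¹ • (volume (Q i))⁻¹ • (volume : Measure E).restrict (Q i)
      ≤ ∑ i, ENNReal.ofReal m • (volume : Measure E).restrict (Q i) := by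
        refine Finset.sum_le_sum fun i _ => ?_
        rw [smul_smul]
        refine Measure.le_iff'.2 fun s => ?_
        simp only [Measure.smul_apply, smul_eq_mul]
        exact mul_le_mul_left (hQ i) _
    _ = ENNReal.ofReal m • ∑ i, (volume : Measure E).restrict (Q i) := by rw [Finset.smul_sum]
    _ ≤ ENNReal.ofReal m • ENNReal.ofReal M • volume.restrict Ω := by
        refine Measure.le_iff'.2 fun s => ?_
        have := Measure.le_iff'.1 hover s
        simp only [Measure.smul_apply, smul_eq_mul] at this ⊢
        exact mul_le_mul_right this _
    _ = _ := by rw [smul_smul, ← ENNReal.ofReal_mul hm]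

/-- The cubes of an admissible family are cells. -/
theorem IsCubeFamily.isCell {Ω : Set E} {N : ℕ} {r C₁ : ℝ} {X : Fin N → E} {Q : Fin N → Set E}
    (hC₁ : 0 < C₁) (hX : IsConfiguration Ω N r X) (hQ : IsCubeFamily Ω N r C₁ X Q) (i : Fin N) :
    IsCell Ω (X i) (r * scale N) (C₁ ^ (1 / 3 : ℝ) * scale N) (C₁ ^ 2) (Q i) ∧
      (∀ y, y ∈ Q i → X i + (X i - y) ∈ Q i) ∧
      (N : ℝ≥0∞)⁻¹ * (volume (Q i))⁻¹ ≤ ENNReal.ofReal C₁ := by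
  obtain ⟨ℓ, hℓ, ho, hc, hv, hb, hsymm, hR⟩ := (hQ.cube i).exists_side
  have hs := scale_pos hX.pos_N
  have hN : (0 : ℝ) < N := by exact_mod_cast hX.pos_N
  have hr := hX.pos_r
  have h1 := hQ.volume_ge i
  have h2 := hQ.volume_le i
  rw [hv] at h1 h2
  rw [ENNReal.ofReal_le_ofReal_iff (by positivity)] at h1 h2
  have hD3 : (C₁ ^ (1 / 3 : ℝ) * scale N) ^ 3 = C₁ / N := by
    rw [mul_pow, scale_pow_three hX.pos_N, ← Real.rpow_natCast, ← Real.rpow_mul hC₁.le]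
    norm_num
    rfl
  have hℓD : ℓ ≤ C₁ ^ (1 / 3 : ℝ) * scale N := by
    refine le_of_pow_le_pow_left₀ (n := 3) (by norm_num) (by positivity) ?_
    rw [hD3]; exact h2
  obtain ⟨hRℓ, hae⟩ := hR (r * scale N) (by positivity) (hQ.ball_subset i)
  refine ⟨⟨ho, hc, hQ.subset i, hae, hb.trans (closedBall_subset_closedBall hℓD),
    by positivity, hRℓ.trans hℓD, by positivity, ?_⟩, hsymm, ?_⟩
  · rw [hD3, hv, ← ENNReal.ofReal_mul (by positivity)]
    refine ENNReal.ofReal_le_ofReal ?_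
    calc C₁ / N = C₁ ^ 2 * (1 / (C₁ * N)) := by field_simp
      _ ≤ _ := by gcongr
  · rw [hv, ← ENNReal.ofReal_natCast, ← ENNReal.ofReal_inv_of_pos hN,
      ← ENNReal.ofReal_inv_of_pos (by positivity), ← ENNReal.ofReal_mul (by positivity)]
    refine ENNReal.ofReal_le_ofReal ?_
    have : (ℓ ^ 3)⁻¹ ≤ (1 / (C₁ * N))⁻¹ := by
      gcongr
    calc (N : ℝ)⁻¹ * (ℓ ^ 3)⁻¹ ≤ (N : ℝ)⁻¹ * (1 / (C₁ * N))⁻¹ := by gcongr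
      _ = C₁ := by field_simp

theorem IsCubeFamily.density {Ω : Set E} {N : ℕ} {r C₁ : ℝ} {X : Fin N → E} {Q : Fin N → Set E}
    (hC₁ : 0 < C₁) (hX : IsConfiguration Ω N r X) (hQ : IsCubeFamily Ω N r C₁ X Q) :
    HasDensityLE Ω 1 (∑ i, volume.restrict (Q i)) ∧ HasDensityLE Ω C₁ (cubeMeasure N Q) ∧
      IsProbabilityMeasure (cubeMeasure N Q) := by
  have hc := fun i => hQ.isCell hC₁ hX i
  have h1 := sum_restrict_le_of_disjoint (fun i => (hc i).1.isOpen.measurableSet) hQ.subset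
    hQ.disjoint
  refine ⟨h1, ?_, ?_⟩
  · have := hasDensityLE_cubeMeasure hC₁.le h1 fun i => (hc i).2.2
    rwa [mul_one] at this
  · exact isProbabilityMeasure_avgMeasure hX.pos_N fun i =>
      isProbabilityMeasure_unif (hc i).1.volume_ne_zero (hc i).1.volume_ne_top

theorem cellFactor_eq {p r d : ℝ} (hp : 0 < p) : cellFactor p r d =
    (if p < 3 then 1 else d ^ (1 - 3 / p)) * r ^ (-(max (3 / p - 1) 0)) := by
  unfold cellFactor
  split_ifs with h
  · have : 1 ≤ 3 / p := by rw [le_div_iff₀ hp]; linarith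
    rw [max_eq_left (by linarith), one_mul, neg_sub]
  · have : 3 / p ≤ 1 := by rw [div_le_one hp]; linarith
    rw [max_eq_right (by linarith)]
    simp

/-! ### The second-order estimate -/

theorem integrableOn_mul_of_tsupport_subset {Ω : Set E} {v ψ : E → ℝ}
    (hv : LocallyIntegrableOn v Ω) (hψ : Continuous ψ) (hψc : HasCompactSupport ψ)
    (hψs : tsupport ψ ⊆ Ω) : IntegrableOn (fun y => v y * ψ y) Ω := by
  have h1 : IntegrableOn v (tsupport ψ) := (hv.mono_set hψs).integrableOn_isCompact hψc
  have h2 : IntegrableOn (fun y => v y * ψ y) (tsupport ψ) :=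
    h1.mul_continuousOn hψ.continuousOn hψc
  have h3 : Integrable fun y => v y * ψ y := by
    refine (integrableOn_iff_integrable_of_support_subset fun y hy => ?_).1 h2
    exact subset_tsupport ψ (right_ne_zero_of_mul hy)
  exact h3.integrableOn

theorem HasWeakPartial.sub {Ω : Set E} {j : Fin 3} {v g w h : E → ℝ} (hv : HasWeakPartial Ω j v g)
    (hw : HasWeakPartial Ω j w h) :
    HasWeakPartial Ω j (fun y => v y - w y) (fun y => g y - h y) := by
  refine ⟨hv.1.sub hw.1, hv.2.1.sub hw.2.1, fun φ hφ hφc hφs => ?_⟩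
  have hd : Continuous fun y => fderiv ℝ φ y (EuclideanSpace.single j 1) :=
    (hφ.continuous_fderiv (by simp)).clm_apply continuous_const
  have hdc : HasCompactSupport fun y => fderiv ℝ φ y (EuclideanSpace.single j 1) :=
    hφc.fderiv_apply ℝ _
  have hds : tsupport (fun y => fderiv ℝ φ y (EuclideanSpace.single j 1)) ⊆ Ω :=
    (tsupport_fderiv_apply_subset ℝ _).trans hφs
  simp only [sub_mul]
  rw [integral_sub (integrableOn_mul_of_tsupport_subset hv.1 hd hdc hds)
      (integrableOn_mul_of_tsupport_subset hw.1 hd hdc hds),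
    integral_sub (integrableOn_mul_of_tsupport_subset hv.2.1 hφ.continuous hφc hφs)
      (integrableOn_mul_of_tsupport_subset hw.2.1 hφ.continuous hφc hφs),
    hv.2.2 φ hφ hφc hφs, hw.2.2 φ hφ hφc hφs]
  ring

theorem hasWeakPartial_clm (Ω : Set E) (L : E →L[ℝ] ℝ) (X : E) (j : Fin 3) :
    HasWeakPartial Ω j (fun y => L (y - X)) (fun _ => L (EuclideanSpace.single j 1)) := by
  have hc : Continuous fun y => L (y - X) := by fun_prop
  refine ⟨(hc.locallyIntegrable).locallyIntegrableOn Ω,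
    (continuous_const.locallyIntegrable).locallyIntegrableOn Ω, fun φ hφ hφc hφs => ?_⟩
  have hd : Continuous fun y => fderiv ℝ φ y (EuclideanSpace.single j 1) :=
    (hφ.continuous_fderiv (by simp)).clm_apply continuous_const
  have hdc : HasCompactSupport fun y => fderiv ℝ φ y (EuclideanSpace.single j 1) :=
    hφc.fderiv_apply ℝ _
  have hfd : ∀ y, fderiv ℝ (fun y => L (y - X)) y = L := fun y => by
    have : HasFDerivAt (fun y => L (y - X)) (L.comp (ContinuousLinearMap.id ℝ E)) y :=
      L.hasFDerivAt.comp y ((hasFDerivAt_id y).sub_const X)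
    simpa using this.fderiv
  rw [setIntegral_eq_integral_of_forall_compl_eq_zero fun y hy => by
      simp [image_eq_zero_of_notMem_tsupport fun h =>
        hy (hφs (tsupport_fderiv_subset ℝ h))],
    setIntegral_eq_integral_of_forall_compl_eq_zero fun y hy => by
      simp [image_eq_zero_of_notMem_tsupport fun h => hy (hφs h)]]
  have := integral_mul_fderiv_eq_neg_fderiv_mul_of_integrable (μ := (volume : Measure E))
    (f := fun y => L (y - X)) (g := φ) (v := EuclideanSpace.single j 1) ?_ ?_ ?_ ?_ ?_
  · simpa only [hfd] using this
  · simp only [hfd]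
    exact (continuous_const.mul hφ.continuous).integrable_of_hasCompactSupport hφc.mul_left
  · exact (hc.mul hd).integrable_of_hasCompactSupport hdc.mul_left
  · exact (hc.mul hφ.continuous).integrable_of_hasCompactSupport hφc.mul_left
  · exact fun y _ => (L.differentiable.comp (differentiable_id.sub_const X)) y
  · exact fun y _ => hφ.differentiable (by simp) y

/-- First moments about the centre of symmetry vanish. -/
theorem integral_clm_sub_eq_zero (L : E →L[ℝ] ℝ) (X : E) {μ : Measure E}
    (hμ : μ.map (fun y => X + (X - y)) = μ) : ∫ y, L (y - X) ∂μ = 0 := by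
  have hm : Measurable fun y : E => X + (X - y) := by fun_prop
  have h : ∫ y, L (y - X) ∂μ = - ∫ y, L (y - X) ∂μ := by
    conv_lhs => rw [← hμ]
    rw [integral_map hm.aemeasurable (by fun_prop), ← integral_neg]
    refine integral_congr_ae (ae_of_all _ fun y => ?_)
    have : X + (X - y) - X = -(y - X) := by abel
    simp only [this, map_neg]
  linarith

theorem map_reflection_restrict {X : E} {Q : Set E} (hQ : MeasurableSet Q)
    (hsymm : ∀ y, y ∈ Q → X + (X - y) ∈ Q) :
    (volume.restrict Q).map (fun y => X + (X - y)) = volume.restrict Q := by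
  have hp : (fun y => X + (X - y)) ⁻¹' Q = Q := by
    ext y
    refine ⟨fun h => ?_, hsymm y⟩
    have := hsymm _ h
    rwa [show X + (X - (X + (X - y))) = y by abel] at this
  have h1 : MeasurePreserving (fun y : E => X + (X - y)) :=
    (measurePreserving_add_left volume X).comp (Measure.measurePreserving_sub_left volume X)
  have := h1.restrict_preimage hQ
  rw [hp] at this
  exact this.map_eq

theorem average_clm_sub_eq_zero (L : E →L[ℝ] ℝ) {X : E} {Q : Set E} (hQ : MeasurableSet Q)
    (hsymm : ∀ y, y ∈ Q → X + (X - y) ∈ Q) : ⨍ y in Q, L (y - X) = 0 := by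
  rw [setAverage_eq, integral_clm_sub_eq_zero L X (map_reflection_restrict hQ hsymm), smul_zero]

theorem average_ball_clm (L : E →L[ℝ] ℝ) (X x : E) {s : ℝ} (hs : 0 < s) :
    ⨍ y in ball x s, L (y - X) = L (x - X) := by
  have hf : volume (ball x s) ≠ ⊤ := measure_ball_lt_top.ne
  have h0 : volume.real (ball x s) ≠ 0 :=
    (ENNReal.toReal_pos (measure_ball_pos _ _ hs).ne' hf).ne'
  have h1 := average_clm_sub_eq_zero L (X := x) (isOpen_ball (x := x) (ε := s)).measurableSet
    fun y hy => by simpa [dist_eq_norm, norm_sub_rev] using hy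
  have hint : IntegrableOn (fun y => L (y - x)) (ball x s) :=
    ((Continuous.continuousOn (by fun_prop)).integrableOn_compact
      (isCompact_closedBall x s)).mono_set ball_subset_closedBall
  have hc : IntegrableOn (fun _ : E => L (x - X)) (ball x s) := integrableOn_const hf
  rw [setAverage_eq, smul_eq_mul, mul_eq_zero_iff_left (inv_ne_zero h0)] at h1
  have e : (fun y => L (y - X)) = fun y => L (y - x) + L (x - X) := funext fun y => by
    rw [← map_add, sub_add_sub_cancel]
  rw [setAverage_eq, e, integral_add hint hc, h1, zero_add, setIntegral_const, smul_smul,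
    inv_mul_cancel₀ h0, one_smul]

theorem preciseRep_sub_clm {v : E → ℝ} {x : E} (h : HasPreciseValue v x) (L : E →L[ℝ] ℝ) (X : E)
    {U : Set E} (hU : U ∈ 𝓝 x) (hv : IntegrableOn v U) :
    preciseRep (fun y => v y - L (y - X)) x = preciseRep v x - L (x - X) := by
  obtain ⟨s₀, hs₀, hs₀U⟩ := Metric.mem_nhds_iff.1 hU
  refine Tendsto.limUnder_eq (((tendsto_preciseRep h).sub_const (L (x - X))).congr' ?_)
  filter_upwards [Ioo_mem_nhdsGT hs₀] with s hs
  have hint : IntegrableOn (fun y => L (y - X)) (ball x s) :=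
    ((Continuous.continuousOn (by fun_prop)).integrableOn_compact
      (isCompact_closedBall x s)).mono_set ball_subset_closedBall
  rw [← average_ball_clm L X x hs.1, setAverage_eq, setAverage_eq, setAverage_eq, ← smul_sub,
    ← integral_sub (hv.mono_set ((ball_subset_ball hs.2.le).trans hs₀U)) hint]

/-- The sphere and the cell have the same centre of mass, so an affine function may be subtracted;
this gains one power of the size of the cell. -/
theorem exists_sphere_sub_cell_le_second {p : ℝ} (hp : 1 < p) (hp32 : 3 / 2 < p) :
    ∃ C : ℝ, 0 ≤ C ∧ ∀ {Ω : Set E}, IsOpen Ω → ∀ {v : E → ℝ} {g : Fin 3 → E → ℝ} {G : E → ℝ≥0∞},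
      (∀ j, HasWeakPartial Ω j v (g j)) → (∀ j, GradBound Ω (g j) G) →
      (∀ j, ∀ᵐ z ∂(volume.restrict Ω), preciseRep (g j) z = g j z) →
      ∀ {X : E} {R D κ : ℝ} {Q : Set E}, IsCell Ω X R D κ Q → (∀ y, y ∈ Q → X + (X - y) ∈ Q) →
      IntegrableOn v Q → (∀ j, IntegrableOn (g j) Q) → lpNorm p G Q ≠ ⊤ →
      (∀ᵐ x ∂(sphereProb X R), HasPreciseValue v x) → Integrable (preciseRep v) (sphereProb X R) →
      ‖(∫ x, preciseRep v x ∂(sphereProb X R)) - ⨍ y in Q, v y‖ₑ ≤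
        ENNReal.ofReal (C * κ ^ 2 * D ^ (2 - 3 / p)) * lpNorm p G Q := by
  obtain ⟨q, hpq⟩ : ∃ q, p.HolderConjugate q := ⟨_, Real.HolderConjugate.conjExponent hp⟩
  have hp0 : 0 < p := hpq.pos
  have hq0 : 0 < q := hpq.symm.pos
  have hinv : 1 / q = 1 - 1 / p := by
    have := hpq.inv_add_inv_eq_one
    simp only [one_div]; linarith
  have hexp : 3 / q - 1 = 2 - 3 / p := by
    have : 3 / q = 3 * (1 / q) := by ring
    rw [this, hinv]; ring
  have hq3 : 1 * q < 3 := by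
    have : 1 / 3 < 1 / q := by
      rw [hinv]
      have : 1 / p < 1 / (3 / 2) := one_div_lt_one_div_of_lt (by norm_num) hp32
      norm_num at this ⊢
      linarith
    rw [div_lt_div_iff₀ (by norm_num) hq0] at this
    linarith
  obtain ⟨C₁, hC₁, h₁⟩ := exists_enorm_preciseRep_sub_average_cell_le
  obtain ⟨C₂, hC₂, h₂⟩ := exists_lintegral_kern_two_mul_kern_two_le
  obtain ⟨C₃, hC₃, h₃⟩ := exists_lintegral_mul_kern_closedBall_le hpq zero_le_one hq3
  refine ⟨C₁ * (3 * C₁) * C₂ * (C₃ * 2 ^ (2 - 3 / p)), by positivity, ?_⟩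
  intro Ω hΩ v g G hg hG hpg X R D κ Q hQ hsymm hv hgi hfin hpv hint
  have hD : 0 < D := hQ.pos.trans_le hQ.le
  have hκ := hQ.nonneg
  have := isProbabilityMeasure_sphereProb X hQ.pos
  have hGm : Measurable G := (hG 0).meas
  have hQm := hQ.isOpen.measurableSet
  set ν := sphereProb X R
  -- the slope of the affine function to be subtracted is the average gradient over `Q`
  set L : E →L[ℝ] ℝ := ∑ j, (⨍ y in Q, g j y) • EuclideanSpace.proj (𝕜 := ℝ) j with hL
  have hLj : ∀ j, L (EuclideanSpace.single j 1) = ⨍ y in Q, g j y := fun j => by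
    simp [hL]
  set w : E → ℝ := fun y => v y - L (y - X) with hw
  set H : E → ℝ≥0∞ := fun z => ENNReal.ofReal (3 * C₁ * κ) * pot G Q z with hH
  have hwH : GradBound Q w H := by
    refine ⟨(measurable_pot hGm Q).const_mul _,
      fun j y => g j y - L (EuclideanSpace.single j 1),
      fun j => ((hg j).mono hQ.subset).sub (hasWeakPartial_clm Q L X j), ?_⟩
    have hae : ∀ᵐ z ∂(volume.restrict Q), ∀ j, preciseRep (g j) z = g j z :=
      ae_all_iff.2 fun j => ae_restrict_of_ae_restrict_of_subset hQ.subset (hpg j)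
    filter_upwards [hae, ae_restrict_mem hQm] with z hz hzQ
    calc ∑ j, ‖g j z - L (EuclideanSpace.single j 1)‖ₑ
        ≤ ∑ _j : Fin 3, ENNReal.ofReal (C₁ * κ) * pot G Q z := by
          refine Finset.sum_le_sum fun j _ => ?_
          rw [hLj, ← hz j]
          exact h₁ (hG j) hQ (hgi j) z hzQ (hQ.subset_closedBall hzQ)
      _ = H z := by
          rw [hH, Finset.sum_const, Finset.card_univ, Fintype.card_fin, nsmul_eq_mul, ← mul_assoc,
            show ((3 : ℕ) : ℝ≥0∞) = ENNReal.ofReal 3 by simp, ← ENNReal.ofReal_mul (by norm_num),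
            mul_assoc 3]
  have hQ' : IsCell Q X R D κ Q := { hQ with subset := subset_rfl }
  have hwi : IntegrableOn w Q := by
    refine hv.sub (((Continuous.continuousOn (by fun_prop)).integrableOn_compact
      (isCompact_closedBall X D)).mono_set hQ.subset_closedBall)
  -- the potential of the potential of the second derivatives is bounded on the whole cell
  have hpot : ∀ x ∈ closedBall X D, pot H Q x ≤
      ENNReal.ofReal (3 * C₁ * κ * C₂ * (C₃ * (2 * D) ^ (2 - 3 / p))) * lpNorm p G Q := by
    intro x hx
    have hswap : ∫⁻ z in Q, pot G Q z * kern 2 x z ≤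
        ∫⁻ y in Q, G y * (ENNReal.ofReal C₂ * kern 1 x y) := by
      calc ∫⁻ z in Q, pot G Q z * kern 2 x z
          = ∫⁻ z in Q, ∫⁻ y in Q, G y * (kern 2 x z * kern 2 z y) := by
            refine lintegral_congr fun z => ?_
            have hm : Measurable fun y => G y * kern 2 z y := hGm.mul (measurable_kern 2 z)
            rw [pot, ← lintegral_mul_const _ hm]
            refine lintegral_congr fun y => ?_
            rw [mul_assoc, mul_comm (kern 2 z y)]
        _ = ∫⁻ y in Q, ∫⁻ z in Q, G y * (kern 2 x z * kern 2 z y) := by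
            refine lintegral_lintegral_swap (Measurable.aemeasurable ?_)
            exact (hGm.comp measurable_snd).mul
              (((measurable_kern 2 x).comp measurable_fst).mul (measurable_kern_uncurry 2))
        _ ≤ _ := by
            refine lintegral_mono fun y => ?_
            have hm : Measurable fun z => kern 2 x z * kern 2 z y := by
              simp only [kern_comm 2 _ y]
              exact (measurable_kern 2 x).mul (measurable_kern 2 y)
            rw [lintegral_const_mul _ hm]
            exact mul_le_mul_right ((setLIntegral_le_lintegral _ _).trans (h₂ x y)) _
    have hsub : Q ⊆ closedBall x (2 * D) := hQ.subset_closedBall.trans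
      (closedBall_subset_closedBall' (by rw [mem_closedBall, dist_comm] at hx; linarith))
    calc pot H Q x = ENNReal.ofReal (3 * C₁ * κ) * ∫⁻ z in Q, pot G Q z * kern 2 x z := by
          have hm : Measurable fun z => pot G Q z * kern 2 x z :=
            (measurable_pot hGm Q).mul (measurable_kern 2 x)
          rw [pot, ← lintegral_const_mul _ hm]
          simp only [hH, mul_assoc]
      _ ≤ ENNReal.ofReal (3 * C₁ * κ) * (ENNReal.ofReal C₂ *
            (ENNReal.ofReal (C₃ * (2 * D) ^ (3 / q - 1)) * lpNorm p G Q)) := by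
          refine mul_le_mul_right (hswap.trans ?_) _
          simp only [mul_left_comm (G _)]
          have hm : Measurable fun y => G y * kern 1 x y := hGm.mul (measurable_kern 1 x)
          rw [lintegral_const_mul _ hm]
          exact mul_le_mul_right (h₃ hGm (by positivity) hsub) _
      _ = _ := by
          rw [hexp, ← mul_assoc, ← mul_assoc, ← ENNReal.ofReal_mul (by positivity),
            ← ENNReal.ofReal_mul (by positivity)]
  have hwp : ∀ᵐ x ∂ν, preciseRep w x = preciseRep v x - L (x - X) := by
    filter_upwards [hpv, hQ.ae_mem] with x hx hxQ
    exact preciseRep_sub_clm hx L X (hQ.isOpen.mem_nhds hxQ) hv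
  have hLi : Integrable (fun x => L (x - X)) ν := by
    refine Integrable.of_bound (by fun_prop) (‖L‖ * R) ?_
    filter_upwards [ae_mem_sphere_sphereProb X R] with x hx
    refine (L.le_opNorm _).trans ?_
    rw [← dist_eq_norm, mem_sphere.1 hx]
  have hwint : Integrable (preciseRep w) ν := (hint.sub hLi).congr (hwp.mono fun x hx => hx.symm)
  have e1 : ∫ x, preciseRep w x ∂ν = ∫ x, preciseRep v x ∂ν := by
    rw [integral_congr_ae hwp, integral_sub hint hLi,
      integral_clm_sub_eq_zero L X (map_reflection_sphereProb X R), sub_zero]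
  have e2 : ⨍ y in Q, w y = ⨍ y in Q, v y := by
    have h0 := average_clm_sub_eq_zero L hQm hsymm
    have hLQ : IntegrableOn (fun y => L (y - X)) Q :=
      ((Continuous.continuousOn (by fun_prop)).integrableOn_compact
        (isCompact_closedBall X D)).mono_set hQ.subset_closedBall
    rw [setAverage_eq] at h0
    rw [setAverage_eq, integral_sub hv hLQ, smul_sub, h0, sub_zero, ← setAverage_eq]
  have e : (∫ x, preciseRep v x ∂ν) - ⨍ y in Q, v y =
      ∫ x, (preciseRep w x - ⨍ y in Q, w y) ∂ν := by
    rw [integral_sub hwint (integrable_const _), integral_const, probReal_univ, one_smul, e1, e2]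
  rw [e]
  refine (enorm_integral_le_lintegral_enorm _).trans ?_
  calc ∫⁻ x, ‖preciseRep w x - ⨍ y in Q, w y‖ₑ ∂ν
      ≤ ∫⁻ _x, ENNReal.ofReal (C₁ * κ) *
          (ENNReal.ofReal (3 * C₁ * κ * C₂ * (C₃ * (2 * D) ^ (2 - 3 / p))) * lpNorm p G Q) ∂ν := by
        refine lintegral_mono_ae ?_
        filter_upwards [hQ.ae_mem, ae_mem_sphere_sphereProb X R] with x hxQ hxs
        have hxD : x ∈ closedBall X D := sphere_subset_closedBall.trans
          (closedBall_subset_closedBall hQ.le) hxs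
        exact (h₁ hwH hQ' hwi x hxQ hxD).trans (mul_le_mul_right (hpot x hxD) _)
    _ = _ := by
        rw [lintegral_const, measure_univ, mul_one, ← mul_assoc,
          ← ENNReal.ofReal_mul (by positivity), Real.mul_rpow (by norm_num) hD.le]
        congr 2
        ring

theorem MemSobolev.of_two {Ω : Set E} {p : ℝ≥0∞} {v : E → ℝ} (h : MemSobolev Ω p 2 v) :
    MemSobolev Ω p 1 v := ⟨h.1, fun j => ⟨(h.2 j).1, (h.2 j).2.1⟩⟩

theorem GradBound.mono_right {Ω : Set E} {v : E → ℝ} {G G' : E → ℝ≥0∞} (h : GradBound Ω v G)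
    (hG' : Measurable G') (hle : ∀ y, G y ≤ G' y) : GradBound Ω v G' := by
  obtain ⟨g, hg, hG⟩ := h.exists_grad
  exact ⟨hG', g, hg, hG.mono fun y hy => hy.trans (hle y)⟩

/-- Second-order comparison of the averaged surface measures with the averages over cells. -/
theorem exists_sphereMeasure_sub_cubeMeasure_le_second {p : ℝ} (hp : 1 < p) (hp3 : p ≠ 3)
    (hp32 : 3 / 2 < p) :
    ∃ C : ℝ, 0 ≤ C ∧ ∀ {Ω : Set E}, IsOpen Ω → ∀ {N : ℕ}, 0 < N → ∀ {r d κ M : ℝ} {X : Fin N → E}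
      {Q : Fin N → Set E}, 0 ≤ M → 0 < r → 0 ≤ d →
      (∀ i, IsCell Ω (X i) (r * scale N) (d * scale N) κ (Q i)) →
      (∀ i y, y ∈ Q i → X i + (X i - y) ∈ Q i) →
      (∀ i, sphere (X i) (r * scale N) ⊆ Ω) → HasDensityLE Ω M (∑ i, volume.restrict (Q i)) →
      ∀ v, MemSobolev Ω (ENNReal.ofReal p) 2 v → sobolevNorm Ω (ENNReal.ofReal p) 2 v ≤ 1 →
        ‖(∫ x, preciseRep v x ∂(sphereMeasure N r X)) - ∫ x, preciseRep v x ∂(cubeMeasure N Q)‖ₑ ≤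
          ENNReal.ofReal (C * κ ^ 2 * M ^ (1 / p) * d ^ (2 - 3 / p) * scale N ^ 2) := by
  obtain ⟨C', hC', h'⟩ := exists_sphere_sub_cell_le hp hp3
  obtain ⟨C, hC, h⟩ := exists_sphere_sub_cell_le_second hp hp32
  refine ⟨C, hC, ?_⟩
  intro Ω hΩ N hN r d κ M X Q hM hr hd hQ hsymm hsΩ hover v hv hv1
  have hp0 : 0 < p := by linarith
  have hs := scale_pos hN
  have hκ : 0 ≤ κ := (hQ ⟨0, hN⟩).nonneg
  have hint : ∀ v, MemLp v (ENNReal.ofReal p) (volume.restrict Ω) → ∀ i,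
      IntegrableOn v (Q i) ∧ Integrable v (unif (Q i)) := fun v hv i =>
    integrable_unif (hQ i).subset (hQ i).volume_ne_zero (hQ i).volume_ne_top hp hv
  obtain ⟨G', hG', hfin', -⟩ := hv.of_two.exists_gradBound (k := 0) hp
  have hc := fun i => h' hΩ hG' (hQ i) (hsΩ i) (hint v hv.memLp i).1
    ((lpNorm_mono hp0 G' (hQ i).subset).trans_lt hfin'.lt_top).ne
  have hae := fun i => preciseRep_ae_eq_unif hΩ (hQ i).subset hp hv.memLp
  choose G₂ hG₂ hfin₂ hle₂ using fun j => (hv.2 j).2.exists_gradBound (k := 0) hp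
  set G : E → ℝ≥0∞ := fun y => ∑ j, G₂ j y with hGdef
  have hGm : Measurable G := Finset.measurable_sum _ fun j _ => (hG₂ j).meas
  have hGb : ∀ j, GradBound Ω (weakPartial Ω j v) G := fun j => (hG₂ j).mono_right hGm fun y =>
    Finset.single_le_sum (f := fun j => G₂ j y) (fun _ _ => zero_le) (Finset.mem_univ j)
  have hle : lpNorm p G Ω ≤ 1 := by
    refine (lpNorm_sum_le hp.le _ _ (fun j _ => (hG₂ j).meas) Ω).trans (le_trans ?_ hv1)
    refine le_trans (Finset.sum_le_sum fun j _ => hle₂ j) ?_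
    exact le_add_self
  have hpg : ∀ j, ∀ᵐ z ∂(volume.restrict Ω),
      preciseRep (weakPartial Ω j v) z = weakPartial Ω j v z := fun j =>
    (ae_preciseRep_eq hΩ (locallyIntegrable_indicator hΩ (by simpa using hp.le)
      (hv.2 j).2.memLp)).mono fun x hx => hx.2
  have hc2 := fun i => h hΩ (fun j => hasWeakPartial_weakPartial (hv.2 j).1) hGb hpg (hQ i)
    (hsymm i) (hint v hv.memLp i).1 (fun j => (hint _ (hv.2 j).2.memLp i).1)
    ((lpNorm_mono hp0 G (hQ i).subset).trans_lt (hle.trans_lt ENNReal.one_lt_top)).ne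
    (hc i).1 (hc i).2.1
  rw [sphereMeasure_eq, cubeMeasure_eq, integral_avgMeasure fun i => (hc i).2.1,
    integral_avgMeasure fun i => (hint v hv.memLp i).2.congr (hae i).symm]
  refine (enorm_avg_sub_avg_le _ _ fun i => ?_).trans (b := (N : ℝ≥0∞)⁻¹ * ∑ i,
    ENNReal.ofReal (C * κ ^ 2 * (d * scale N) ^ (2 - 3 / p)) * lpNorm p G (Q i)) ?_
  · rw [integral_congr_ae (hae i), integral_unif]
    exact hc2 i
  · rw [← Finset.mul_sum, mul_left_comm]
    calc _ ≤ ENNReal.ofReal (C * κ ^ 2 * (d * scale N) ^ (2 - 3 / p)) *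
          (ENNReal.ofReal (M ^ (1 / p) * scale N ^ (3 / p)) * 1) := by
          refine mul_le_mul_right ((avg_lpNorm_le hp.le hN hM hover G).trans ?_) _
          exact mul_le_mul_right hle _
      _ = _ := by
          rw [mul_one, ← ENNReal.ofReal_mul (by positivity)]
          congr 1
          have e : (d * scale N) ^ (2 - 3 / p) * scale N ^ (3 / p) =
              d ^ (2 - 3 / p) * scale N ^ 2 := by
            rw [Real.mul_rpow hd hs.le, mul_assoc, ← Real.rpow_add hs, sub_add_cancel,
              show (2 : ℝ) = ((2 : ℕ) : ℝ) by norm_num, Real.rpow_natCast]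
          calc _ = C * κ ^ 2 * M ^ (1 / p) *
              ((d * scale N) ^ (2 - 3 / p) * scale N ^ (3 / p)) := by ring
            _ = _ := by rw [e]; ring

theorem scale_sq (N : ℕ) : scale N ^ 2 = (N : ℝ) ^ (-(2 / 3 : ℝ)) := by
  rw [scale, ← Real.rpow_natCast, ← Real.rpow_mul (Nat.cast_nonneg N)]
  norm_num

/-- Comparison of `ρ̄_N` and `σ_N`. -/
theorem exists_dualDistLE_sphereMeasure_cubeMeasure {p : ℝ} (hp : 1 < p) (hp3 : p ≠ 3) {C₁ : ℝ}
    (hC₁ : 0 < C₁) : ∃ C : ℝ, ∀ (Ω : Set E), IsContainer Ω →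
      ∀ (N : ℕ) (r : ℝ) (X : Fin N → E) (Q : Fin N → Set E),
        IsConfiguration Ω N r X → IsCubeFamily Ω N r C₁ X Q →
        DualDistLE Ω 1 p (sphereMeasure N r X) (cubeMeasure N Q)
          (C * r ^ (-(max (3 / p - 1) 0)) * (N : ℝ) ^ (-(1 / 3 : ℝ))) ∧
        (3 / 2 < p → DualDistLE Ω 2 p (sphereMeasure N r X) (cubeMeasure N Q)
          (C * (N : ℝ) ^ (-(2 / 3 : ℝ)))) := by
  have hp0 : 0 < p := by linarith
  obtain ⟨A, hA, hfirst⟩ := exists_sphereMeasure_sub_cubeMeasure_le hp hp3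
  obtain ⟨B, hB, hsecond⟩ : ∃ B : ℝ, 0 ≤ B ∧ (3 / 2 < p → ∀ {Ω : Set E}, IsOpen Ω → ∀ {N : ℕ},
      0 < N → ∀ {r d κ M : ℝ} {X : Fin N → E}
      {Q : Fin N → Set E}, 0 ≤ M → 0 < r → 0 ≤ d →
      (∀ i, IsCell Ω (X i) (r * scale N) (d * scale N) κ (Q i)) →
      (∀ i y, y ∈ Q i → X i + (X i - y) ∈ Q i) →
      (∀ i, sphere (X i) (r * scale N) ⊆ Ω) → HasDensityLE Ω M (∑ i, volume.restrict (Q i)) →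
      ∀ v, MemSobolev Ω (ENNReal.ofReal p) 2 v → sobolevNorm Ω (ENNReal.ofReal p) 2 v ≤ 1 →
        ‖(∫ x, preciseRep v x ∂(sphereMeasure N r X)) - ∫ x, preciseRep v x ∂(cubeMeasure N Q)‖ₑ ≤
          ENNReal.ofReal (B * κ ^ 2 * M ^ (1 / p) * d ^ (2 - 3 / p) * scale N ^ 2)) := by
    by_cases h32 : 3 / 2 < p
    · obtain ⟨B, hB, h⟩ := exists_sphereMeasure_sub_cubeMeasure_le_second hp hp3 h32
      exact ⟨B, hB, fun _ => h⟩
    · exact ⟨0, le_rfl, fun h => absurd h h32⟩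
  set d : ℝ := C₁ ^ (1 / 3 : ℝ) with hd
  have hd0 : 0 < d := by positivity
  set e : ℝ := if p < 3 then 1 else d ^ (1 - 3 / p) with he
  have he0 : 0 < e := by rw [he]; split_ifs <;> positivity
  refine ⟨A * C₁ ^ 2 * e + B * (C₁ ^ 2) ^ 2 * d ^ (2 - 3 / p), ?_⟩
  intro Ω hΩ N r X Q hX hQ
  have hΩo : IsOpen Ω := hΩ.1.1
  have hs := scale_pos hX.pos_N
  have hr := hX.pos_r
  have hcell := fun i => hQ.isCell hC₁ hX i
  obtain ⟨hover, hden, hprob⟩ := hQ.density hC₁ hX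
  have hsΩ : ∀ i, sphere (X i) (r * scale N) ⊆ Ω := fun i =>
    sphere_subset_closedBall.trans (hX.subset i)
  obtain ⟨hact, hest⟩ := hfirst hΩo hX.pos_N zero_le_one hX.pos_r hd0.le (fun i => (hcell i).1)
    hsΩ hover
  refine ⟨dualDistLE_of_forall hact (hden.actsOnSobolev hΩo hp 1) fun v hv hv1 => ?_,
    fun h32 => dualDistLE_of_forall (fun v hv => hact v hv.of_two)
      (hden.actsOnSobolev hΩo hp 2) fun v hv hv1 => ?_⟩
  · refine (hest v hv hv1).trans (ENNReal.ofReal_le_ofReal ?_)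
    rw [cellFactor_eq hp0, Real.one_rpow, mul_one]
    change _ ≤ _ * scale N
    have : A * C₁ ^ 2 * (e * r ^ (-(max (3 / p - 1) 0))) =
      (A * C₁ ^ 2 * e) * r ^ (-(max (3 / p - 1) 0)) := by ring
    rw [this]
    gcongr
    exact le_add_of_nonneg_right (by positivity)
  · refine (hsecond h32 hΩo hX.pos_N zero_le_one hX.pos_r hd0.le (fun i => (hcell i).1)
      (fun i => (hcell i).2.1) hsΩ hover v hv hv1).trans (ENNReal.ofReal_le_ofReal ?_)
    rw [Real.one_rpow, mul_one, ← scale_sq]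
    gcongr
    exact le_add_of_nonneg_left (by positivity)

/-! ### The uniform interior cone property -/

/-- For every vertex `y ∈ Ω` within `δ` of `x`, the truncated cone
`{y + s (e + b) : 0 ≤ s < δ, ‖b‖ ≤ κ}` lies in `Ω`. -/
def HasInteriorCone (Ω : Set E) (x : E) (δ κ : ℝ) (e : E) : Prop :=
  ‖e‖ = 1 ∧ ∀ y ∈ Ω, dist y x < δ → ∀ s : ℝ, 0 ≤ s → s < δ → ∀ b : E, ‖b‖ ≤ κ →
    y + s • (e + b) ∈ Ω

theorem HasInteriorCone.mono {Ω : Set E} {x : E} {δ κ δ' κ' : ℝ} {e : E}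
    (h : HasInteriorCone Ω x δ κ e) (hδ : δ' ≤ δ) (hκ : κ' ≤ κ) : HasInteriorCone Ω x δ' κ' e :=
  ⟨h.1, fun y hy hyx s hs hsδ b hb =>
    h.2 y hy (hyx.trans_le hδ) s hs (hsδ.trans_le hδ) b (hb.trans hκ)⟩

theorem dist_add_smul_lt {x₀ x y e b : E} {s η : ℝ} (he : ‖e‖ = 1) (hb : ‖b‖ ≤ 1)
    (hx : dist x x₀ < η) (hy : dist y x < η) (hs : 0 ≤ s) (hsη : s < η) :
    dist (y + s • (e + b)) x₀ < 4 * η := by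
  have h1 : dist (y + s • (e + b)) y ≤ s * 2 := by
    rw [dist_self_add_left, norm_smul, Real.norm_of_nonneg hs]
    gcongr
    exact (norm_add_le _ _).trans (by linarith)
  have h2 := dist_triangle4 (y + s • (e + b)) y x x₀
  linarith

/-- Near a boundary point, an open set above the graph of a Lipschitz function contains the cones
around the vertical direction. -/
theorem exists_hasInteriorCone_of_graph {Ω : Set E} {x₀ : E} {ρ : ℝ} (hρ : 0 < ρ)
    (b : OrthonormalBasis (Fin 3) ℝ E) {γ : EuclideanSpace ℝ (Fin 2) → ℝ} (hγ : ContDiff ℝ 2 γ)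
    (h : ∀ y ∈ ball x₀ ρ, (y ∈ Ω ↔ γ !₂[b.repr y 0, b.repr y 1] < b.repr y 2)) :
    ∃ δ > 0, ∃ κ > 0, ∀ x ∈ ball x₀ δ, ∃ e, HasInteriorCone Ω x δ κ e := by
  set P : E → EuclideanSpace ℝ (Fin 2) := fun y => !₂[b.repr y 0, b.repr y 1] with hP
  have hPdist : ∀ y z, dist (P y) (P z) ≤ dist y z := fun y z => by
    rw [dist_eq_norm y z, ← b.repr.norm_map, EuclideanSpace.dist_eq, EuclideanSpace.norm_eq]
    refine Real.sqrt_le_sqrt ?_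
    simp only [hP, Fin.sum_univ_two, Fin.sum_univ_three, map_sub, PiLp.sub_apply, Real.norm_eq_abs,
      Real.dist_eq]
    exact le_add_of_nonneg_right (sq_nonneg _)
  obtain ⟨K, t, ht, hK⟩ := (hγ.contDiffAt.of_le (by norm_num)).exists_lipschitzOnWith (x := P x₀)
  obtain ⟨η, hη, hηt⟩ := Metric.mem_nhds_iff.1 ht
  set δ := min ρ η / 4 with hδ
  have hδ0 : 0 < δ := by positivity
  have h4ρ : 4 * δ ≤ ρ := by rw [hδ]; linarith [min_le_left ρ η]
  have h4η : 4 * δ ≤ η := by rw [hδ]; linarith [min_le_right ρ η]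
  have hK0 : 0 ≤ (K : ℝ) := K.2
  refine ⟨δ, hδ0, 1 / (K + 2), by positivity, fun x hx => ⟨b 2, b.norm_eq_one 2, ?_⟩⟩
  intro y hy hyx s hs hsδ w hw
  have hw1 : ‖w‖ ≤ 1 := hw.trans (by rw [div_le_one (by positivity)]; linarith)
  have hz : dist (y + s • (b 2 + w)) x₀ < 4 * δ :=
    dist_add_smul_lt (b.norm_eq_one 2) hw1 hx hyx hs hsδ
  have hy0 : dist y x₀ < 4 * δ := by
    have := dist_triangle y x x₀
    have := mem_ball.1 hx
    linarith
  rw [h _ (mem_ball.2 (hz.trans_le h4ρ))]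
  rw [h _ (mem_ball.2 (hy0.trans_le h4ρ))] at hy
  have h1 : γ (P (y + s • (b 2 + w))) - γ (P y) ≤ K * (s * ‖w‖) := by
    have h1 := hK.dist_le_mul _ (hηt ((hPdist _ _).trans_lt (hz.trans_le h4η))) _
      (hηt ((hPdist _ _).trans_lt (hy0.trans_le h4η)))
    refine (le_abs_self _).trans (h1.trans ?_)
    gcongr
    have e : P (y + s • (b 2 + w)) = P (y + s • w) := by
      ext k
      fin_cases k <;> simp [hP, smul_add]
    rw [e]
    refine (hPdist _ _).trans (le_of_eq ?_)
    rw [dist_self_add_left, norm_smul, Real.norm_of_nonneg hs]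
  have h2 : b.repr (y + s • (b 2 + w)) 2 = b.repr y 2 + s * (1 + b.repr w 2) := by
    simp [smul_add, mul_add]
  have h3 : -‖w‖ ≤ b.repr w 2 := by
    have := PiLp.norm_apply_le (b.repr w) 2
    rw [b.repr.norm_map] at this
    exact (abs_le.1 this).1
  have h4 : (K + 1) * ‖w‖ ≤ 1 := by
    calc (K + 1) * ‖w‖ ≤ (K + 1) * (1 / (K + 2)) := by gcongr
      _ ≤ 1 := by rw [mul_one_div, div_le_one (by positivity)]; linarith
  change γ (P _) < _
  rw [h2]
  have h5 : s * (K * ‖w‖) ≤ s * (1 + b.repr w 2) := by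
    gcongr
    linarith
  have : γ (P y) < b.repr y 2 := hy
  linarith

theorem IsC2Domain.exists_hasInteriorCone_nhds {Ω : Set E} (hΩ : IsC2Domain Ω) (x₀ : E) :
    ∃ δ > 0, ∃ κ > 0, ∀ x ∈ ball x₀ δ, ∃ e, HasInteriorCone Ω x δ κ e := by
  have he : ‖(EuclideanSpace.single 0 1 : E)‖ = 1 := by simp
  by_cases hx₀ : x₀ ∈ frontier Ω
  · obtain ⟨ρ, hρ, b, γ, hγ, h⟩ := hΩ.2 x₀ hx₀
    exact exists_hasInteriorCone_of_graph hρ b hγ h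
  by_cases hx : x₀ ∈ Ω
  · obtain ⟨η, hη, hηΩ⟩ := Metric.isOpen_iff.1 hΩ.1 x₀ hx
    refine ⟨η / 4, by positivity, 1, one_pos, fun x hx => ⟨_, he, ?_⟩⟩
    intro y _ hyx s hs hsδ w hw
    refine hηΩ (mem_ball.2 ((dist_add_smul_lt he hw hx hyx hs hsδ).trans_le ?_))
    linarith
  · have hx' : x₀ ∉ closure Ω := fun h => hx₀ ⟨h, by rwa [hΩ.1.interior_eq]⟩
    obtain ⟨η, hη, hηΩ⟩ := Metric.isOpen_iff.1 isClosed_closure.isOpen_compl x₀ hx'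
    refine ⟨η / 2, by positivity, 1, one_pos, fun x hx => ⟨_, he, ?_⟩⟩
    intro y hy hyx
    refine absurd (subset_closure hy) (hηΩ ?_)
    have := dist_triangle y x x₀
    have := mem_ball.1 hx
    exact mem_ball.2 (by linarith)

/-- The uniform interior cone property on a compact set. -/
theorem IsC2Domain.exists_hasInteriorCone {Ω K : Set E} (hΩ : IsC2Domain Ω) (hK : IsCompact K) :
    ∃ δ > 0, ∃ κ > 0, ∀ x ∈ K, ∃ e, HasInteriorCone Ω x δ κ e := by
  refine hK.induction_on (p := fun s => ∃ δ > (0 : ℝ), ∃ κ > (0 : ℝ), ∀ x ∈ s, ∃ e,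
    HasInteriorCone Ω x δ κ e) ⟨1, one_pos, 1, one_pos, by simp⟩ ?_ ?_ ?_
  · rintro s t hst ⟨δ, hδ, κ, hκ, h⟩
    exact ⟨δ, hδ, κ, hκ, fun x hx => h x (hst hx)⟩
  · rintro s t ⟨δ, hδ, κ, hκ, h⟩ ⟨δ', hδ', κ', hκ', h'⟩
    refine ⟨min δ δ', lt_min hδ hδ', min κ κ', lt_min hκ hκ', fun x hx => ?_⟩
    rcases hx with hx | hx
    · exact (h x hx).imp fun e he => he.mono (min_le_left _ _) (min_le_left _ _)
    · exact (h' x hx).imp fun e he => he.mono (min_le_right _ _) (min_le_right _ _)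
  · intro x _
    obtain ⟨δ, hδ, κ, hκ, h⟩ := hΩ.exists_hasInteriorCone_nhds x
    exact ⟨ball x δ, mem_nhdsWithin_of_mem_nhds (ball_mem_nhds x hδ), δ, hδ, κ, hκ, h⟩

/-! ### Transport along cones -/

/-- Along an interior cone, the value of a Sobolev function at a point and its average over a ball
of comparable size, placed inside the cone, are compared by a potential of the gradient. -/
theorem exists_enorm_preciseRep_sub_average_cone_le {κ A : ℝ} (hκ : 0 < κ) (hA : 0 ≤ A) :
    ∃ C S D : ℝ, 0 < C ∧ 0 < S ∧ 0 < D ∧ ∀ {Ω : Set E} {v : E → ℝ} {G : E → ℝ≥0∞},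
      IsOpen Ω → GradBound Ω v G → ∀ {δ h : ℝ} {x e : E}, HasInteriorCone Ω x δ κ e → 0 < h →
      (A + S + 1) * h < δ → x ∈ Ω →
      ball (x + (S * h) • e) h ⊆ Ω ∧ (IntegrableOn v (ball (x + (S * h) • e) h) →
        ∀ y ∈ Ω, dist y x ≤ A * h → ‖preciseRep v y - ⨍ z in ball (x + (S * h) • e) h, v z‖ₑ ≤
          ENNReal.ofReal C * pot G (Ω ∩ closedBall y (D * h)) y) := by
  obtain ⟨C, hC, hmain⟩ := exists_enorm_preciseRep_sub_average_le
  have hu := unitVol_pos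
  -- the distance is so large that a cone with vertex up to `(A + 1) * h` from `x` contains `Z`
  set S := (A + 2) / κ with hS
  have hS0 : 0 < S := by positivity
  have hSκ : S * κ = A + 2 := by rw [hS]; field_simp
  refine ⟨C * (A + S + 2) ^ 3 / unitVol, S, A + S + 2, by positivity, hS0, by positivity, ?_⟩
  intro Ω v G hΩ hG δ h x e hcone hh hδ hxΩ
  have hSh : 0 < S * h := by positivity
  have hAh : 0 ≤ A * h := by positivity
  set Z := ball (x + (S * h) • e) h with hZ
  -- the ball `Z` lies in the cone with vertex `y`
  have hjoin : ∀ y ∈ Ω, dist y x < (A + 1) * h → ∀ z ∈ Z, ∀ t : ℝ, 0 ≤ t → t ≤ 1 →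
      y + t • (z - y) ∈ Ω := by
    intro y hy hyx z hz t ht ht1
    have e1 : t • (z - y) =
        (t * (S * h)) • (e + (S * h)⁻¹ • ((x - y) + (z - (x + (S * h) • e)))) := by
      rw [mul_smul, smul_add (S * h), smul_inv_smul₀ hSh.ne']
      congr 1
      abel
    rw [e1]
    refine hcone.2 y hy (by nlinarith) _ (by positivity) ?_ _ ?_
    · have : t * (S * h) ≤ S * h := mul_le_of_le_one_left hSh.le ht1
      nlinarith
    · rw [norm_smul, norm_inv, Real.norm_of_nonneg hSh.le, inv_mul_le_iff₀ hSh]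
      have h1 : ‖x - y‖ < (A + 1) * h := by rwa [← dist_eq_norm, dist_comm]
      have h2 : ‖z - (x + (S * h) • e)‖ < h := by rwa [← dist_eq_norm]
      calc _ ≤ ‖x - y‖ + ‖z - (x + (S * h) • e)‖ := norm_add_le _ _
        _ ≤ (S * κ) * h := by rw [hSκ]; linarith
        _ = _ := by ring
  have hZΩ : Z ⊆ Ω := fun z hz => by
    have := hjoin x hxΩ (by rw [dist_self]; positivity) z hz 1 zero_le_one le_rfl
    simpa using this
  refine ⟨hZΩ, fun hv y hy hyx => ?_⟩
  obtain ⟨τ₀, hτ₀, hτ₀Ω⟩ := Metric.isOpen_iff.1 hΩ y hy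
  obtain ⟨τ, hτ0, hτ⟩ : ∃ τ, 0 < τ ∧ τ < min τ₀ h := exists_between (lt_min hτ₀ hh)
  have hτ1 : τ < τ₀ := hτ.trans_le (min_le_left _ _)
  have hτh : τ < h := hτ.trans_le (min_le_right _ _)
  set Q := convexHull ℝ (ball y τ ∪ Z) with hQ
  have hQo : IsOpen Q := (isOpen_ball.union isOpen_ball).convexHull
  have hyQ : y ∈ Q := subset_convexHull ℝ _ (Or.inl (mem_ball_self hτ0))
  have hZQ : Z ⊆ Q := subset_union_right.trans (subset_convexHull ℝ _)
  have hQΩ : Q ⊆ Ω := by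
    rw [hQ, convexHull_union ⟨y, mem_ball_self hτ0⟩ ⟨_, mem_ball_self hh⟩,
      (convex_ball y τ).convexHull_eq, (convex_ball _ h).convexHull_eq]
    intro w hw
    obtain ⟨a, ha, z, hz, hw⟩ := mem_convexJoin.1 hw
    rw [segment_eq_image'] at hw
    obtain ⟨t, ht, rfl⟩ := hw
    refine hjoin a (hτ₀Ω (ball_subset_ball hτ1.le ha)) ?_ z hz t ht.1 ht.2
    have := dist_triangle a y x
    have := mem_ball.1 ha
    linarith
  have hQD : Q ⊆ closedBall y ((A + S + 2) * h) := by
    refine convexHull_min (union_subset ?_ ?_) (convex_closedBall _ _)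
    · exact ball_subset_closedBall.trans (closedBall_subset_closedBall (by nlinarith))
    · refine ball_subset_closedBall.trans (closedBall_subset_closedBall' ?_)
      have h1 : dist (x + (S * h) • e) x = S * h := by
        rw [dist_self_add_left, norm_smul, hcone.1, mul_one, Real.norm_of_nonneg hSh.le]
      have := dist_triangle (x + (S * h) • e) x y
      rw [dist_comm x y] at this
      nlinarith
  refine (hmain hG hQo (convex_convexHull ℝ _) hQΩ hyQ (by positivity) hQD isOpen_ball.measurableSet
    hZQ (measure_ball_pos _ _ hh).ne' hv).trans ?_
  rw [← mul_assoc, volume_ball_eq _ hh.le, ← ENNReal.ofReal_inv_of_pos (by positivity),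
    ← ENNReal.ofReal_mul (by positivity)]
  refine mul_le_mul' (le_of_eq ?_) (pot_mono G (subset_inter hQΩ hQD) y)
  congr 1
  field_simp

/-- Hölder's inequality for the truncated Riesz potential, integrated against a measure with bounded
density. -/
theorem exists_lintegral_pot_truncated_le {p : ℝ} (hp : 1 < p) :
    ∃ C : ℝ, 0 ≤ C ∧ ∀ {Ω : Set E} {M : ℝ} {μ : Measure E}, 0 ≤ M → HasDensityLE Ω M μ →
      IsProbabilityMeasure μ → ∀ {G : E → ℝ≥0∞}, Measurable G → ∀ {D : ℝ}, 0 < D →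
      ∫⁻ y, pot G (Ω ∩ closedBall y D) y ∂μ ≤
        ENNReal.ofReal (C * M ^ (1 / p) * D) * lpNorm p G Ω := by
  obtain ⟨q, hpq⟩ : ∃ q, p.HolderConjugate q := ⟨_, Real.HolderConjugate.conjExponent hp⟩
  have hp0 : 0 < p := hpq.pos
  have hq0 : 0 < q := hpq.symm.pos
  have hinv : 1 / p + 1 / q = 1 := by
    simpa only [one_div] using hpq.inv_add_inv_eq_one
  obtain ⟨C, hC, hker⟩ := lintegral_volume_kern_closedBall_le (β := 2) (by norm_num) (by norm_num)
  refine ⟨C, hC, fun {Ω M μ} hM hμ hprob {G} hG {D} hD => ?_⟩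
  -- the truncated kernel
  set T : Set (E × E) := {w | dist w.2 w.1 ≤ D} with hT
  have hTm : MeasurableSet T := (isClosed_le (by fun_prop) continuous_const).measurableSet
  set k : ℝ → E × E → ℝ≥0∞ := fun β => T.indicator fun w => kern β w.1 w.2 with hk
  have hkm : ∀ β, Measurable (k β) := fun β => (measurable_kern_uncurry β).indicator hTm
  have hk' : ∀ y, k 2 ∘ Prod.mk y = (closedBall y D).indicator (kern 2 y) := fun y => by
    ext z
    simp [hk, hT, indicator, mem_closedBall]
  have hksymm : ∀ z y, k 2 (y, z) = (closedBall z D).indicator (kern 2 z) y := fun z y => by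
    simp [hk, hT, indicator, mem_closedBall, dist_comm z y, kern_comm 2 z y]
  have hkint : ∀ y, ∫⁻ z in Ω, (closedBall y D).indicator (kern 2 y) z ≤
      ENNReal.ofReal (C * D) := by
    intro y
    refine (setLIntegral_le_lintegral _ _).trans ?_
    rw [lintegral_indicator isClosed_closedBall.measurableSet]
    refine (hker y D hD).trans (le_of_eq ?_)
    norm_num
  set θ := μ.prod (volume.restrict Ω) with hθ
  have hGm : Measurable fun w : E × E => G w.2 := hG.comp measurable_snd
  have hf : Measurable fun w : E × E => G w.2 * k (2 / p) w := hGm.mul (hkm _)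
  have hg := hkm (2 / q)
  have hsplit : ∀ w, k (2 / p) w * k (2 / q) w = k 2 w := fun w => by
    by_cases hw : w ∈ T
    · simp only [hk, indicator_of_mem hw]
      rw [← kern_add (by positivity) (by positivity)]
      congr 1
      linear_combination 2 * hinv
    · simp only [hk, indicator_of_notMem hw, mul_zero]
  have hpow : ∀ {s : ℝ}, 0 < s → ∀ w, k (2 / s) w ^ s = k 2 w := fun {s} hs w => by
    by_cases hw : w ∈ T
    · simp only [hk, indicator_of_mem hw, kern_rpow]
      rw [div_mul_cancel₀ _ hs.ne']
    · simp only [hk, indicator_of_notMem hw, ENNReal.zero_rpow_of_pos hs]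
  have e1 : ∫⁻ y, pot G (Ω ∩ closedBall y D) y ∂μ =
      ∫⁻ w, ((fun w : E × E => G w.2 * k (2 / p) w) * k (2 / q)) w ∂θ := by
    rw [hθ, lintegral_prod _ (hf.mul hg).aemeasurable]
    refine lintegral_congr fun y => ?_
    have : ∀ z, ((fun w : E × E => G w.2 * k (2 / p) w) * k (2 / q)) (y, z) =
        (closedBall y D).indicator (fun z => G z * kern 2 y z) z := fun z => by
      rw [Pi.mul_apply, mul_assoc, hsplit, ← Function.comp_apply (f := k 2), hk',
        indicator_mul_right]
    simp only [this]
    rw [lintegral_indicator isClosed_closedBall.measurableSet,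
      Measure.restrict_restrict isClosed_closedBall.measurableSet, inter_comm, pot]
  have f1 : ∫⁻ w, (G w.2 * k (2 / p) w) ^ p ∂θ ≤
      ENNReal.ofReal (M * (C * D)) * ∫⁻ z in Ω, G z ^ p := by
    rw [hθ, lintegral_prod_symm _ (hf.pow_const p).aemeasurable,
      ← lintegral_const_mul _ (hG.pow_const p)]
    refine lintegral_mono fun z => ?_
    have hm : Measurable ((closedBall z D).indicator (kern 2 z)) :=
      (measurable_kern 2 z).indicator isClosed_closedBall.measurableSet
    have : ∀ y, (G z * k (2 / p) (y, z)) ^ p =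
        G z ^ p * (closedBall z D).indicator (kern 2 z) y := fun y => by
      rw [ENNReal.mul_rpow_of_nonneg _ _ hp0.le, hpow hp0, hksymm]
    simp only [this]
    rw [lintegral_const_mul _ hm, mul_comm, ENNReal.ofReal_mul hM]
    refine mul_le_mul_left ((lintegral_mono' hμ le_rfl).trans ?_) _
    rw [lintegral_smul_measure, smul_eq_mul]
    exact mul_le_mul_right (hkint z) _
  have f2 : ∫⁻ w, k (2 / q) w ^ q ∂θ ≤ ENNReal.ofReal (C * D) := by
    rw [hθ, lintegral_prod _ (hg.pow_const q).aemeasurable]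
    calc _ ≤ ∫⁻ _y, ENNReal.ofReal (C * D) ∂μ := by
          refine lintegral_mono fun y => ?_
          simp only [hpow hq0]
          exact (le_of_eq (lintegral_congr fun z => congrFun (hk' y) z)).trans (hkint y)
      _ = _ := by simp
  rw [e1]
  refine (ENNReal.lintegral_mul_le_Lp_mul_Lq θ hpq hf.aemeasurable hg.aemeasurable).trans ?_
  calc _ ≤ (ENNReal.ofReal (M * (C * D)) * ∫⁻ z in Ω, G z ^ p) ^ (1 / p) *
        (ENNReal.ofReal (C * D)) ^ (1 / q) := by gcongr
    _ = _ := by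
        rw [ENNReal.mul_rpow_of_nonneg _ _ (by positivity), ← lpNorm, mul_right_comm,
          ENNReal.ofReal_rpow_of_nonneg (by positivity) (by positivity),
          ENNReal.ofReal_rpow_of_nonneg (by positivity) (by positivity),
          ← ENNReal.ofReal_mul (by positivity)]
        congr 2
        have hCD : 0 ≤ C * D := by positivity
        rw [Real.mul_rpow hM hCD, mul_assoc, ← Real.rpow_add_of_nonneg hCD (by positivity)
          (by positivity), hinv, Real.rpow_one]
        ring

/-! ### Transport of measures with bounded density -/

/-- The average of the probability measures `μ i` has density at most `M` on `Ω`, and `μ i` is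
carried by the ball around `X i` of radius `A N^{-1/3}`. -/
structure IsSpread (Ω : Set E) (A M : ℝ) {N : ℕ} (X : Fin N → E) (μ : Fin N → Measure E) :
    Prop where
  prob : ∀ i, IsProbabilityMeasure (μ i)
  ae_dist_le : ∀ i, ∀ᵐ y ∂(μ i), dist y (X i) ≤ A * scale N
  density : HasDensityLE Ω M (avgMeasure μ)

theorem IsSpread.mono {Ω : Set E} {A M A' M' : ℝ} {N : ℕ} {X : Fin N → E} {μ : Fin N → Measure E}
    (h : IsSpread Ω A M X μ) (hN : 0 < N) (hA : A ≤ A') (hM : M ≤ M') : IsSpread Ω A' M' X μ := by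
  have hs := scale_pos hN
  refine ⟨h.prob, fun i => (h.ae_dist_le i).mono fun y hy => hy.trans (by gcongr),
    h.density.trans (Measure.le_iff'.2 fun s => ?_)⟩
  simp only [Measure.smul_apply, smul_eq_mul]
  exact mul_le_mul_left (ENNReal.ofReal_le_ofReal hM) _

theorem of_ae_avgMeasure {N : ℕ} {μ : Fin N → Measure E} {P : E → Prop}
    (h : ∀ᵐ x ∂(avgMeasure μ), P x) (i : Fin N) : ∀ᵐ x ∂(μ i), P x := by
  rw [avgMeasure, Measure.ae_ennreal_smul_measure_iff
    (ENNReal.inv_ne_zero.2 (ENNReal.natCast_ne_top N)), ← Measure.sum_fintype,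
    Measure.ae_sum_iff] at h
  exact h i

theorem integrable_of_avgMeasure {N : ℕ} {μ : Fin N → Measure E} {f : E → ℝ}
    (h : Integrable f (avgMeasure μ)) (i : Fin N) : Integrable f (μ i) := by
  have hN : 0 < N := i.pos
  rw [avgMeasure, integrable_smul_measure (ENNReal.inv_ne_zero.2 (ENNReal.natCast_ne_top N))
    (ENNReal.inv_ne_top.2 (by exact_mod_cast hN.ne'))] at h
  exact integrable_finsetSum_measure.1 h i (Finset.mem_univ i)

theorem lintegral_avgMeasure {N : ℕ} (μ : Fin N → Measure E) (f : E → ℝ≥0∞) :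
    ∫⁻ x, f x ∂(avgMeasure μ) = (N : ℝ≥0∞)⁻¹ * ∑ i, ∫⁻ x, f x ∂(μ i) := by
  rw [avgMeasure, lintegral_smul_measure, lintegral_finsetSum_measure, smul_eq_mul]

/-- For many particles, the integral against a spread measure is close to the mean of the averages
over balls inside the interior cones at the particles. -/
theorem exists_integral_sub_cone_average_le {p : ℝ} (hp : 1 < p) {κ A M : ℝ} (hκ : 0 < κ)
    (hA : 0 ≤ A) (hM : 0 ≤ M) :
    ∃ C S : ℝ, 0 ≤ C ∧ 0 < S ∧ ∀ {Ω : Set E}, IsOpen Ω → ∀ {δ : ℝ} {N : ℕ}, 0 < N →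
      (A + S + 1) * scale N < δ → ∀ {X : Fin N → E} {e : Fin N → E},
      (∀ i, HasInteriorCone Ω (X i) δ κ (e i)) → (∀ i, X i ∈ Ω) →
      ∀ {μ : Fin N → Measure E}, IsSpread Ω A M X μ →
      ∀ v, MemSobolev Ω (ENNReal.ofReal p) 1 v → sobolevNorm Ω (ENNReal.ofReal p) 1 v ≤ 1 →
      ‖(∫ x, preciseRep v x ∂(avgMeasure μ)) - (N : ℝ)⁻¹ *
          ∑ i, ⨍ z in ball (X i + (S * scale N) • e i) (scale N), v z‖ₑ ≤
        ENNReal.ofReal (C * scale N) := by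
  obtain ⟨C, S, D, hC, hS, hD, hcone⟩ := exists_enorm_preciseRep_sub_average_cone_le hκ hA
  obtain ⟨C', hC', hpot⟩ := exists_lintegral_pot_truncated_le hp
  refine ⟨C * (C' * M ^ (1 / p) * D), S, by positivity, hS, ?_⟩
  intro Ω hΩ δ N hN hδ X e he hX μ hμ v hv hv1
  have hs := scale_pos hN
  have hprob := hμ.prob
  have := isProbabilityMeasure_avgMeasure hN hprob
  obtain ⟨G, hG, hfin, hle⟩ := hv.exists_gradBound hp
  have hint := (hμ.density.actsOnSobolev hΩ hp 1 v hv).2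
  have hΩae : ∀ᵐ y ∂(avgMeasure μ), y ∈ Ω := hμ.density.ae (ae_restrict_mem hΩ.measurableSet)
  rw [integral_avgMeasure fun i => integrable_of_avgMeasure hint i]
  refine (enorm_avg_sub_avg_le _ _ (B := fun i => ∫⁻ y, ENNReal.ofReal C *
    pot G (Ω ∩ closedBall y (D * scale N)) y ∂(μ i)) fun i => ?_).trans ?_
  · obtain ⟨hZ, hest⟩ := hcone hΩ hG (he i) hs hδ (hX i)
    have hvZ := (integrable_unif hZ (measure_ball_pos _ _ hs).ne' measure_ball_lt_top.ne hp
      hv.memLp).1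
    have e1 : (∫ x, preciseRep v x ∂(μ i)) -
        ⨍ z in ball (X i + (S * scale N) • e i) (scale N), v z =
        ∫ x, (preciseRep v x -
          ⨍ z in ball (X i + (S * scale N) • e i) (scale N), v z) ∂(μ i) := by
      rw [integral_sub (integrable_of_avgMeasure hint i) (integrable_const _), integral_const,
        probReal_univ, one_smul]
    rw [e1]
    refine (enorm_integral_le_lintegral_enorm _).trans (lintegral_mono_ae ?_)
    filter_upwards [of_ae_avgMeasure hΩae i, hμ.ae_dist_le i] with y hy hyX
    exact hest hvZ y hy hyX
  · rw [← lintegral_avgMeasure, lintegral_const_mul' _ _ ENNReal.ofReal_ne_top]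
    calc _ ≤ ENNReal.ofReal C *
        (ENNReal.ofReal (C' * M ^ (1 / p) * (D * scale N)) * 1) := by
          refine mul_le_mul_right ((hpot hM hμ.density this hG.meas (by positivity)).trans ?_) _
          exact mul_le_mul_right (hle.trans hv1) _
      _ = _ := by
          rw [mul_one, ← ENNReal.ofReal_mul hC.le]
          congr 1
          ring

/-- Two spread measures that assign the same mass to each particle are close: both are compared with
the same averages over balls in the interior cones.  This is needed only for many particles; for
the others the measures are bounded separately. -/
theorem IsC2Domain.exists_enorm_integral_sub_le {p : ℝ} (hp : 1 < p) {Ω K : Set E}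
    (hΩ : IsC2Domain Ω) (hK : IsCompact K) {A M : ℝ} (hA : 0 ≤ A) (hM : 0 ≤ M) :
    ∃ C : ℝ, 0 ≤ C ∧ ∀ {N : ℕ}, 0 < N → ∀ {X : Fin N → E}, (∀ i, X i ∈ K) → (∀ i, X i ∈ Ω) →
      ∀ {μ ν : Fin N → Measure E}, IsSpread Ω A M X μ → IsSpread Ω A M X ν →
      ∀ v, MemSobolev Ω (ENNReal.ofReal p) 1 v → sobolevNorm Ω (ENNReal.ofReal p) 1 v ≤ 1 →
      ‖(∫ x, preciseRep v x ∂(avgMeasure μ)) - ∫ x, preciseRep v x ∂(avgMeasure ν)‖ₑ ≤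
        ENNReal.ofReal (C * scale N) := by
  obtain ⟨δ, hδ, κ, hκ, hcone⟩ := hΩ.exists_hasInteriorCone hK
  obtain ⟨C, S, hC, hS, h⟩ := exists_integral_sub_cone_average_le hp hκ hA hM
  have hp0 : 0 < p := by linarith
  have hS' : 0 < A + S + 1 := by positivity
  refine ⟨C + C + (M ^ (1 / p) + M ^ (1 / p)) * ((A + S + 1) / δ), by positivity, ?_⟩
  intro N hN X hXK hXΩ μ ν hμ hν v hv hv1
  have hs := scale_pos hN
  rcases lt_or_ge ((A + S + 1) * scale N) δ with hlt | hge
  · choose e he using fun i => hcone (X i) (hXK i)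
    have h1 := h hΩ.1 hN hlt he hXΩ hμ v hv hv1
    have h2 := h hΩ.1 hN hlt he hXΩ hν v hv hv1
    set m := (N : ℝ)⁻¹ * ∑ i, ⨍ z in ball (X i + (S * scale N) • e i) (scale N), v z
    rw [← edist_eq_enorm_sub] at h1 h2 ⊢
    refine (edist_triangle_right _ _ m).trans ((add_le_add h1 h2).trans ?_)
    rw [← ENNReal.ofReal_add (by positivity) (by positivity), ← add_mul]
    exact ENNReal.ofReal_le_ofReal
      (mul_le_mul_of_nonneg_right (le_add_of_nonneg_right (by positivity)) hs.le)
  · have hb : ∀ {μ : Fin N → Measure E}, IsSpread Ω A M X μ →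
        ‖∫ x, preciseRep v x ∂(avgMeasure μ)‖ₑ ≤ ENNReal.ofReal (M ^ (1 / p)) := by
      intro μ hμ
      have := isProbabilityMeasure_avgMeasure hN hμ.prob
      refine (hμ.density.enorm_integral_preciseRep_le hΩ.1 hp hv.memLp).trans ?_
      rw [ENNReal.ofReal_rpow_of_nonneg hM (by positivity)]
      exact mul_le_of_le_one_right' ((eLpNorm_le_sobolevNorm _ _ _ _).trans hv1)
    refine enorm_sub_le.trans ((add_le_add (hb hμ) (hb hν)).trans ?_)
    rw [← ENNReal.ofReal_add (by positivity) (by positivity)]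
    refine ENNReal.ofReal_le_ofReal ?_
    have h1 : 1 ≤ (A + S + 1) / δ * scale N := by
      rw [div_mul_eq_mul_div, one_le_div hδ]; exact hge
    calc M ^ (1 / p) + M ^ (1 / p)
        ≤ (M ^ (1 / p) + M ^ (1 / p)) * ((A + S + 1) / δ * scale N) :=
          le_mul_of_one_le_right (by positivity) h1
      _ = (M ^ (1 / p) + M ^ (1 / p)) * ((A + S + 1) / δ) * scale N := by ring
      _ ≤ _ := by
          exact mul_le_mul_of_nonneg_right (le_add_of_nonneg_left (by positivity)) hs.le

/-! ### The limit density -/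

theorem isProbabilityMeasure_densityMeasure {Ω : Set E} {n : E → ℝ} (hn : IsBoundedDensity Ω n) :
    IsProbabilityMeasure (densityMeasure Ω n) := by
  refine ⟨?_⟩
  rw [densityMeasure, withDensity_apply _ MeasurableSet.univ, Measure.restrict_univ, hn.2.2]

theorem IsBoundedDensity.exists_hasDensityLE {Ω : Set E} {n : E → ℝ} (hn : IsBoundedDensity Ω n) :
    ∃ M : ℝ, 0 ≤ M ∧ HasDensityLE Ω M (densityMeasure Ω n) := by
  refine ⟨(eLpNorm n ∞ (volume.restrict Ω)).toReal, ENNReal.toReal_nonneg, ?_⟩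
  rw [HasDensityLE, ENNReal.ofReal_toReal hn.1.2.ne, densityMeasure, ← withDensity_const]
  refine withDensity_mono ?_
  filter_upwards [ae_le_eLpNormEssSup (f := n) (μ := volume.restrict Ω)] with x hx
  rw [eLpNorm_exponent_top]
  exact (Real.ofReal_le_enorm _).trans hx

/-- A nearly optimal coupling splits the limit density into the parts transported to each
particle. -/
theorem IsCloseTo.exists_split {Ω : Set E} {n : E → ℝ} {N : ℕ} {C₀ : ℝ} {X : Fin N → E}
    (hN : 0 < N) (hC₀ : 0 < C₀) (hinj : Function.Injective X) (h : IsCloseTo Ω n N C₀ X) :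
    ∃ ν : Fin N → Measure E, (∀ i, IsProbabilityMeasure (ν i)) ∧
      (∀ i, ∀ᵐ y ∂(ν i), dist y (X i) ≤ 2 * C₀ * scale N) ∧
      avgMeasure ν = densityMeasure Ω n := by
  have hs := scale_pos hN
  have hN0 : (N : ℝ≥0∞) ≠ 0 := by exact_mod_cast hN.ne'
  have hNt : (N : ℝ≥0∞) ≠ ⊤ := ENNReal.natCast_ne_top N
  -- the infimum need not be attained, hence the factor `2`
  have hlt : wassersteinInfty (empiricalMeasure N X) (densityMeasure Ω n) <
      ENNReal.ofReal (2 * C₀ * scale N) :=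
    lt_of_le_of_lt h ((ENNReal.ofReal_lt_ofReal_iff (by positivity)).2
      (by nlinarith [mul_pos hC₀ hs]))
  simp only [wassersteinInfty, iInf_lt_iff] at hlt
  obtain ⟨π, h1, h2, h3⟩ := hlt
  have hdist : ∀ᵐ z ∂π, dist z.2 z.1 ≤ 2 * C₀ * scale N := by
    filter_upwards [ae_lt_of_essSup_lt h3] with z hz
    rw [edist_dist, ENNReal.ofReal_lt_ofReal_iff (by positivity), dist_comm] at hz
    exact hz.le
  set A : Fin N → Set (E × E) := fun i => Prod.fst ⁻¹' {X i} with hA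
  have hAm : ∀ i, MeasurableSet (A i) := fun i => measurable_fst (measurableSet_singleton _)
  have hmass : ∀ i, π (A i) = (N : ℝ≥0∞)⁻¹ := fun i => by
    rw [hA, ← Measure.map_apply measurable_fst (measurableSet_singleton _), h1, empiricalMeasure,
      Measure.smul_apply, Measure.finsetSum_apply, Finset.sum_eq_single i]
    · simp
    · intro j _ hj
      simp [hinj.ne hj]
    · simp
  have hmem : ∀ᵐ z ∂π, z ∈ ⋃ i, A i := by
    have h0 : empiricalMeasure N X (range X)ᶜ = 0 := by
      simp [empiricalMeasure, (finite_range X).measurableSet]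
    rw [← h1, Measure.map_apply measurable_fst (finite_range X).measurableSet.compl] at h0
    refine (measure_eq_zero_iff_ae_notMem.1 h0).mono fun z hz => ?_
    obtain ⟨i, hi⟩ := not_not.1 hz
    exact mem_iUnion.2 ⟨i, hi.symm⟩
  have hsum : ∑ i, π.restrict (A i) = π := by
    have hd : Pairwise (Function.onFun Disjoint A) := fun i j hij =>
      Disjoint.preimage _ (disjoint_singleton.2 (hinj.ne hij))
    rw [← Measure.sum_fintype, ← Measure.restrict_iUnion hd hAm,
      Measure.restrict_eq_self_of_ae_mem hmem]
  refine ⟨fun i => (N : ℝ≥0∞) • (π.restrict (A i)).map Prod.snd, fun i => ⟨?_⟩, fun i => ?_, ?_⟩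
  · rw [Measure.smul_apply, Measure.map_apply measurable_snd MeasurableSet.univ, preimage_univ,
      Measure.restrict_apply_univ, hmass, smul_eq_mul, ENNReal.mul_inv_cancel hN0 hNt]
  · refine Measure.ae_smul_measure ?_ _
    refine (ae_map_iff measurable_snd.aemeasurable
      (isClosed_le (by fun_prop) continuous_const).measurableSet).2 ?_
    filter_upwards [ae_restrict_mem (hAm i), ae_restrict_of_ae hdist] with z hz hz'
    rwa [show z.1 = X i from hz] at hz'
  · rw [avgMeasure, ← Finset.smul_sum, smul_smul, ENNReal.inv_mul_cancel hN0 hNt, one_smul, ← h2]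
    conv_rhs => rw [← hsum]
    ext s hs
    simp only [Measure.finsetSum_apply, Measure.map_apply measurable_snd hs]

/-- Packing of disjoint balls in a ball. -/
theorem card_mul_pow_three_le {ι : Type*} (s : Finset ι) {X : ι → E} {x : E} {R t : ℝ} (ht : 0 ≤ t)
    (hR : 0 ≤ R) (hX : ∀ i ∈ s, dist (X i) x ≤ R)
    (hd : ∀ i ∈ s, ∀ j ∈ s, i ≠ j → Disjoint (ball (X i) t) (ball (X j) t)) :
    s.card * t ^ 3 ≤ (R + t) ^ 3 := by
  have hu := unitVol_pos
  have h1 : volume (⋃ i ∈ s, ball (X i) t) ≤ volume (ball x (R + t)) := by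
    refine measure_mono (iUnion₂_subset fun i hi => ball_subset_ball' ?_)
    linarith [hX i hi]
  rw [measure_biUnion_finset (fun i hi j hj hij => hd i hi j hj hij) fun i _ =>
    isOpen_ball.measurableSet, volume_ball_eq _ (by positivity)] at h1
  simp only [volume_ball_eq _ ht, Finset.sum_const, nsmul_eq_mul] at h1
  rw [← ENNReal.ofReal_natCast, ← ENNReal.ofReal_mul (by positivity),
    ENNReal.ofReal_le_ofReal_iff (by positivity)] at h1
  nlinarith

theorem tendsto_scale : Tendsto scale atTop (𝓝[>] 0) := by
  refine tendsto_nhdsWithin_iff.2 ⟨?_, ?_⟩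
  · exact (tendsto_rpow_neg_atTop (by norm_num : (0 : ℝ) < 1 / 3)).comp tendsto_natCast_atTop_atTop
  · filter_upwards [eventually_gt_atTop 0] with N hN using scale_pos hN

/-- By the Lebesgue differentiation theorem, a density is bounded if its averages over balls of
certain radii tending to zero are. -/
theorem hasDensityLE_densityMeasure_of_frequently {Ω : Set E} {n : E → ℝ} (hΩ : IsOpen Ω)
    (hn : IsBoundedDensity Ω n) {P : ℝ} (h : ∃ᶠ N in atTop, ∀ x,
      densityMeasure Ω n (closedBall x (scale N)) ≤
        ENNReal.ofReal P * volume (closedBall x (scale N))) :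
    HasDensityLE Ω P (densityMeasure Ω n) := by
  have := isProbabilityMeasure_densityMeasure hn
  set ρ := densityMeasure Ω n with hρ
  have hac : ρ ≪ volume :=
    (withDensity_absolutelyContinuous _ _).trans Measure.restrict_le_self.absolutelyContinuous
  have hle : ∀ᵐ x ∂(volume : Measure E), ρ.rnDeriv volume x ≤ ENNReal.ofReal P := by
    filter_upwards [Besicovitch.ae_tendsto_rnDeriv ρ (volume : Measure E)] with x hx
    refine isClosed_Iic.mem_of_frequently_of_tendsto ?_ (hx.comp tendsto_scale)
    refine (h.and_eventually (eventually_gt_atTop 0)).mono fun N hN => ?_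
    exact ENNReal.div_le_of_le_mul (hN.1 x)
  have hvol : ρ ≤ ENNReal.ofReal P • volume := by
    rw [← Measure.withDensity_rnDeriv_eq ρ volume hac, ← withDensity_const]
    exact withDensity_mono hle
  have hres : ρ.restrict Ω = ρ := by
    rw [hρ, densityMeasure, restrict_withDensity hΩ.measurableSet, Measure.restrict_restrict
      hΩ.measurableSet, inter_self]
  calc ρ = ρ.restrict Ω := hres.symm
    _ ≤ (ENNReal.ofReal P • volume).restrict Ω := Measure.restrict_mono le_rfl hvol
    _ = _ := Measure.restrict_smul _ _ _

/-- A ball of radius `N^{-1/3}` contains a bounded number of particles, so that a density close to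
the empirical measure gives it a mass of order at most `N⁻¹`. -/
theorem densityMeasure_closedBall_scale_le {Ω : Set E} {n : E → ℝ} {N : ℕ} {C₀ c : ℝ}
    {X : Fin N → E} (hN : 0 < N) (hC₀ : 0 < C₀) (hc : 0 < c) (hinj : Function.Injective X)
    (hX : IsSeparated Ω N c X) (h : IsCloseTo Ω n N C₀ X) (x : E) :
    densityMeasure Ω n (closedBall x (scale N)) ≤
      ENNReal.ofReal (((1 + 2 * C₀ + c / 2) / (c / 2)) ^ 3 / unitVol) *
        volume (closedBall x (scale N)) := by
  classical
  obtain ⟨ν, hprob, hdist, hν⟩ := h.exists_split hN hC₀ hinj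
  have hs := scale_pos hN
  have hu := unitVol_pos
  set s : Finset (Fin N) := Finset.univ.filter fun i => dist (X i) x ≤ (1 + 2 * C₀) * scale N
    with hsdef
  have hcard : (s.card : ℝ) ≤ ((1 + 2 * C₀ + c / 2) / (c / 2)) ^ 3 := by
    have := card_mul_pow_three_le s (X := X) (x := x) (R := (1 + 2 * C₀) * scale N)
      (t := c / 2 * scale N) (by positivity) (by positivity)
      (fun i hi => (Finset.mem_filter.1 hi).2) fun i _ j _ hij =>
        ball_disjoint_ball (by linarith [hX.1 i j hij])
    rw [← add_mul, mul_pow, mul_pow, ← mul_assoc] at this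
    rw [div_pow, le_div_iff₀ (by positivity)]
    exact le_of_mul_le_mul_right this (by positivity)
  have hνi : ∀ i, ν i (closedBall x (scale N)) ≤ if i ∈ s then 1 else 0 := fun i => by
    have := hprob i
    split_ifs with hi
    · exact prob_le_one
    · refine le_of_eq (measure_eq_zero_iff_ae_notMem.2 ((hdist i).mono fun y hy' hy => hi ?_))
      rw [hsdef, Finset.mem_filter]
      refine ⟨Finset.mem_univ i, ?_⟩
      have h1 := dist_triangle_left (X i) x y
      have h2 : dist y x ≤ scale N := hy
      have h3 : dist y (X i) ≤ 2 * C₀ * scale N := hy'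
      linarith
  rw [← hν, avgMeasure, Measure.smul_apply, Measure.finsetSum_apply, smul_eq_mul,
    volume_closedBall_eq _ hs.le, ← ENNReal.ofReal_mul (by positivity)]
  have hN' : (0 : ℝ) < N := by exact_mod_cast hN
  calc (N : ℝ≥0∞)⁻¹ * ∑ i, ν i (closedBall x (scale N)) ≤ (N : ℝ≥0∞)⁻¹ * s.card := by
        refine mul_le_mul_right ((Finset.sum_le_sum fun i _ => hνi i).trans (le_of_eq ?_)) _
        simp
    _ = ENNReal.ofReal ((N : ℝ)⁻¹ * s.card) := by
        rw [ENNReal.ofReal_mul (by positivity), ENNReal.ofReal_inv_of_pos hN',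
          ENNReal.ofReal_natCast, ENNReal.ofReal_natCast]
    _ ≤ _ := by
        refine ENNReal.ofReal_le_ofReal ?_
        rw [scale_pow_three hN]
        calc (N : ℝ)⁻¹ * s.card ≤ (N : ℝ)⁻¹ * ((1 + 2 * C₀ + c / 2) / (c / 2)) ^ 3 := by gcongr
          _ = _ := by field_simp

theorem IsConfiguration.injective {Ω : Set E} {N : ℕ} {r : ℝ} {X : Fin N → E}
    (h : IsConfiguration Ω N r X) : Function.Injective X := by
  intro i j hij
  by_contra hne
  have hR : 0 ≤ r * scale N := (mul_pos h.pos_r (scale_pos h.pos_N)).le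
  refine (Set.disjoint_left.1 (h.disjoint i j hne)) (mem_closedBall_self hR) ?_
  rw [hij]
  exact mem_closedBall_self hR

/-- Comparison of `σ_N` and `n`. -/
theorem exists_dualDistLE_cubeMeasure_densityMeasure {p : ℝ} (hp : 1 < p) {Ω K : Set E}
    (hΩ : IsContainer Ω) (hK : IsCompact K) {C₀ c C₁ : ℝ} (hC₀ : 0 < C₀) (hc : 0 < c)
    (hC₁ : 0 < C₁) : ∃ C : ℝ,
      ∀ (n : E → ℝ), IsBoundedDensity Ω n → ∀ (I : Set ℕ), I.Infinite →
      ∀ (r : ℝ) (X : (N : ℕ) → Fin N → E) (Q : (N : ℕ) → Fin N → Set E),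
        (∀ N ∈ I, IsConfiguration Ω N r (X N) ∧ IsCubeFamily Ω N r C₁ (X N) (Q N) ∧
          IsSeparated Ω N c (X N) ∧ IsCloseTo Ω n N C₀ (X N) ∧ ∀ i, X N i ∈ K) →
        ∀ N ∈ I, DualDistLE Ω 1 p (cubeMeasure N (Q N)) (densityMeasure Ω n)
          (C * (N : ℝ) ^ (-(1 / 3 : ℝ))) := by
  have hu := unitVol_pos
  set P := ((1 + 2 * C₀ + c / 2) / (c / 2)) ^ 3 / unitVol with hP
  obtain ⟨C, hC, hmain⟩ := hΩ.1.exists_enorm_integral_sub_le hp hK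
    (A := max (C₁ ^ (1 / 3 : ℝ)) (2 * C₀)) (M := max C₁ P) (by positivity) (by positivity)
  refine ⟨C, ?_⟩
  intro n hn I hI r X Q h N hN
  have hΩo := hΩ.1.1
  have := isProbabilityMeasure_densityMeasure hn
  have hden : HasDensityLE Ω P (densityMeasure Ω n) := by
    refine hasDensityLE_densityMeasure_of_frequently hΩo hn ?_
    refine (Nat.frequently_atTop_iff_infinite.2 hI).mono fun N hN => ?_
    obtain ⟨hX, -, hsep, hclose, -⟩ := h N hN
    exact densityMeasure_closedBall_scale_le hX.pos_N hC₀ hc hX.injective hsep hclose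
  obtain ⟨hX, hQ, hsep, hclose, hXK⟩ := h N hN
  obtain ⟨-, hσ, hσp⟩ := hQ.density hC₁ hX
  obtain ⟨ν, hprob, hdist, hν⟩ := hclose.exists_split hX.pos_N hC₀ hX.injective
  have hs := scale_pos hX.pos_N
  have hμ' : IsSpread Ω (C₁ ^ (1 / 3 : ℝ)) C₁ (X N) fun i => unif (Q N i) := by
    have hcell := fun i => hQ.isCell hC₁ hX i
    refine ⟨fun i => isProbabilityMeasure_unif (hcell i).1.volume_ne_zero
      (hcell i).1.volume_ne_top, fun i => ?_, hσ⟩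
    refine Measure.ae_smul_measure ?_ _
    filter_upwards [ae_restrict_mem (hcell i).1.isOpen.measurableSet] with y hy
    exact (hcell i).1.subset_closedBall hy
  have hν' : IsSpread Ω (2 * C₀) P (X N) ν := ⟨hprob, hdist, by rwa [hν]⟩
  refine dualDistLE_of_forall (hσ.actsOnSobolev hΩo hp 1) (hden.actsOnSobolev hΩo hp 1)
    fun v hv hv1 => ?_
  rw [← hν]
  exact hmain hX.pos_N hXK (fun i => hX.subset i (mem_closedBall_self
      (mul_pos hX.pos_r hs).le))
    (hμ'.mono hX.pos_N (le_max_left _ _) (le_max_left _ _))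
    (hν'.mono hX.pos_N (le_max_right _ _) (le_max_right _ _)) v hv hv1

/-! ### Surface measures and the limit density -/

theorem ball_subset_of_le_infDist_frontier {Ω : Set E} {x : E} {t : ℝ} (hx : x ∈ Ω)
    (ht : t ≤ infDist x (frontier Ω)) : ball x t ⊆ Ω := by
  intro y hy
  by_contra hyΩ
  have hpre : IsPreconnected (ball x t) := (convex_ball x t).isPreconnected
  obtain ⟨z, hz, hzf⟩ : (ball x t ∩ frontier Ω).Nonempty := by
    by_contra hne
    have hdis : ball x t ⊆ interior Ω ∪ (closure Ω)ᶜ := fun z hz => by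
      by_contra h
      rw [mem_union, not_or, mem_compl_iff, not_not] at h
      exact hne ⟨z, hz, h.2, h.1⟩
    have hxt : x ∈ ball x t := mem_ball_self (dist_nonneg.trans_lt hy)
    obtain ⟨z, -, hz1, hz2⟩ := hpre _ _ isOpen_interior isClosed_closure.isOpen_compl hdis
      ⟨x, hxt, (hdis hxt).resolve_right fun h => h (subset_closure hx)⟩
      ⟨y, hy, (hdis hy).resolve_left fun h => hyΩ (interior_subset h)⟩
    exact hz2 (interior_subset.trans subset_closure hz1)
  have h1 := infDist_le_dist_of_mem (x := x) hzf
  have h2 : dist z x < t := hz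
  rw [dist_comm] at h2
  linarith

/-- The radius of a ball inside a cylinder is at most that of the cylinder. -/
theorem radius_le_of_closedBall_subset_cylinder {Ω : Set E} {ξ : E} {L : ℝ}
    (hL : ∀ x ∈ Ω, infDist x (Submodule.span ℝ {ξ} : Set E) < L) {x : E} {R : ℝ} (hR : 0 ≤ R)
    (h : closedBall x R ⊆ Ω) : R ≤ L := by
  obtain ⟨u, hu, hu1⟩ : ∃ u ∈ (Submodule.span ℝ {ξ})ᗮ, ‖u‖ = 1 := by
    have h1 := Submodule.finrank_add_finrank_orthogonal (Submodule.span ℝ {ξ})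
    rw [finrank_euclideanSpace_fin] at h1
    have h2 : Module.finrank ℝ (Submodule.span ℝ {ξ}) ≤ 1 := by
      simpa using finrank_span_le_card (R := ℝ) ({ξ} : Set E)
    have : Nontrivial (Submodule.span ℝ {ξ})ᗮ :=
      Module.nontrivial_of_finrank_pos (R := ℝ) (by omega)
    obtain ⟨w, hw⟩ := exists_norm_eq (Submodule.span ℝ {ξ})ᗮ zero_le_one
    exact ⟨w, w.2, hw⟩
  have key : ∀ y ∈ Ω, |inner ℝ u y| < L := by
    intro y hy
    obtain ⟨z, hz, hyz⟩ := (infDist_lt_iff (Submodule.span ℝ {ξ}).nonempty).1 (hL y hy)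
    have h1 : inner ℝ u z = (0 : ℝ) := Submodule.inner_left_of_mem_orthogonal hz hu
    calc |inner ℝ u y| = |inner ℝ u (y - z)| := by rw [inner_sub_right, h1, sub_zero]
      _ ≤ ‖u‖ * ‖y - z‖ := abs_real_inner_le_norm u _
      _ < L := by rwa [hu1, one_mul, ← dist_eq_norm]
  have huu : inner ℝ u u = (1 : ℝ) := by rw [real_inner_self_eq_norm_sq, hu1, one_pow]
  have h1 := key (x + R • u) (h (by simp [norm_smul, hu1, abs_of_nonneg hR]))
  have h2 := key (x + (-R) • u) (h (by simp [norm_smul, hu1, abs_of_nonneg hR]))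
  rw [inner_add_right, inner_smul_right, huu, abs_lt] at h1 h2
  linarith [h1.2, h2.1]

/-- The balls around the particles may be enlarged to disjoint balls in `Ω` whose radii are of order
at least `N^{-1/3}`. -/
theorem IsConfiguration.exists_larger_radius {Ω : Set E} {N : ℕ} {r c : ℝ} {X : Fin N → E}
    (hΩ : IsOpen Ω) (hX : IsConfiguration Ω N r X) (hsep : IsSeparated Ω N c X) :
    ∃ a, r < a ∧ c / 2 ≤ a ∧ a ≤ max (c / 2) (2 * r) ∧
      (∀ i, ball (X i) (a * scale N) ⊆ Ω) ∧
      ∀ i j, i ≠ j → Disjoint (ball (X i) (a * scale N)) (ball (X j) (a * scale N)) := by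
  have hs := scale_pos hX.pos_N
  have hr := hX.pos_r
  rcases lt_or_ge r (c / 2) with hlt | hge
  · refine ⟨c / 2, hlt, le_rfl, le_max_left _ _, fun i => ?_, fun i j hij => ?_⟩
    · refine ball_subset_of_le_infDist_frontier
        (hX.subset i (mem_closedBall_self (mul_pos hr hs).le)) (le_trans ?_ (hsep.2 i))
      have := mul_pos (hr.trans hlt) hs
      linarith
    · exact ball_disjoint_ball (by linarith [hsep.1 i j hij])
  · have hcont : Tendsto (fun a : ℝ => a * scale N) (𝓝[>] r) (𝓝 (r * scale N)) :=
      ((continuous_mul_const (scale N)).tendsto r).mono_left nhdsWithin_le_nhds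
    have h1 : ∀ᶠ a in 𝓝[>] r, ∀ i, ball (X i) (a * scale N) ⊆ Ω := by
      refine eventually_all.2 fun i => ?_
      obtain ⟨δ, hδ, hδΩ⟩ :=
        (isCompact_closedBall (X i) (r * scale N)).exists_cthickening_subset_open
        hΩ (hX.subset i)
      rw [cthickening_closedBall hδ.le (mul_pos hr hs).le] at hδΩ
      filter_upwards [hcont.eventually (gt_mem_nhds
        (show r * scale N < δ + r * scale N by linarith))] with a ha
      exact (ball_subset_closedBall.trans (closedBall_subset_closedBall ha.le)).trans hδΩ
    have h2 : ∀ᶠ a in 𝓝[>] r, ∀ i j, i ≠ j →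
        Disjoint (ball (X i) (a * scale N)) (ball (X j) (a * scale N)) := by
      refine eventually_all.2 fun i => eventually_all.2 fun j => ?_
      by_cases hij : i = j
      · exact Eventually.of_forall fun a h => absurd hij h
      have hd := (disjoint_closedBall_closedBall_iff (mul_pos hr hs).le (mul_pos hr hs).le).1
        (hX.disjoint i j hij)
      filter_upwards [(hcont.add hcont).eventually (gt_mem_nhds hd)] with a ha _
      exact ball_disjoint_ball ha.le
    obtain ⟨a, h1, h2, h3⟩ := (h1.and (h2.and (Ioo_mem_nhdsGT
      (show r < 2 * r by linarith)))).exists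
    exact ⟨a, h3.1, hge.trans h3.1.le, h3.2.le.trans (le_max_right _ _), h1, h2⟩

theorem isCell_ball {Ω : Set E} {X : E} {R D : ℝ} (hR : 0 < R) (hRD : R < D) (h : ball X D ⊆ Ω) :
    IsCell Ω X R D unitVol⁻¹ (ball X D) := by
  have hu := unitVol_pos
  refine ⟨isOpen_ball, convex_ball _ _, h, ?_, ball_subset_closedBall, hR, hRD.le,
    by positivity, ?_⟩
  · filter_upwards [ae_mem_sphere_sphereProb X R] with x hx
    rw [mem_ball, mem_sphere.1 hx]
    exact hRD
  · rw [volume_ball_eq X (hR.trans hRD).le, ← ENNReal.ofReal_mul (by positivity),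
      inv_mul_cancel_left₀ hu.ne']

/-- A density that is close to a single configuration has bounded support. -/
theorem IsCloseTo.exists_ae_norm_le {Ω : Set E} {n : E → ℝ} {N : ℕ} {C₀ : ℝ} {X : Fin N → E}
    (hN : 0 < N) (hC₀ : 0 < C₀) (hinj : Function.Injective X) (h : IsCloseTo Ω n N C₀ X) :
    ∃ ϱ : ℝ, 0 ≤ ϱ ∧ ∀ᵐ y ∂(densityMeasure Ω n), ‖y‖ ≤ ϱ := by
  obtain ⟨ν, -, hdist, hν⟩ := h.exists_split hN hC₀ hinj
  have hs := scale_pos hN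
  refine ⟨2 * C₀ * scale N + ∑ i, ‖X i‖, by positivity, ?_⟩
  rw [← hν]
  refine ae_avgMeasure fun i => (hdist i).mono fun y hy => ?_
  have h1 : ‖X i‖ ≤ ∑ i, ‖X i‖ :=
    Finset.single_le_sum (f := fun i => ‖X i‖) (fun i _ => norm_nonneg _) (Finset.mem_univ i)
  have h2 : ‖y‖ ≤ dist y (X i) + ‖X i‖ := by
    rw [dist_eq_norm]
    exact norm_le_norm_sub_add _ _
  linarith

theorem IsCloseTo.norm_le {Ω : Set E} {n : E → ℝ} {N : ℕ} {C₀ ϱ : ℝ} {X : Fin N → E}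
    (hN : 0 < N) (hC₀ : 0 < C₀) (hinj : Function.Injective X) (h : IsCloseTo Ω n N C₀ X)
    (hϱ : ∀ᵐ y ∂(densityMeasure Ω n), ‖y‖ ≤ ϱ) (i : Fin N) : ‖X i‖ ≤ ϱ + 2 * C₀ := by
  obtain ⟨ν, hprob, hdist, hν⟩ := h.exists_split hN hC₀ hinj
  rw [← hν] at hϱ
  have := hprob i
  obtain ⟨y, hy, hyX⟩ := ((of_ae_avgMeasure hϱ i).and (hdist i)).exists
  have h1 : ‖X i‖ ≤ dist y (X i) + ‖y‖ := by
    rw [dist_comm, dist_eq_norm]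
    exact norm_le_norm_sub_add _ _
  have h2 : 2 * C₀ * scale N ≤ 2 * C₀ := mul_le_of_le_one_right (by positivity) (scale_le_one hN)
  linarith

/-- The total volume of the balls bounds `r`. -/
theorem IsConfiguration.radius_le {Ω : Set E} {N : ℕ} {r ϱ L : ℝ} {X : Fin N → E}
    (hX : IsConfiguration Ω N r X) (hϱ : 0 ≤ ϱ) (hnorm : ∀ i, ‖X i‖ ≤ ϱ)
    (hL : r * scale N ≤ L) : r ≤ ϱ + L := by
  have hs := scale_pos hX.pos_N
  have hr := hX.pos_r
  have hN : (0 : ℝ) < N := by exact_mod_cast hX.pos_N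
  have h := card_mul_pow_three_le Finset.univ (X := X) (x := 0) (R := ϱ) (t := r * scale N)
    (by positivity) hϱ (fun i _ => by simpa using hnorm i) fun i _ j _ hij =>
      (hX.disjoint i j hij).mono ball_subset_closedBall ball_subset_closedBall
  have hL0 : 0 < L := (mul_pos hr hs).trans_le hL
  refine le_of_pow_le_pow_left₀ (n := 3) (by norm_num) (by positivity) ?_
  rw [Finset.card_univ, Fintype.card_fin, mul_pow, scale_pow_three hX.pos_N] at h
  calc r ^ 3 = N * (r ^ 3 * (N : ℝ)⁻¹) := by field_simp
    _ ≤ (ϱ + r * scale N) ^ 3 := h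
    _ ≤ _ := by gcongr

/-- Comparison of `ρ̄_N` and `n`, with the averages over disjoint balls around the particles as an
intermediate measure. -/
theorem exists_dualDistLE_sphereMeasure_densityMeasure {p : ℝ} (hp : 1 < p) (hp3 : p ≠ 3)
    {Ω : Set E} (hΩ : IsContainer Ω) {n : E → ℝ} (hn : IsBoundedDensity Ω n) {C₀ c : ℝ}
    (hC₀ : 0 < C₀) (hc : 0 < c) : ∃ C : ℝ,
      ∀ (N : ℕ) (r : ℝ) (X : Fin N → E), IsConfiguration Ω N r X → IsSeparated Ω N c X →
        IsCloseTo Ω n N C₀ X →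
        DualDistLE Ω 1 p (sphereMeasure N r X) (densityMeasure Ω n)
          (C * r ^ (-(max (3 / p - 1) 0)) * (N : ℝ) ^ (-(1 / 3 : ℝ))) := by
  -- without an admissible configuration, `n` need not have bounded support, but then there is
  -- nothing to prove
  by_cases hex : ∃ (N : ℕ) (r : ℝ) (X : Fin N → E), IsConfiguration Ω N r X ∧ IsCloseTo Ω n N C₀ X
  swap
  · exact ⟨0, fun N r X hX _ h => absurd ⟨N, r, X, hX, h⟩ hex⟩
  obtain ⟨N₀, r₀, X₀, hX₀, hclose₀⟩ := hex
  obtain ⟨ϱ, hϱ, hsupp⟩ := hclose₀.exists_ae_norm_le hX₀.pos_N hC₀ hX₀.injective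
  obtain ⟨hC2, ξ, -, L, hL, hcyl⟩ := hΩ
  have hΩo := hC2.1
  have hu := unitVol_pos
  have hp0 : 0 < p := by linarith
  have := isProbabilityMeasure_densityMeasure hn
  obtain ⟨M, hM, hden⟩ := hn.exists_hasDensityLE
  -- `rmax` bounds the radii `r`, `amax` the enlarged radii, and `m` the density of the measure that
  -- is uniform on each of the enlarged balls
  obtain ⟨rmax, hrmax⟩ : ∃ rmax, rmax = ϱ + 2 * C₀ + L := ⟨_, rfl⟩
  have hrmax0 : 0 < rmax := by rw [hrmax]; positivity
  obtain ⟨amax, hamax⟩ : ∃ amax, amax = max (c / 2) (2 * rmax) := ⟨_, rfl⟩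
  have hamax0 : 0 < amax := by rw [hamax]; positivity
  obtain ⟨m, hm⟩ : ∃ m, m = (unitVol * (c / 2) ^ 3)⁻¹ := ⟨_, rfl⟩
  have hm0 : 0 ≤ m := by rw [hm]; positivity
  obtain ⟨B, hB, htransport⟩ := hC2.exists_enorm_integral_sub_le hp
    (isCompact_closedBall (0 : E) (ϱ + 2 * C₀))
    (A := max amax (2 * C₀)) (M := max m M) (by positivity) (by positivity)
  obtain ⟨A, hA, hfirst⟩ := exists_sphereMeasure_sub_cubeMeasure_le hp hp3
  obtain ⟨e, he⟩ : ∃ e, e = if p < 3 then 1 else amax ^ (1 - 3 / p) := ⟨_, rfl⟩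
  obtain ⟨β, hβ⟩ : ∃ β, β = max (3 / p - 1) 0 := ⟨_, rfl⟩
  have hβ0 : 0 ≤ β := hβ ▸ le_max_right _ _
  refine ⟨A * unitVol⁻¹ * e + B * rmax ^ β, ?_⟩
  intro N r X hX hsep hclose
  have hN := hX.pos_N
  have hs := scale_pos hN
  have hr := hX.pos_r
  have hN' : (0 : ℝ) < N := by exact_mod_cast hN
  have hnorm := hclose.norm_le hN hC₀ hX.injective hsupp
  have hrle : r ≤ rmax := by
    rw [hrmax]
    exact hX.radius_le (by positivity) hnorm (radius_le_of_closedBall_subset_cylinder hcyl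
      (mul_pos hr hs).le (hX.subset ⟨0, hN⟩))
  obtain ⟨a, hra, hca, hale, hsub, hdisj⟩ := hX.exists_larger_radius hΩo hsep
  have ha0 : 0 < a := hr.trans hra
  have haamax : a ≤ amax := by
    rw [hamax]
    exact hale.trans (max_le_max le_rfl (by linarith))
  have hcell : ∀ i, IsCell Ω (X i) (r * scale N) (a * scale N) unitVol⁻¹
      (ball (X i) (a * scale N)) := fun i =>
    isCell_ball (by positivity) (by gcongr) (hsub i)
  have hover := sum_restrict_le_of_disjoint (fun i => (hcell i).isOpen.measurableSet) hsub hdisj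
  have hσ := hasDensityLE_cubeMeasure hm0 hover fun i => by
    rw [volume_ball_eq _ (by positivity), ← ENNReal.ofReal_natCast, ← ENNReal.ofReal_inv_of_pos hN',
      ← ENNReal.ofReal_inv_of_pos (by positivity), ← ENNReal.ofReal_mul (by positivity)]
    refine ENNReal.ofReal_le_ofReal ?_
    calc (N : ℝ)⁻¹ * (unitVol * (a * scale N) ^ 3)⁻¹ = (unitVol * a ^ 3)⁻¹ := by
          rw [mul_pow, scale_pow_three hN]; field_simp
      _ ≤ m := by rw [hm]; gcongr
  rw [mul_one] at hσ
  obtain ⟨hact, hest⟩ := hfirst hΩo hN zero_le_one hr ha0.le hcell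
    (fun i => sphere_subset_closedBall.trans (hX.subset i)) hover
  obtain ⟨ν, hprob, hdist, hν⟩ := hclose.exists_split hN hC₀ hX.injective
  have hμ' : IsSpread Ω amax m X fun i => unif (ball (X i) (a * scale N)) := by
    refine ⟨fun i => isProbabilityMeasure_unif (hcell i).volume_ne_zero
      (hcell i).volume_ne_top, fun i => ?_, hσ⟩
    refine Measure.ae_smul_measure ?_ _
    filter_upwards [ae_restrict_mem isOpen_ball.measurableSet] with y hy
    exact (mem_ball.1 hy).le.trans (by gcongr)
  have hν' : IsSpread Ω (2 * C₀) M X ν := ⟨hprob, hdist, by rwa [hν]⟩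
  refine dualDistLE_of_forall hact (hden.actsOnSobolev hΩo hp 1) fun v hv hv1 => ?_
  have h1 := hest v hv hv1
  have h2 := htransport hN (fun i => by simpa using hnorm i)
    (fun i => hX.subset i (mem_closedBall_self (mul_pos hr hs).le))
    (hμ'.mono hN (le_max_left _ _) (le_max_left _ _))
    (hν'.mono hN (le_max_right _ _) (le_max_right _ _)) v hv hv1
  rw [hν, ← cubeMeasure_eq] at h2
  rw [← edist_eq_enorm_sub] at h1 h2 ⊢
  have hcf : 0 ≤ cellFactor p r a := by unfold cellFactor; split_ifs <;> positivity
  refine (edist_triangle _ _ _).trans ((add_le_add h1 h2).trans ?_)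
  rw [← ENNReal.ofReal_add (by positivity) (by positivity), ← add_mul]
  refine ENNReal.ofReal_le_ofReal ?_
  change _ ≤ _ * scale N
  refine mul_le_mul_of_nonneg_right ?_ hs.le
  rw [Real.one_rpow, mul_one, cellFactor_eq hp0, ← hβ, add_mul]
  refine add_le_add ?_ ?_
  · rw [← mul_assoc]
    refine mul_le_mul_of_nonneg_right (mul_le_mul_of_nonneg_left ?_ (by positivity)) (by positivity)
    rw [he]
    split_ifs with h3
    · exact le_rfl
    · have : 3 / p ≤ 1 := by rw [div_le_one hp0]; linarith
      exact Real.rpow_le_rpow ha0.le haamax (by linarith)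
  · rw [mul_assoc]
    refine le_mul_of_one_le_right hB ?_
    rw [Real.rpow_neg hr.le, ← div_eq_mul_inv, one_le_div (by positivity)]
    exact Real.rpow_le_rpow hr.le hrle hβ0

end Sedimentation

end

theorem proposition2p1 (p : ℝ) (hp : 1 < p) (hp3 : p ≠ 3) :
    (∀ C₁ : ℝ, 0 < C₁ → ∃ C : ℝ,
      ∀ (Ω : Set Sedimentation.E), Sedimentation.IsContainer Ω →
      ∀ (N : ℕ) (r : ℝ) (X : Fin N → Sedimentation.E) (Q : Fin N → Set Sedimentation.E),
        Sedimentation.IsConfiguration Ω N r X →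
        Sedimentation.IsCubeFamily Ω N r C₁ X Q →
        Sedimentation.DualDistLE Ω 1 p
          (Sedimentation.sphereMeasure N r X) (Sedimentation.cubeMeasure N Q)
          (C * r ^ (-(max (3 / p - 1) 0)) * (N : ℝ) ^ (-(1 / 3 : ℝ))) ∧
        (3 / 2 < p → Sedimentation.DualDistLE Ω 2 p
          (Sedimentation.sphereMeasure N r X) (Sedimentation.cubeMeasure N Q)
          (C * (N : ℝ) ^ (-(2 / 3 : ℝ))))) ∧
    (∀ (Ω : Set Sedimentation.E), Sedimentation.IsContainer Ω →
      ∀ (K : Set Sedimentation.E), IsCompact K → K ⊆ closure Ω →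
      ∀ C₀ c C₁ : ℝ, 0 < C₀ → 0 < c → 0 < C₁ → ∃ C : ℝ,
      ∀ (n : Sedimentation.E → ℝ), Sedimentation.IsBoundedDensity Ω n →
      ∀ (I : Set ℕ), I.Infinite →
      ∀ (r : ℝ) (X : (N : ℕ) → Fin N → Sedimentation.E)
        (Q : (N : ℕ) → Fin N → Set Sedimentation.E),
        (∀ N ∈ I, Sedimentation.IsConfiguration Ω N r (X N) ∧
          Sedimentation.IsCubeFamily Ω N r C₁ (X N) (Q N) ∧
          Sedimentation.IsSeparated Ω N c (X N) ∧
          Sedimentation.IsCloseTo Ω n N C₀ (X N) ∧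
          ∀ i, X N i ∈ K) →
        ∀ N ∈ I, Sedimentation.DualDistLE Ω 1 p
          (Sedimentation.cubeMeasure N (Q N)) (Sedimentation.densityMeasure Ω n)
          (C * (N : ℝ) ^ (-(1 / 3 : ℝ)))) ∧
    (∀ (Ω : Set Sedimentation.E), Sedimentation.IsContainer Ω →
      ∀ (n : Sedimentation.E → ℝ), Sedimentation.IsBoundedDensity Ω n →
      ∀ C₀ c : ℝ, 0 < C₀ → 0 < c → ∃ C : ℝ,
      ∀ (C₁ : ℝ), 0 < C₁ →
      ∀ (N : ℕ) (r : ℝ) (X : Fin N → Sedimentation.E) (Q : Fin N → Set Sedimentation.E),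
        Sedimentation.IsConfiguration Ω N r X →
        Sedimentation.IsCubeFamily Ω N r C₁ X Q →
        Sedimentation.IsSeparated Ω N c X →
        Sedimentation.IsCloseTo Ω n N C₀ X →
        Sedimentation.DualDistLE Ω 1 p
          (Sedimentation.sphereMeasure N r X) (Sedimentation.densityMeasure Ω n)
          (C * r ^ (-(max (3 / p - 1) 0)) * (N : ℝ) ^ (-(1 / 3 : ℝ)))) := by
  refine ⟨fun C₁ hC₁ => Sedimentation.exists_dualDistLE_sphereMeasure_cubeMeasure hp hp3 hC₁,
    fun Ω hΩ K hK _ C₀ c C₁ hC₀ hc hC₁ =>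
      Sedimentation.exists_dualDistLE_cubeMeasure_densityMeasure hp hΩ hK hC₀ hc hC₁,
    fun Ω hΩ n hn C₀ c hC₀ hc => ?_⟩
  obtain ⟨C, hC⟩ :=
    Sedimentation.exists_dualDistLE_sphereMeasure_densityMeasure hp hp3 hΩ hn hC₀ hc
  exact ⟨C, fun _ _ N r X _ hX _ hsep hclose => hC N r X hX hsep hclose⟩
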